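/- Let $d\ge 2$ and let $f_0,f_1,f_2\in\mathbb{C}[s,t]$ be homogeneous polynomials of degree $d$ without common zero in $\mathbb{C}^2\setminus\{0\}$. Let $\phi:\mathbb{P}^1\to\mathbb{P}^2$, $(s:t)\mapsto(f_0:f_1:f_2)$, and assume that $\phi$ is generically $1$-to-$1$ onto its image $\mathcal{C}$, that is, all but finitely many points of $\mathcal{C}$ have exactly one preimage. Let $F=0$ be a reduced homogeneous equation of the plane curve $\mathcal{C}$. The dual curve $\mathcal{C}^\vee\subset(\mathbb{P}^2)^\vee$ is the Zariski closure of the set of points $(F_x(P):F_y(P):F_z(P))$, where $P$ runs over the smooth points of $\mathcal{C}$; let $d^\vee$ denote its degree. For $0\le i<j\le 2$ let $$m_{ij}=\partial_s f_i\,\partial_t f_j-\partial_s f_j\,\partial_t f_i$$ be the $2\times 2$ minors of the Jacobian matrix of $\phi$, let $A=\gcd(m_{01},m_{02},m_{12})$, write $m_{ij}=A\,m_{ij}'$, and set $$(f_0^\vee,f_1^\vee,f_2^\vee)=(m_{12}',-m_{02}',m_{01}').$$ Then $\mathcal{C}^\vee$ is a plane curve, and the three polynomials $f_0^\vee,f_1^\vee,f_2^\vee$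 are homogeneous of degree $d^\vee$, have no common zero in $\mathbb{C}^2\setminus\{0\}$, and define a regular map $\phi^\vee:\mathbb{P}^1\to(\mathbb{P}^2)^\vee$ whose image is $\mathcal{C}^\vee$ and which is generically $1$-to-$1$ onto $\mathcal{C}^\vee$. Consequently, $\mathcal{C}$ has finitely many singular points and $$\deg A=\sum_P(m_P-r_P),$$ where the sum is over the singular points $P$ of $\mathcal{C}$, $m_P$ is the multiplicity of $\mathcal{C}$ at $P$, and $r_P$ is the number of branches of $\mathcal{C}$ at $P$, that is, the number of points of the normalization of $\mathcal{C}$ lying over $P$. -/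

import Mathlib

namespace RationalPlaneCurve

open MvPolynomial

/-- The complex projective line, with homogeneous coordinates `(s : t)`. -/
abbrev P1 : Type := Projectivization ℂ (Fin 2 → ℂ)

/-- The complex projective plane, with homogeneous coordinates `(x : y : z)`. It also serves as
the dual plane, the point `(a : b : c)` standing for the line `a x + b y + c z = 0`. -/
abbrev P2 : Type := Projectivization ℂ (Fin 3 → ℂ)

/-- The polynomials `f 0, f 1, f 2` have no common zero in `ℂ² \ {0}`, so that (when they are
homogeneous of one degree) they define a regular map on the whole of the projective line. -/
def NoCommonZero (f : Fin 3 → MvPolynomial (Fin 2) ℂ) : Prop :=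
  ∀ v : Fin 2 → ℂ, v ≠ 0 → (fun i => eval v (f i)) ≠ 0

/-- The map `(s : t) ↦ (f 0 (s, t) : f 1 (s, t) : f 2 (s, t))`. It is evaluated at a chosen
representative of `(s : t)`; see `projMap_mk` for the independence of this choice. -/
noncomputable def projMap (f : Fin 3 → MvPolynomial (Fin 2) ℂ) (hf : NoCommonZero f) (Q : P1) : P2 :=
  Projectivization.mk ℂ (fun i => eval Q.rep (f i)) (hf Q.rep Q.rep_nonzero)

theorem eval_smul_of_isHomogeneous {n d : ℕ} {p : MvPolynomial (Fin n) ℂ}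
    (hp : p.IsHomogeneous d) (a : ℂ) (v : Fin n → ℂ) :
    eval (a • v) p = a ^ d * eval v p := by
  rw [eval_eq, eval_eq, Finset.mul_sum]
  refine Finset.sum_congr rfl fun m hm => ?_
  have h : ∑ i ∈ m.support, m i = d := by
    have := hp (mem_support_iff.mp hm)
    rw [Finsupp.weight_apply] at this
    simpa [Finsupp.sum] using this
  simp only [Pi.smul_apply, smul_eq_mul, mul_pow, Finset.prod_mul_distrib,
    Finset.prod_pow_eq_pow_sum, h]
  ring

theorem projMap_mk {d : ℕ} (f : Fin 3 → MvPolynomial (Fin 2) ℂ) (hd : ∀ i, (f i).IsHomogeneous d)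
    (hf : NoCommonZero f) (v : Fin 2 → ℂ) (hv : v ≠ 0) :
    projMap f hf (Projectivization.mk ℂ v hv) =
      Projectivization.mk ℂ (fun i => eval v (f i)) (hf v hv) := by
  obtain ⟨a, ha⟩ := Projectivization.exists_smul_eq_mk_rep ℂ v hv
  unfold projMap
  rw [Projectivization.mk_eq_mk_iff']
  refine ⟨(a : ℂ) ^ d, ?_⟩
  funext i
  have h := eval_smul_of_isHomogeneous (hd i) (a : ℂ) v
  rw [← ha]
  exact h.symm

/-- A map from the projective line to the plane is generically one-to-one if all but finitely
many points of its image have exactly one preimage. -/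
def GenericallyOneToOne (φ : P1 → P2) : Prop :=
  {P : P2 | P ∈ Set.range φ ∧ ¬ ∃! Q : P1, φ Q = P}.Finite

/-- The zero locus in the plane of a homogeneous polynomial. -/
def curvePoints (F : MvPolynomial (Fin 3) ℂ) : Set P2 := {P | eval P.rep F = 0}

/-- `Z` is the plane curve with reduced equation `F = 0`; the degree of the curve is then the
degree of `F`. -/
def IsReducedEquation (F : MvPolynomial (Fin 3) ℂ) (Z : Set P2) : Prop :=
  F.IsHomogeneous F.totalDegree ∧ Squarefree F ∧ curvePoints F = Z

/-- The gradient of `F` at `v`. -/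
noncomputable def gradient (F : MvPolynomial (Fin 3) ℂ) (v : Fin 3 → ℂ) : Fin 3 → ℂ :=
  fun i => eval v (pderiv i F)

/-- The singular points of the curve with reduced equation `F = 0`. -/
def singularPoints (F : MvPolynomial (Fin 3) ℂ) : Set P2 :=
  {P | P ∈ curvePoints F ∧ gradient F P.rep = 0}

/-- The Zariski closure of a subset of the plane. -/
def zariskiClosure (Z : Set P2) : Set P2 :=
  {L | ∀ (n : ℕ) (G : MvPolynomial (Fin 3) ℂ), G.IsHomogeneous n → (∀ P ∈ Z, P ∈ curvePoints G) → L ∈ curvePoints G}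

/-- The dual curve of the curve with reduced equation `F = 0`: the closure in the dual plane of the
image of the smooth part of the curve under the polar map `P ↦ (F_x(P) : F_y(P) : F_z(P))`. -/
def dualCurve (F : MvPolynomial (Fin 3) ℂ) : Set P2 :=
  zariskiClosure {L | ∃ P ∈ curvePoints F, ∃ h : gradient F P.rep ≠ 0,
    L = Projectivization.mk ℂ (gradient F P.rep) h}

/-- The minor `∂_s f_i ∂_t f_j - ∂_s f_j ∂_t f_i` of the Jacobian matrix of `f`. -/
noncomputable def minor (f : Fin 3 → MvPolynomial (Fin 2) ℂ) (i j : Fin 3) :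
    MvPolynomial (Fin 2) ℂ :=
  pderiv 0 (f i) * pderiv 1 (f j) - pderiv 0 (f j) * pderiv 1 (f i)

theorem exists_rep_ne_zero (P : P2) : ∃ i, P.rep i ≠ 0 :=
  Function.ne_iff.mp P.rep_nonzero

/-- The index of a coordinate that does not vanish at `P`. -/
noncomputable def chartIndex (P : P2) : Fin 3 := Classical.choose (exists_rep_ne_zero P)

/-- The equation of the curve `F = 0` in affine coordinates centred at `P`: with `v` a
representative of `P` and `v i ≠ 0`, it is `F (v + X₀ e_j + X₁ e_k)`, where `j < k` are the two
indices other than `i`. -/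
noncomputable def localEquation (F : MvPolynomial (Fin 3) ℂ) (P : P2) : MvPolynomial (Fin 2) ℂ :=
  aeval (fun j => C (P.rep j) + (chartIndex P).insertNth (α := fun _ => MvPolynomial (Fin 2) ℂ)
    0 (fun k => X k) j) F

/-- The multiplicity `m_P` of the curve `F = 0` at `P`: the least degree of a nonzero homogeneous
component of its equation in affine coordinates centred at `P`. -/
noncomputable def multiplicityAt (F : MvPolynomial (Fin 3) ℂ) (P : P2) : ℕ :=
  sInf {k | homogeneousComponent k (localEquation F P) ≠ 0}

/-- The coordinate ring of the affine part of the curve `F = 0` around `P`. -/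
abbrev AffineRing (F : MvPolynomial (Fin 3) ℂ) (P : P2) : Type :=
  MvPolynomial (Fin 2) ℂ ⧸ Ideal.span {localEquation F P}

/-- The ideal of `P` in that coordinate ring, generated by the two coordinates centred at `P`. -/
noncomputable def pointIdeal (F : MvPolynomial (Fin 3) ℂ) (P : P2) : Ideal (AffineRing F P) :=
  Ideal.span (Set.range fun k : Fin 2 => Ideal.Quotient.mk _ (X k))

/-- The coordinate ring of the normalization of that affine part: the integral closure of the
coordinate ring in its total ring of fractions. -/
abbrev NormalizedRing (F : MvPolynomial (Fin 3) ℂ) (P : P2) : Type :=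
  integralClosure (AffineRing F P) (FractionRing (AffineRing F P))

/-- The number `r_P` of branches of the curve `F = 0` at `P`: the number of points of the
normalization of the curve that lie over `P`. -/
noncomputable def branchesAt (F : MvPolynomial (Fin 3) ℂ) (P : P2) : ℕ :=
  ((pointIdeal F P).primesOver (NormalizedRing F P)).ncard

end RationalPlaneCurve

open RationalPlaneCurve

/-!
Write `g` for the vector of the reduced minors. A generically one-to-one map of degree at least two
does not have its image in a line (`linearIndependent_of_genericallyOneToOne`), and then all the
minors of the Jacobian matrix are nonzero. The relations between the `f i` are the multiples of one
irreducible form (`exists_generator_of_relations`), whose zero set is exactly the image: a point of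
the zero set lies under a point of the normalization of an affine chart, which is `ℂ[X, 1 / G]`
with `X` a parameter on the line (`IsParametrized.isLocalization_integralClosure`,
`IsEquation.curvePoints_eq`). By the Nullstellensatz `F` is this form, up to a constant.

Differentiating `F(f) = 0` shows that the gradient of `F` along the curve is orthogonal to both
partial derivatives of `f`. So is `g`, hence the gradient is `H g` for a nonzero form `H`
(`IsEquation.exists_gradient_eq`), and the dual curve is the image of `g`
(`IsEquation.dualCurve_eq`). Conversely `f` is orthogonal to both partial derivatives of `g`, so
the same argument applied to `g` gives back `f`. This is biduality: a general point of the dual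
curve determines a point of the curve, so `g` is generically one-to-one with `f`
(`IsEquation.genericallyOneToOne`).

The degree of the image of a generically one-to-one map is the degree of the map
(`IsEquation.totalDegree_eq`). A general line of given direction `x₁ - l x₀ = e` meets the image in
as many distinct points as the degree of the map. In the other direction, the function field of the
projective line has that degree over `ℂ(x₁ - l x₀)`, and the powers of `x₀` with exponent below
`deg F` are independent there. Applied to `g`, this gives the degree of the dual curve. Applied to
`f`, the equality of the two bounds shows that the parametrization is birational
(`Chart.isFractionRing`), so that the branches at `P` are the parameters over `P`
(`Chart.branchesAt_eq`).

A general line through `P` meets the curve at `P` with multiplicity `m_P`. The norm formula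
`Chart.eval_lineRestrict_mul_prod` turns this into a count of roots of a polynomial in the
parameter, and `m_P` is the sum over the parameters of `P` of the orders of vanishing of the
parametrization, in coordinates centred at `P` (`Chart.multiplicityAt_eq`). By Euler's identity the
minors restrict, up to constants, to Wronskians. If the parametrization vanishes to order `r` at a
parameter, then `r - 1` is the least order of these Wronskians there, and it is the order of `A`
because the components of `g` have no common zero (`Chart.vanishingOrder_add_one`). Hence the zeros
of `A` over `P` number `m_P - r_P`, with multiplicity, and `deg A` is the sum of these numbers. At
a smooth point both terms are one, so only the singular points contribute
(`totalDegree_eq_finsum`).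
-/

namespace RationalPlaneCurve

open MvPolynomial

/-! ### Forms along a parametrized line -/

/-- The restriction of a polynomial to the affine line `τ ↦ τ a + b`, as a polynomial in `τ`. -/
noncomputable def lineRestrict {n : ℕ} (a b : Fin n → ℂ) :
    MvPolynomial (Fin n) ℂ →ₐ[ℂ] Polynomial ℂ :=
  aeval fun i => Polynomial.C (b i) + Polynomial.C (a i) * Polynomial.X

@[simp]
theorem lineRestrict_X {n : ℕ} (a b : Fin n → ℂ) (i : Fin n) :
    lineRestrict a b (X i) = Polynomial.C (b i) + Polynomial.C (a i) * Polynomial.X := by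
  simp [lineRestrict]

@[simp]
theorem lineRestrict_C {n : ℕ} (a b : Fin n → ℂ) (c : ℂ) :
    lineRestrict a b (C c) = Polynomial.C c := by
  simp [lineRestrict]

theorem eval_lineRestrict {n : ℕ} (a b : Fin n → ℂ) (h : MvPolynomial (Fin n) ℂ) (τ : ℂ) :
    (lineRestrict a b h).eval τ = eval (τ • a + b) h := by
  induction h using MvPolynomial.induction_on with
  | C c => simp
  | add p q hp hq => simp [hp, hq]
  | mul_X p i hp => simp [hp]; ring_nf; simp

theorem natDegree_prod_linear_le_and_coeff {n : ℕ} (a b : Fin n → ℂ) (m : Fin n → ℕ)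
    (s : Finset (Fin n)) :
    (∏ i ∈ s, (Polynomial.C (b i) + Polynomial.C (a i) * Polynomial.X) ^ m i).natDegree
        ≤ ∑ i ∈ s, m i ∧
      (∏ i ∈ s, (Polynomial.C (b i) + Polynomial.C (a i) * Polynomial.X) ^ m i).coeff
        (∑ i ∈ s, m i) = ∏ i ∈ s, a i ^ m i := by
  classical
  have hlin : ∀ i, (Polynomial.C (b i) + Polynomial.C (a i) * Polynomial.X).natDegree ≤ 1 := by
    intro i
    rw [add_comm]
    exact Polynomial.natDegree_linear_le
  induction s using Finset.induction_on with
  | empty => simp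
  | insert i s hi ih =>
    simp only [Finset.prod_insert hi, Finset.sum_insert hi]
    have h1 : ((Polynomial.C (b i) + Polynomial.C (a i) * Polynomial.X) ^ m i).natDegree
        ≤ m i := by
      simpa using Polynomial.natDegree_pow_le_of_le (m i) (hlin i)
    refine ⟨Polynomial.natDegree_mul_le_of_le h1 ih.1, ?_⟩
    rw [Polynomial.coeff_mul_add_eq_of_natDegree_le h1 ih.1, ih.2]
    congr 1
    have := Polynomial.coeff_pow_of_natDegree_le (m := m i) (hlin i)
    simpa using this

theorem sum_eq_of_mem_support {n d : ℕ} {p : MvPolynomial (Fin n) ℂ} (hp : p.IsHomogeneous d)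
    {m : Fin n →₀ ℕ} (hm : m ∈ p.support) : ∑ i, m i = d := by
  rw [hp.degree_eq_sum_deg_support hm]
  exact (Finset.sum_subset (Finset.subset_univ _) fun i _ hi => by simpa using hi).symm

theorem natDegree_lineRestrict_le_and_coeff {n d : ℕ} (a b : Fin n → ℂ)
    {h : MvPolynomial (Fin n) ℂ} (hh : h.IsHomogeneous d) :
    (lineRestrict a b h).natDegree ≤ d ∧ (lineRestrict a b h).coeff d = eval a h := by
  have hsum := fun m => sum_eq_of_mem_support hh (m := m)
  have key : lineRestrict a b h = ∑ m ∈ h.support, Polynomial.C (coeff m h) *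
      ∏ i, (Polynomial.C (b i) + Polynomial.C (a i) * Polynomial.X) ^ m i := by
    unfold lineRestrict
    rw [aeval_def, eval₂_eq']
    rfl
  rw [key]
  constructor
  · refine Polynomial.natDegree_sum_le_of_forall_le _ _ fun m hm => ?_
    refine (Polynomial.natDegree_C_mul_le _ _).trans ?_
    rw [← hsum m hm]
    exact (natDegree_prod_linear_le_and_coeff a b m Finset.univ).1
  · rw [Polynomial.finsetSum_coeff, eval_eq']
    refine Finset.sum_congr rfl fun m hm => ?_
    rw [Polynomial.coeff_C_mul, ← hsum m hm,
      (natDegree_prod_linear_le_and_coeff a b m Finset.univ).2]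

theorem natDegree_lineRestrict_le {n d : ℕ} (a b : Fin n → ℂ)
    {h : MvPolynomial (Fin n) ℂ} (hh : h.IsHomogeneous d) :
    (lineRestrict a b h).natDegree ≤ d :=
  (natDegree_lineRestrict_le_and_coeff a b hh).1

theorem coeff_lineRestrict {n d : ℕ} (a b : Fin n → ℂ)
    {h : MvPolynomial (Fin n) ℂ} (hh : h.IsHomogeneous d) :
    (lineRestrict a b h).coeff d = eval a h :=
  (natDegree_lineRestrict_le_and_coeff a b hh).2

/-- The determinant of two vectors of the plane. -/
def det2 (a b : Fin 2 → ℂ) : ℂ := a 0 * b 1 - a 1 * b 0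

theorem exists_det2_ne_zero {a : Fin 2 → ℂ} (ha : a ≠ 0) : ∃ b, det2 a b ≠ 0 := by
  obtain ⟨i, hi⟩ := Function.ne_iff.mp ha
  fin_cases i
  · exact ⟨![0, 1], by simpa [det2] using hi⟩
  · exact ⟨![-1, 0], by simpa [det2] using hi⟩

theorem eq_smul_add_smul_of_det2 {a b : Fin 2 → ℂ} (hab : det2 a b ≠ 0) (v : Fin 2 → ℂ) :
    v = (det2 v b / det2 a b) • a + (det2 a v / det2 a b) • b := by
  have h : ∀ i, v i = det2 v b / det2 a b * a i + det2 a v / det2 a b * b i := by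
    intro i
    rw [div_mul_eq_mul_div, div_mul_eq_mul_div, ← add_div, eq_div_iff hab]
    unfold det2
    fin_cases i <;> simp <;> ring
  funext i
  simpa using h i

theorem smul_add_ne_zero {a b : Fin 2 → ℂ} (hab : det2 a b ≠ 0) (τ : ℂ) : τ • a + b ≠ 0 := by
  intro h
  have h0 := congrFun h 0
  have h1 := congrFun h 1
  simp only [Pi.add_apply, Pi.smul_apply, smul_eq_mul, Pi.zero_apply] at h0 h1
  apply hab
  unfold det2
  linear_combination a 0 * h1 - a 1 * h0

/-- A binary form is determined by its restriction to a line that avoids the origin. -/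
theorem eq_zero_of_lineRestrict_eq_zero {n : ℕ} {a b : Fin 2 → ℂ} (hab : det2 a b ≠ 0)
    {h : MvPolynomial (Fin 2) ℂ} (hh : h.IsHomogeneous n) (h0 : lineRestrict a b h = 0) :
    h = 0 := by
  refine MvPolynomial.funext fun v => ?_
  rw [map_zero, eq_smul_add_smul_of_det2 hab v]
  by_cases hy : det2 a v / det2 a b = 0
  · rw [hy, zero_smul, add_zero, eval_smul_of_isHomogeneous hh, ← coeff_lineRestrict a b hh, h0]
    simp
  · have : (det2 v b / det2 a b) • a + (det2 a v / det2 a b) • b =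
        (det2 a v / det2 a b) • ((det2 v b / det2 a b / (det2 a v / det2 a b)) • a + b) := by
      rw [smul_add, smul_smul, mul_div_cancel₀ _ hy]
    rw [this, eval_smul_of_isHomogeneous hh, ← eval_lineRestrict, h0]
    simp

/-- Over `ℂ` a binary form of positive degree has a nontrivial zero. -/
theorem exists_eval_eq_zero {n : ℕ} (hn : 0 < n) {h : MvPolynomial (Fin 2) ℂ}
    (hh : h.IsHomogeneous n) : ∃ v : Fin 2 → ℂ, v ≠ 0 ∧ eval v h = 0 := by
  by_cases h0 : eval ![1, 0] h = 0
  · exact ⟨![1, 0], fun h => by simpa using congrFun h 0, h0⟩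
  have hab : det2 ![1, 0] ![0, 1] ≠ 0 := by simp [det2]
  rw [← coeff_lineRestrict ![1, 0] ![0, 1] hh] at h0
  have hdeg : (lineRestrict ![1, 0] ![0, 1] h).degree ≠ 0 := by
    intro h1
    have h2 := Polynomial.natDegree_eq_of_degree_eq_some (n := 0) h1
    exact h0 (Polynomial.coeff_eq_zero_of_natDegree_lt (by omega))
  obtain ⟨τ, hτ⟩ := IsAlgClosed.exists_root _ hdeg
  refine ⟨_, smul_add_ne_zero hab τ, ?_⟩
  rw [← eval_lineRestrict]
  exact hτ

/-! ### Homogeneous factors -/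

/-- The ring map `X i ↦ X i * T`, whose coefficients are the homogeneous components. -/
noncomputable def gradingHom {n : ℕ} :
    MvPolynomial (Fin n) ℂ →ₐ[ℂ] Polynomial (MvPolynomial (Fin n) ℂ) :=
  aeval fun i => Polynomial.C (X i) * Polynomial.X

theorem gradingHom_of_isHomogeneous {n d : ℕ} {p : MvPolynomial (Fin n) ℂ}
    (hp : p.IsHomogeneous d) : gradingHom p = Polynomial.C p * Polynomial.X ^ d := by
  have hsum := fun m => sum_eq_of_mem_support hp (m := m)
  have : ∀ m ∈ p.support, gradingHom (monomial m (coeff m p)) =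
      Polynomial.C (monomial m (coeff m p)) * Polynomial.X ^ d := by
    intro m hm
    unfold gradingHom
    rw [aeval_monomial, monomial_eq, Finsupp.prod_fintype _ _ (by simp),
      Finsupp.prod_fintype _ _ (by simp)]
    simp only [mul_pow, Finset.prod_mul_distrib, Finset.prod_pow_eq_pow_sum, hsum m hm]
    simp [mul_assoc]
  conv_lhs => rw [p.as_sum]
  conv_rhs => rw [p.as_sum]
  rw [map_sum, map_sum, Finset.sum_mul]
  exact Finset.sum_congr rfl this

theorem coeff_gradingHom {n : ℕ} (p : MvPolynomial (Fin n) ℂ) (k : ℕ) :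
    (gradingHom p).coeff k = homogeneousComponent k p := by
  conv_lhs => rw [← sum_homogeneousComponent p]
  rw [map_sum, Polynomial.finsetSum_coeff]
  have : ∀ i, (gradingHom (homogeneousComponent i p)).coeff k =
      if k = i then homogeneousComponent i p else 0 := by
    intro i
    rw [gradingHom_of_isHomogeneous (homogeneousComponent_isHomogeneous i p),
      Polynomial.coeff_C_mul_X_pow]
  simp only [this, Finset.sum_ite_eq, Finset.mem_range]
  split_ifs with h
  · rfl
  · exact (homogeneousComponent_eq_zero _ _ (by omega)).symm

/-- The factors of a nonzero form are forms: for the grading by `gradingHom` the lowest and the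
highest degree of a product are the sums of those of its factors. -/
theorem isHomogeneous_of_mul {n N : ℕ} {p q : MvPolynomial (Fin n) ℂ}
    (h : (p * q).IsHomogeneous N) (h0 : p * q ≠ 0) :
    p.IsHomogeneous p.totalDegree ∧ q.IsHomogeneous q.totalDegree := by
  have hinj : ∀ r : MvPolynomial (Fin n) ℂ, gradingHom r = 0 → r = 0 := by
    intro r hr
    rw [← sum_homogeneousComponent r]
    exact Finset.sum_eq_zero fun i _ => by rw [← coeff_gradingHom, hr, Polynomial.coeff_zero]
  have key : gradingHom p * gradingHom q = Polynomial.C (p * q) * Polynomial.X ^ N := by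
    rw [← map_mul, gradingHom_of_isHomogeneous h]
  have hp0 : gradingHom p ≠ 0 := fun hp => h0 (by rw [hinj p hp, zero_mul])
  have hq0 : gradingHom q ≠ 0 := fun hq => h0 (by rw [hinj q hq, mul_zero])
  have hdeg := congrArg Polynomial.natDegree key
  have htr := congrArg Polynomial.natTrailingDegree key
  rw [Polynomial.natDegree_mul hp0 hq0, Polynomial.natDegree_C_mul_X_pow _ _ h0] at hdeg
  rw [Polynomial.natTrailingDegree_mul hp0 hq0, Polynomial.C_mul_X_pow_eq_monomial,
    Polynomial.natTrailingDegree_monomial h0] at htr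
  have h1 := Polynomial.natTrailingDegree_le_natDegree (gradingHom p)
  have h2 := Polynomial.natTrailingDegree_le_natDegree (gradingHom q)
  have main : ∀ r : MvPolynomial (Fin n) ℂ, gradingHom r ≠ 0 →
      (gradingHom r).natTrailingDegree = (gradingHom r).natDegree →
      r.IsHomogeneous r.totalDegree := by
    intro r hr hrd
    have : r = homogeneousComponent (gradingHom r).natDegree r := by
      conv_lhs => rw [← sum_homogeneousComponent r]
      rw [Finset.sum_eq_single (gradingHom r).natDegree]
      · intro i _ hi
        rw [← coeff_gradingHom]
        rcases lt_or_gt_of_ne hi with h | h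
        · exact Polynomial.coeff_eq_zero_of_lt_natTrailingDegree (by omega)
        · exact Polynomial.coeff_eq_zero_of_natDegree_lt h
      · intro hi
        exact homogeneousComponent_eq_zero _ _ (by simpa using hi)
    have hh : r.IsHomogeneous (gradingHom r).natDegree := by
      rw [this]
      convert homogeneousComponent_isHomogeneous _ r using 2
      rw [← this]
    rwa [hh.totalDegree (fun h => hr (by rw [h, map_zero]))]
  exact ⟨main p hp0 (by omega), main q hq0 (by omega)⟩

/-! ### Chain rule -/

theorem derivation_aeval {σ : Type*} [Fintype σ] {S : Type*} [CommRing S] [Algebra ℂ S]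
    (D : Derivation ℂ S S) (g : σ → S) (p : MvPolynomial σ ℂ) :
    D (aeval g p) = ∑ i, aeval g (pderiv i p) * D (g i) := by
  classical
  induction p using MvPolynomial.induction_on with
  | C c => simp
  | add p q hp hq => simp [hp, hq, add_mul, Finset.sum_add_distrib]
  | mul_X p j hp =>
    simp only [map_mul, aeval_X, Derivation.leibniz, hp, smul_eq_mul, pderiv_X, map_add,
      add_mul, Finset.sum_add_distrib]
    congr 1
    · rw [Finset.sum_eq_single j]
      · simp
      · intro i _ hi
        simp [hi.symm]
      · simp
    · rw [Finset.mul_sum]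
      exact Finset.sum_congr rfl fun i _ => by ring

theorem derivative_lineRestrict {n : ℕ} (a b : Fin n → ℂ) (h : MvPolynomial (Fin n) ℂ) :
    Polynomial.derivative (lineRestrict a b h) =
      ∑ i, Polynomial.C (a i) * lineRestrict a b (pderiv i h) := by
  have := derivation_aeval (Polynomial.derivative' (R := ℂ))
    (fun i => Polynomial.C (b i) + Polynomial.C (a i) * Polynomial.X) h
  simp only [Polynomial.derivative'_apply] at this
  unfold lineRestrict
  rw [this]
  refine Finset.sum_congr rfl fun i _ => ?_
  rw [mul_comm, Polynomial.derivative_add, Polynomial.derivative_C, Polynomial.derivative_C_mul,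
    Polynomial.derivative_X, zero_add, mul_one]

/-- The Jacobian determinant of two polynomials in two variables. -/
noncomputable def jacobian (g h : MvPolynomial (Fin 2) ℂ) : MvPolynomial (Fin 2) ℂ :=
  pderiv 0 g * pderiv 1 h - pderiv 0 h * pderiv 1 g

theorem isHomogeneous_jacobian {d : ℕ} {g h : MvPolynomial (Fin 2) ℂ}
    (hg : g.IsHomogeneous d) (hh : h.IsHomogeneous d) :
    (jacobian g h).IsHomogeneous (2 * (d - 1)) := by
  rw [two_mul]
  exact (hg.pderiv.mul hh.pderiv).sub (hh.pderiv.mul hg.pderiv)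

/-- By Euler's identity the Jacobian determinant of two forms of the same degree restricts, on an
affine line, to a multiple of the Wronskian of their restrictions. -/
theorem wronskian_lineRestrict {d : ℕ} {g h : MvPolynomial (Fin 2) ℂ}
    (hg : g.IsHomogeneous d) (hh : h.IsHomogeneous d) (a b : Fin 2 → ℂ) :
    Polynomial.C (d : ℂ) * Polynomial.wronskian (lineRestrict a b g) (lineRestrict a b h) =
      Polynomial.C (-det2 a b) * lineRestrict a b (jacobian g h) := by
  have euler : ∀ k : MvPolynomial (Fin 2) ℂ, k.IsHomogeneous d →
      Polynomial.C (d : ℂ) * lineRestrict a b k =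
      (Polynomial.C (b 0) + Polynomial.C (a 0) * Polynomial.X) * lineRestrict a b (pderiv 0 k) +
      (Polynomial.C (b 1) + Polynomial.C (a 1) * Polynomial.X) *
        lineRestrict a b (pderiv 1 k) := by
    intro k hk
    have := congrArg (lineRestrict a b) hk.sum_X_mul_pderiv
    simp only [Fin.sum_univ_two, map_add, map_mul, lineRestrict_X, map_nsmul] at this
    rw [this]
    simp
  have hi := euler g hg
  have hj := euler h hh
  simp only [Polynomial.wronskian, derivative_lineRestrict, Fin.sum_univ_two, jacobian, map_sub,
    map_mul, det2, map_neg]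
  linear_combination (Polynomial.C (a 0) * lineRestrict a b (pderiv 0 h) +
    Polynomial.C (a 1) * lineRestrict a b (pderiv 1 h)) * hi -
    (Polynomial.C (a 0) * lineRestrict a b (pderiv 0 g) +
    Polynomial.C (a 1) * lineRestrict a b (pderiv 1 g)) * hj

/-! ### Generic fibres of a rational function -/

/-- All but finitely many values of a rational function `P / G` with `deg G < deg P` are taken at
simple points only: a multiple point of a fibre is a zero of the Wronskian of `P` and `G`. -/
theorem finite_setOf_not_nodup_roots {P G : Polynomial ℂ} (hdeg : G.natDegree < P.natDegree)
    (hcop : IsCoprime P G) : {c : ℂ | ¬ (P - Polynomial.C c * G).roots.Nodup}.Finite := by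
  classical
  have hW : Polynomial.wronskian P G ≠ 0 := by
    intro h
    have := Polynomial.derivative_eq_zero.mp (hcop.wronskian_eq_zero_iff.mp h).1
    omega
  refine ((Polynomial.wronskian P G).roots.toFinset.finite_toSet.image
    (fun τ => P.eval τ / G.eval τ)).subset ?_
  intro c hc
  have hne : P - Polynomial.C c * G ≠ 0 := by
    intro h
    have h1 := congrArg Polynomial.natDegree (sub_eq_zero.mp h)
    have h2 := Polynomial.natDegree_C_mul_le c G
    omega
  simp only [Set.mem_ofPred_eq, Multiset.nodup_iff_count_le_one, not_forall, not_le,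
    Polynomial.count_roots, Polynomial.one_lt_rootMultiplicity_iff_isRoot hne,
    Polynomial.IsRoot.def, Polynomial.eval_sub, Polynomial.derivative_sub,
    Polynomial.derivative_C_mul, Polynomial.eval_mul, Polynomial.eval_C] at hc
  obtain ⟨τ, h1, h2⟩ := hc
  have hG : G.eval τ ≠ 0 := by
    intro hG
    rw [hG, mul_zero, sub_zero] at h1
    obtain ⟨x, y, hxy⟩ := hcop
    have := congrArg (Polynomial.eval τ) hxy
    simp [h1, hG] at this
  refine ⟨τ, ?_, ?_⟩
  · rw [Finset.mem_coe, Multiset.mem_toFinset, Polynomial.mem_roots hW,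
      Polynomial.IsRoot.def, Polynomial.wronskian, Polynomial.eval_sub, Polynomial.eval_mul,
      Polynomial.eval_mul]
    linear_combination Polynomial.eval τ (Polynomial.derivative G) * h1 - G.eval τ * h2
  · simp only
    rw [div_eq_iff hG]
    linear_combination h1

theorem natDegree_sub_C_mul {P G : Polynomial ℂ} (hdeg : G.natDegree < P.natDegree) (c : ℂ) :
    (P - Polynomial.C c * G).natDegree = P.natDegree :=
  Polynomial.natDegree_sub_eq_left_of_natDegree_lt
    ((Polynomial.natDegree_C_mul_le c G).trans_lt hdeg)

theorem card_roots_sub_C_mul {P G : Polynomial ℂ} (hdeg : G.natDegree < P.natDegree) (c : ℂ) :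
    Multiset.card (P - Polynomial.C c * G).roots = P.natDegree := by
  rw [IsAlgClosed.card_roots_eq_natDegree, natDegree_sub_C_mul hdeg]

theorem isCoprime_of_no_common_root {P G : Polynomial ℂ}
    (h : ∀ τ, P.eval τ = 0 → G.eval τ ≠ 0) : IsCoprime P G := by
  rw [Polynomial.isCoprime_iff_aeval_ne_zero_of_isAlgClosed ℂ ℂ]
  intro τ
  by_contra! hc
  exact h τ (by simpa using hc.1) (by simpa using hc.2)

/-- Two polynomials over `ℂ` with vanishing Wronskian are linearly dependent. -/
theorem exists_of_wronskian_eq_zero {P Q : Polynomial ℂ} (h : Polynomial.wronskian P Q = 0) :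
    ∃ α β : ℂ, (α ≠ 0 ∨ β ≠ 0) ∧ Polynomial.C α * P + Polynomial.C β * Q = 0 := by
  classical
  by_cases hP : P = 0
  · exact ⟨1, 0, by simp, by simp [hP]⟩
  have hg : EuclideanDomain.gcd P Q ≠ 0 := fun h => hP (EuclideanDomain.gcd_eq_zero_iff.mp h).1
  obtain ⟨P', hP'⟩ := EuclideanDomain.gcd_dvd_left P Q
  obtain ⟨Q', hQ'⟩ := EuclideanDomain.gcd_dvd_right P Q
  set g := EuclideanDomain.gcd P Q with hgdef
  have hcop : IsCoprime P' Q' := by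
    obtain ⟨x, y, hxy⟩ : ∃ x y, P * x + Q * y = g :=
      ⟨_, _, (EuclideanDomain.gcd_eq_gcd_ab P Q).symm⟩
    refine ⟨x, y, mul_left_cancel₀ hg ?_⟩
    rw [mul_one]
    conv_rhs => rw [← hxy]
    conv_rhs => rw [hP', hQ']
    ring
  have hW : Polynomial.wronskian P' Q' = 0 := by
    have : g * g * Polynomial.wronskian P' Q' = 0 := by
      rw [hP', hQ'] at h
      rw [← h]
      simp only [Polynomial.wronskian, Polynomial.derivative_mul]
      ring
    simpa [hg] using this
  obtain ⟨h1, h2⟩ := hcop.wronskian_eq_zero_iff.mp hW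
  have e1 := Polynomial.eq_C_of_natDegree_eq_zero
    (Polynomial.derivative_eq_zero.mp h1)
  have e2 := Polynomial.eq_C_of_natDegree_eq_zero
    (Polynomial.derivative_eq_zero.mp h2)
  refine ⟨Q'.coeff 0, -P'.coeff 0, Or.inr ?_, ?_⟩
  · intro h0
    rw [neg_eq_zero] at h0
    rw [h0, Polynomial.C_0] at e1
    exact hP (by rw [hP', e1, mul_zero])
  · rw [Polynomial.C_neg, ← e1, ← e2, hP', hQ']
    ring

/-- Two binary forms of the same positive degree with vanishing Jacobian determinant are linearly
dependent. -/
theorem exists_of_jacobian_eq_zero {d : ℕ} (hd : 0 < d) {g h : MvPolynomial (Fin 2) ℂ}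
    (hg : g.IsHomogeneous d) (hh : h.IsHomogeneous d) (h0 : jacobian g h = 0) :
    ∃ α β : ℂ, (α ≠ 0 ∨ β ≠ 0) ∧ C α * g + C β * h = 0 := by
  have hab : det2 ![1, 0] ![0, 1] ≠ 0 := by simp [det2]
  have hW := wronskian_lineRestrict hg hh ![1, 0] ![0, 1]
  rw [h0, map_zero, mul_zero, mul_eq_zero, Polynomial.C_eq_zero, Nat.cast_eq_zero] at hW
  obtain ⟨α, β, hαβ, h1⟩ := exists_of_wronskian_eq_zero (hW.resolve_left hd.ne')
  refine ⟨α, β, hαβ, eq_zero_of_lineRestrict_eq_zero hab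
    ((hg.C_mul α).add (hh.C_mul β)) ?_⟩
  simpa using h1

/-! ### Nondegeneracy -/

theorem sum_C_mul_eq_zero_iff {f : Fin 3 → MvPolynomial (Fin 2) ℂ} :
    LinearIndependent ℂ f ↔ ∀ c : Fin 3 → ℂ, ∑ i, C (c i) * f i = 0 → c = 0 := by
  rw [Fintype.linearIndependent_iff]
  simp only [MvPolynomial.smul_eq_C_mul, funext_iff, Pi.zero_apply]

theorem jacobian_ne_zero {d : ℕ} (hd : 0 < d) {f : Fin 3 → MvPolynomial (Fin 2) ℂ}
    (hf : ∀ i, (f i).IsHomogeneous d) (hlin : LinearIndependent ℂ f) {i j : Fin 3} (hij : i ≠ j) :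
    jacobian (f i) (f j) ≠ 0 := by
  intro h
  obtain ⟨α, β, hαβ, h1⟩ := exists_of_jacobian_eq_zero hd (hf i) (hf j) h
  have h2 := sum_C_mul_eq_zero_iff.mp hlin (fun k => if k = i then α else if k = j then β else 0) ?_
  · have hi := congrFun h2 i
    have hj := congrFun h2 j
    simp only [hij.symm, if_true, if_false, Pi.zero_apply] at hi hj
    exact hαβ.elim (fun h => h hi) (fun h => h hj)
  · rw [← h1, ← Finset.sum_subset (Finset.subset_univ {i, j}), Finset.sum_pair hij]
    · simp [hij.symm]
    · intro k _ hk
      simp only [Finset.mem_insert, Finset.mem_singleton, not_or] at hk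
      simp [hk.1, hk.2]

/-! ### Points of the projective line and of the plane -/

theorem mk_eq_mk_of_smul {n : ℕ} {v w : Fin n → ℂ} (hv : v ≠ 0) (hw : w ≠ 0) (c : ℂ)
    (h : c • w = v) : Projectivization.mk ℂ v hv = Projectivization.mk ℂ w hw :=
  (Projectivization.mk_eq_mk_iff' ℂ v w hv hw).mpr ⟨c, h⟩

/-- The point of the projective line with parameter `τ` on the affine line `τ ↦ τ a + b`. -/
noncomputable def linePoint (a b : Fin 2 → ℂ) (hab : det2 a b ≠ 0) (τ : ℂ) : P1 :=
  Projectivization.mk ℂ (τ • a + b) (smul_add_ne_zero hab τ)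

theorem linePoint_injective {a b : Fin 2 → ℂ} (hab : det2 a b ≠ 0) :
    Function.Injective (linePoint a b hab) := by
  intro τ σ h
  obtain ⟨c, hc⟩ := (Projectivization.mk_eq_mk_iff' ℂ _ _ _ _).mp h
  have h0 := congrFun hc 0
  have h1 := congrFun hc 1
  simp only [Pi.add_apply, Pi.smul_apply, smul_eq_mul] at h0 h1
  have hc1 : c = 1 := by
    have : (c - 1) * det2 a b = 0 := by
      unfold det2
      linear_combination a 0 * h1 - a 1 * h0
    simpa [hab, sub_eq_zero] using this
  subst hc1
  have : (σ - τ) * det2 a b = 0 := by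
    unfold det2
    linear_combination b 1 * h0 - b 0 * h1
  simp only [mul_eq_zero, hab, or_false, sub_eq_zero] at this
  exact this.symm

/-- A point of the projective line is on the affine line `τ ↦ τ a + b` unless it is `a`. -/
theorem exists_linePoint_eq {a b : Fin 2 → ℂ} (hab : det2 a b ≠ 0) {v : Fin 2 → ℂ} (hv : v ≠ 0)
    (hva : det2 a v ≠ 0) : ∃ τ, linePoint a b hab τ = Projectivization.mk ℂ v hv := by
  refine ⟨det2 v b / det2 a b / (det2 a v / det2 a b), ?_⟩
  refine (mk_eq_mk_of_smul hv _ (det2 a v / det2 a b) ?_).symm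
  rw [smul_add, smul_smul, mul_div_cancel₀ _ (div_ne_zero hva hab)]
  exact (eq_smul_add_smul_of_det2 hab v).symm

theorem eq_smul_of_det2_eq_zero {a v : Fin 2 → ℂ} (ha : a ≠ 0) (h : det2 a v = 0) :
    ∃ c : ℂ, v = c • a := by
  obtain ⟨b, hab⟩ := exists_det2_ne_zero ha
  exact ⟨_, by simpa [h] using eq_smul_add_smul_of_det2 hab v⟩

/-- The ratio of two homogeneous coordinates of a point of the plane, `0` by convention where the
denominator vanishes. -/
noncomputable def ratio (j i : Fin 3) (P : P2) : ℂ := P.rep j / P.rep i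

theorem ratio_mk (j i : Fin 3) (v : Fin 3 → ℂ) (hv : v ≠ 0) :
    ratio j i (Projectivization.mk ℂ v hv) = v j / v i := by
  obtain ⟨a, ha⟩ := Projectivization.exists_smul_eq_mk_rep ℂ v hv
  unfold ratio
  rw [← ha]
  exact mul_div_mul_left _ _ a.ne_zero

theorem mem_curvePoints_mk {n : ℕ} {F : MvPolynomial (Fin 3) ℂ} (hF : F.IsHomogeneous n)
    (v : Fin 3 → ℂ) (hv : v ≠ 0) : Projectivization.mk ℂ v hv ∈ curvePoints F ↔ eval v F = 0 := by
  obtain ⟨a, ha⟩ := Projectivization.exists_smul_eq_mk_rep ℂ v hv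
  unfold curvePoints
  rw [Set.mem_ofPred_eq, ← ha]
  have := eval_smul_of_isHomogeneous hF (a : ℂ) v
  rw [Units.smul_def, this]
  simp

theorem projMap_linePoint {d : ℕ} {f : Fin 3 → MvPolynomial (Fin 2) ℂ}
    (hf : ∀ i, (f i).IsHomogeneous d) (hreg : NoCommonZero f) {a b : Fin 2 → ℂ}
    (hab : det2 a b ≠ 0) (τ : ℂ) :
    projMap f hreg (linePoint a b hab τ) =
      Projectivization.mk ℂ (fun i => eval (τ • a + b) (f i))
        (hreg _ (smul_add_ne_zero hab τ)) :=
  projMap_mk f hf hreg _ _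

/-- A generically one-to-one map of degree at least two does not have its image in a line: it would
be a map of that degree onto a projective line. -/
theorem linearIndependent_of_genericallyOneToOne {d : ℕ} (hd : 2 ≤ d)
    {f : Fin 3 → MvPolynomial (Fin 2) ℂ} (hf : ∀ i, (f i).IsHomogeneous d)
    (hreg : NoCommonZero f) (hinj : GenericallyOneToOne (projMap f hreg)) :
    LinearIndependent ℂ f := by
  classical
  rw [sum_C_mul_eq_zero_iff]
  intro c hc
  by_contra hne
  obtain ⟨k, hk⟩ := Function.ne_iff.mp hne
  rw [Pi.zero_apply] at hk
  set i := k.succAbove 0 with hi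
  set j := k.succAbove 1 with hj
  have hrel : ∀ v, c k * eval v (f k) + (c i * eval v (f i) + c j * eval v (f j)) = 0 := by
    intro v
    have := congrArg (eval v) hc
    rw [Fin.sum_univ_succAbove _ k, Fin.sum_univ_two] at this
    simpa using this
  have hall : ∀ v : Fin 2 → ℂ, v ≠ 0 → eval v (f i) = 0 → eval v (f j) ≠ 0 := by
    intro v hv h1 h2
    have h3 := hrel v
    rw [h1, h2] at h3
    apply hreg v hv
    funext l
    rcases Fin.eq_self_or_eq_succAbove k l with rfl | ⟨m, rfl⟩
    · simpa [hk] using h3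
    · fin_cases m
      · exact h1
      · exact h2
  obtain ⟨a, ha, hai⟩ := exists_eval_eq_zero (by omega) (hf i)
  obtain ⟨b, hab⟩ := exists_det2_ne_zero ha
  set P := lineRestrict a b (f j)
  set G := lineRestrict a b (f i)
  have hPd : P.natDegree = d := by
    refine Polynomial.natDegree_eq_of_le_of_coeff_ne_zero (natDegree_lineRestrict_le a b (hf j)) ?_
    rw [coeff_lineRestrict a b (hf j)]
    exact hall a ha hai
  have hGd : G.natDegree < P.natDegree := by
    rw [hPd]
    refine lt_of_le_of_ne (natDegree_lineRestrict_le a b (hf i)) fun h => ?_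
    have h1 : G.coeff G.natDegree = 0 := by
      rw [h, coeff_lineRestrict a b (hf i), hai]
    rw [Polynomial.coeff_natDegree, Polynomial.leadingCoeff_eq_zero] at h1
    rw [h1, Polynomial.natDegree_zero] at h
    omega
  have hcop : IsCoprime P G := by
    refine isCoprime_of_no_common_root fun τ h1 h2 => ?_
    rw [eval_lineRestrict] at h1 h2
    exact hall _ (smul_add_ne_zero hab τ) h2 h1
  have hbad := finite_setOf_not_nodup_roots hGd hcop
  refine Set.infinite_univ ((hbad.union (hinj.image (ratio j i))).subset fun x _ => ?_)
  by_cases hx : (P - Polynomial.C x * G).roots.Nodup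
  swap
  · exact Or.inl hx
  right
  have hcard : (P - Polynomial.C x * G).roots.toFinset.card = d := by
    rw [Multiset.toFinset_card_of_nodup hx, card_roots_sub_C_mul hGd, hPd]
  obtain ⟨τ, hτ, σ, hσ, hne'⟩ := Finset.one_lt_card.mp (show 1 < _ by rw [hcard]; omega)
  have hroot : ∀ τ ∈ (P - Polynomial.C x * G).roots.toFinset,
      eval (τ • a + b) (f i) ≠ 0 ∧ eval (τ • a + b) (f j) = x * eval (τ • a + b) (f i) := by
    intro τ hτ
    have h1 : P.eval τ = x * G.eval τ := by
      have := Polynomial.isRoot_of_mem_roots (Multiset.mem_toFinset.mp hτ)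
      simpa [sub_eq_zero] using this
    rw [eval_lineRestrict, eval_lineRestrict] at h1
    refine ⟨fun h => hall _ (smul_add_ne_zero hab τ) h ?_, h1⟩
    rw [h1, h, mul_zero]
  obtain ⟨hτi, hτj⟩ := hroot τ hτ
  obtain ⟨hσi, hσj⟩ := hroot σ hσ
  refine ⟨projMap f hreg (linePoint a b hab τ), ⟨⟨_, rfl⟩, ?_⟩, ?_⟩
  · rintro ⟨Q, -, hQ⟩
    have h1 := hQ _ rfl
    have h2 := hQ (linePoint a b hab σ) ?_
    · exact hne' (linePoint_injective hab (h1.trans h2.symm))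
    · simp only [projMap_linePoint hf]
      refine mk_eq_mk_of_smul _ _
        (eval (σ • a + b) (f i) / eval (τ • a + b) (f i)) ?_
      have hrτ := hrel (τ • a + b)
      have hrσ := hrel (σ • a + b)
      rw [hτj] at hrτ
      rw [hσj] at hrσ
      funext l
      rw [Pi.smul_apply, smul_eq_mul, div_mul_eq_mul_div, div_eq_iff hτi]
      rcases Fin.eq_self_or_eq_succAbove k l with rfl | ⟨m, rfl⟩
      · apply mul_left_cancel₀ hk
        linear_combination eval (σ • a + b) (f i) * hrτ - eval (τ • a + b) (f i) * hrσ
      · fin_cases m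
        · change _ * eval _ (f i) = eval _ (f i) * _
          ring
        · change _ * eval _ (f j) = eval _ (f j) * _
          rw [hτj, hσj]
          ring
  · rw [projMap_linePoint hf, ratio_mk, hτj, mul_div_cancel_right₀ _ hτi]

/-! ### The equation of the image -/

theorem pderiv_aeval {n : ℕ} (f : Fin n → MvPolynomial (Fin 2) ℂ) (p : MvPolynomial (Fin n) ℂ)
    (k : Fin 2) :
    pderiv k (aeval f p) = ∑ i, aeval f (pderiv i p) * pderiv k (f i) :=
  derivation_aeval (pderiv k) f p

theorem totalDegree_pderiv_lt {n : ℕ} {p : MvPolynomial (Fin n) ℂ} {i : Fin n}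
    (h : pderiv i p ≠ 0) : (pderiv i p).totalDegree < p.totalDegree := by
  obtain ⟨m, hm, hdeg⟩ := Finset.exists_mem_eq_sup (pderiv i p).support
    (support_nonempty.mpr h) (fun m => m.sum fun _ e => e)
  have h1 : m + Finsupp.single i 1 ∈ p.support := by
    rw [mem_support_iff, coeff_pderiv] at hm
    rw [mem_support_iff]
    exact left_ne_zero_of_mul hm
  have h2 := le_totalDegree h1
  rw [Finsupp.sum_add_index' (fun _ => rfl) (fun _ _ _ => rfl), Finsupp.sum_single_index rfl] at h2
  unfold totalDegree at h2 ⊢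
  omega

theorem eq_C_of_pderiv_eq_zero {n : ℕ} {p : MvPolynomial (Fin n) ℂ}
    (h : ∀ i, pderiv i p = 0) : ∃ c, p = C c := by
  refine ⟨coeff 0 p, ?_⟩
  ext m
  rw [coeff_C]
  split_ifs with h0
  · rw [← h0]
  · obtain ⟨i, hi⟩ := Finsupp.ne_iff.mp (Ne.symm h0)
    rw [Finsupp.coe_zero, Pi.zero_apply] at hi
    have h1 := congrArg (coeff (m - Finsupp.single i 1)) (h i)
    have hle : Finsupp.single i 1 ≤ m := by
      rw [Finsupp.single_le_iff]
      omega
    rw [coeff_pderiv, tsub_add_cancel_of_le hle, coeff_zero, mul_eq_zero] at h1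
    exact h1.resolve_right (Nat.cast_add_one_ne_zero _)

/-- The Jacobian criterion: two polynomials with nonzero Jacobian determinant are algebraically
independent. A relation of minimal degree would be killed by both partial derivatives. -/
theorem eq_zero_of_aeval_eq_zero_of_jacobian_ne_zero {g h : MvPolynomial (Fin 2) ℂ}
    (hJ : jacobian g h ≠ 0) (r : MvPolynomial (Fin 2) ℂ) (hr : aeval ![g, h] r = 0) : r = 0 := by
  induction hn : r.totalDegree using Nat.strong_induction_on generalizing r with
  | _ n ih =>
    have e0 := pderiv_aeval ![g, h] r 0
    have e1 := pderiv_aeval ![g, h] r 1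
    rw [hr, map_zero, Fin.sum_univ_two] at e0 e1
    simp only [Matrix.cons_val_zero, Matrix.cons_val_one] at e0 e1
    have k0 : aeval ![g, h] (pderiv 0 r) = 0 := by
      refine (mul_eq_zero.mp (?_ : _ * jacobian g h = 0)).resolve_right hJ
      unfold jacobian
      linear_combination pderiv 0 h * e1 - pderiv 1 h * e0
    have k1 : aeval ![g, h] (pderiv 1 r) = 0 := by
      refine (mul_eq_zero.mp (?_ : _ * jacobian g h = 0)).resolve_right hJ
      unfold jacobian
      linear_combination pderiv 1 g * e0 - pderiv 0 g * e1
    have hz : ∀ i, pderiv i r = 0 := by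
      intro i
      by_contra hne
      refine hne (ih _ (hn ▸ totalDegree_pderiv_lt hne) _ ?_ rfl)
      fin_cases i
      · exact k0
      · exact k1
    obtain ⟨c, rfl⟩ := eq_C_of_pderiv_eq_zero hz
    rw [algHom_C, algebraMap_eq] at hr
    exact hr

/-- Three polynomials in two variables are algebraically dependent, as `ℂ[s, t]` has transcendence
degree two. -/
theorem exists_ne_zero_aeval_eq_zero (f : Fin 3 → MvPolynomial (Fin 2) ℂ) :
    ∃ H : MvPolynomial (Fin 3) ℂ, H ≠ 0 ∧ aeval f H = 0 := by
  by_contra! hc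
  have hind : AlgebraicIndependent ℂ f := by
    rw [algebraicIndependent_iff]
    intro p hp
    by_contra hne
    exact hc p hne hp
  have := hind.lift_cardinalMk_le_trdeg
  rw [MvPolynomial.trdeg_of_isDomain] at this
  simp only [Cardinal.mk_fin, Cardinal.lift_natCast] at this
  have h32 : 3 ≤ 2 := by exact_mod_cast this
  omega

theorem aeval_finSuccEquiv_symm_C (f : Fin 3 → MvPolynomial (Fin 2) ℂ)
    (r : MvPolynomial (Fin 2) ℂ) :
    aeval f ((finSuccEquiv ℂ 2).symm (Polynomial.C r)) = aeval ![f 1, f 2] r := by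
  have : (finSuccEquiv ℂ 2).symm (Polynomial.C r) = rename Fin.succ r := by
    rw [AlgEquiv.symm_apply_eq]
    induction r using MvPolynomial.induction_on with
    | C c => simp [finSuccEquiv_apply]
    | add p q hp hq => simp [hp, hq]
    | mul_X p i hp => simp [hp, finSuccEquiv_X_succ]
  rw [this, aeval_rename]
  congr 1
  congr 1
  funext i
  fin_cases i <;> rfl

theorem resultant_ne_zero_of_irreducible_map {R K : Type*} [CommRing R] [Field K]
    [Algebra R K] (hinj : Function.Injective (algebraMap R K)) {g h : Polynomial R}
    (hg : Irreducible (g.map (algebraMap R K)))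
    (hdvd : ¬ g.map (algebraMap R K) ∣ h.map (algebraMap R K)) : Polynomial.resultant g h ≠ 0 := by
  intro h0
  refine Polynomial.resultant_ne_zero _ _ ((hg.coprime_iff_not_dvd).mpr hdvd) ?_
  rw [Polynomial.natDegree_map_eq_of_injective hinj,
    Polynomial.natDegree_map_eq_of_injective hinj, Polynomial.resultant_map_map, h0, map_zero]

/-- The relations between the `f i` are the multiples of any prime relation `G`: a relation not
divisible by `G` would have with `G` a nonzero resultant, that is, there would be a relation
between `f 1` and `f 2` alone. -/
theorem dvd_of_aeval_eq_zero {f : Fin 3 → MvPolynomial (Fin 2) ℂ}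
    (hJ : jacobian (f 1) (f 2) ≠ 0) {G H : MvPolynomial (Fin 3) ℂ} (hG : Prime G)
    (hfG : aeval f G = 0) (hfH : aeval f H = 0) : G ∣ H := by
  let e := finSuccEquiv ℂ 2
  have helim : ∀ r : MvPolynomial (Fin 2) ℂ, aeval f (e.symm (Polynomial.C r)) = 0 → r = 0 := by
    intro r hr
    rw [aeval_finSuccEquiv_symm_C] at hr
    exact eq_zero_of_aeval_eq_zero_of_jacobian_ne_zero hJ r hr
  have hgirr : Irreducible (e G) := (MulEquiv.irreducible_iff e).mpr hG.irreducible
  have hgdeg : (e G).natDegree ≠ 0 := by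
    intro h
    have h1 := Polynomial.eq_C_of_natDegree_eq_zero h
    have h2 := helim ((e G).coeff 0) (by rw [← h1, AlgEquiv.symm_apply_apply, hfG])
    rw [h2, Polynomial.C_0] at h1
    exact hgirr.ne_zero h1
  have hgprim := hgirr.isPrimitive hgdeg
  let ι := algebraMap (MvPolynomial (Fin 2) ℂ) (FractionRing (MvPolynomial (Fin 2) ℂ))
  have hinj : Function.Injective ι := IsFractionRing.injective _ _
  -- by Gauss's lemma irreducibility and divisibility may be tested over the fraction field
  have hgK : Irreducible ((e G).map ι) :=
    hgprim.irreducible_iff_irreducible_map_fraction_map.mp hgirr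
  by_cases hdvd : (e G).map ι ∣ (e H).map ι
  · exact (map_dvd_iff e).mp (hgprim.dvd_of_fraction_map_dvd_fraction_map hdvd)
  · exfalso
    have hres := resultant_ne_zero_of_irreducible_map hinj hgK hdvd
    obtain ⟨p, q, -, -, hpq⟩ := Polynomial.exists_mul_add_mul_eq_C_resultant
      (e G) (e H) le_rfl le_rfl (Or.inl hgdeg)
    refine hres (helim _ ?_)
    rw [← hpq, map_add, map_mul, map_mul, AlgEquiv.symm_apply_apply, AlgEquiv.symm_apply_apply,
      map_add, map_mul, map_mul, hfG, hfH, zero_mul, zero_mul, add_zero]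

/-- The homogeneous components of a relation between forms of the same degree are relations. -/
theorem aeval_homogeneousComponent_eq_zero {d : ℕ} (hd : 0 < d)
    {f : Fin 3 → MvPolynomial (Fin 2) ℂ} (hf : ∀ i, (f i).IsHomogeneous d)
    {G : MvPolynomial (Fin 3) ℂ} (hG : aeval f G = 0) (n : ℕ) :
    aeval f (homogeneousComponent n G) = 0 := by
  by_cases hn : n ∈ Finset.range (G.totalDegree + 1)
  swap
  · rw [homogeneousComponent_eq_zero _ _ (by simpa using hn), map_zero]
  have h1 := congrArg (homogeneousComponent (d * n)) hG
  have h2 : ∀ k, (aeval f (homogeneousComponent k G)).IsHomogeneous (d * k) := fun k =>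
    (homogeneousComponent_isHomogeneous k G).aeval f hf
  conv_lhs at h1 => rw [← sum_homogeneousComponent G, map_sum, map_sum]
  rw [Finset.sum_eq_single n] at h1
  · rwa [homogeneousComponent_eq_self (h2 n), map_zero] at h1
  · intro k _ hk
    rw [homogeneousComponent_of_mem (h2 k), if_neg]
    intro h
    exact hk (Nat.eq_of_mul_eq_mul_left hd h).symm
  · exact fun h => absurd hn h

/-- The ideal of relations between the `f i` is generated by an irreducible form: it is prime and
nonzero, so contains a prime element, which generates it and divides its own leading form. -/
theorem exists_generator_of_relations {d : ℕ} (hd : 0 < d)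
    {f : Fin 3 → MvPolynomial (Fin 2) ℂ} (hf : ∀ i, (f i).IsHomogeneous d)
    (hlin : LinearIndependent ℂ f) :
    ∃ F : MvPolynomial (Fin 3) ℂ, F.IsHomogeneous F.totalDegree ∧ Irreducible F ∧
      ∀ G, aeval f G = 0 ↔ F ∣ G := by
  have hJ : jacobian (f 1) (f 2) ≠ 0 := jacobian_ne_zero hd hf hlin (by decide)
  have hprime : (RingHom.ker (aeval f : MvPolynomial (Fin 3) ℂ →ₐ[ℂ] _)).IsPrime :=
    RingHom.ker_isPrime _
  obtain ⟨H, hH0, hH⟩ := exists_ne_zero_aeval_eq_zero f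
  obtain ⟨F, hF, hFp⟩ := hprime.exists_mem_prime_of_ne_bot
    (fun h => hH0 ((Submodule.mem_bot _).mp (h ▸ RingHom.mem_ker.mpr hH)))
  have hF0 : aeval f F = 0 := hF
  have hiff : ∀ G, aeval f G = 0 ↔ F ∣ G := by
    refine fun G => ⟨fun h => dvd_of_aeval_eq_zero hJ hFp hF0 h, ?_⟩
    rintro ⟨K, rfl⟩
    rw [map_mul, hF0, zero_mul]
  refine ⟨F, ?_, hFp.irreducible, hiff⟩
  have htop : homogeneousComponent F.totalDegree F ≠ 0 := by
    obtain ⟨m, hm, hdeg⟩ := Finset.exists_mem_eq_sup F.support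
      (support_nonempty.mpr hFp.ne_zero) (fun m => m.sum fun _ e => e)
    intro h
    have h1 := congrArg (coeff m) h
    rw [coeff_homogeneousComponent, if_pos, coeff_zero] at h1
    · exact mem_support_iff.mp hm h1
    · exact hdeg.symm
  obtain ⟨K, hK⟩ := (hiff _).mp (aeval_homogeneousComponent_eq_zero hd hf hF0 F.totalDegree)
  rw [hK] at htop
  refine (isHomogeneous_of_mul (N := F.totalDegree) ?_ htop).1
  rw [← hK]
  exact homogeneousComponent_isHomogeneous _ _

/-! ### Affine charts of the curve -/

/-- A parametrization `τ ↦ τ a + b` of an affine part of the projective line, adapted to the affine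
chart of the plane around `P`: the point at infinity `a` is mapped to the line at infinity. -/
structure Chart (f : Fin 3 → MvPolynomial (Fin 2) ℂ) (P : P2) where
  /-- the point at infinity -/
  a : Fin 2 → ℂ
  /-- the origin -/
  b : Fin 2 → ℂ
  det_ne_zero : det2 a b ≠ 0
  eval_eq_zero : eval a (f (chartIndex P)) = 0

theorem rep_chartIndex_ne_zero (P : P2) : P.rep (chartIndex P) ≠ 0 :=
  Classical.choose_spec (exists_rep_ne_zero P)

/-- The indices of the two affine coordinates around `P`. -/
noncomputable def affineIndex (P : P2) (k : Fin 2) : Fin 3 := (chartIndex P).succAbove k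

theorem index_cases (P : P2) (j : Fin 3) : j = chartIndex P ∨ ∃ k, j = affineIndex P k :=
  Fin.eq_self_or_eq_succAbove (chartIndex P) j

/-- The point with affine coordinates `y`, in coordinates centred at `P`. -/
noncomputable def affinePoint {S : Type*} [CommRing S] [Algebra ℂ S] (P : P2) (y : Fin 2 → S) :
    Fin 3 → S :=
  fun j => algebraMap ℂ S (P.rep j) + (chartIndex P).insertNth (α := fun _ => S) 0 y j

@[simp]
theorem affinePoint_chartIndex {S : Type*} [CommRing S] [Algebra ℂ S] (P : P2) (y : Fin 2 → S) :
    affinePoint P y (chartIndex P) = algebraMap ℂ S (P.rep (chartIndex P)) := by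
  simp [affinePoint]

@[simp]
theorem affinePoint_affineIndex {S : Type*} [CommRing S] [Algebra ℂ S] (P : P2) (y : Fin 2 → S)
    (k : Fin 2) :
    affinePoint P y (affineIndex P k) = algebraMap ℂ S (P.rep (affineIndex P k)) + y k := by
  simp [affinePoint, affineIndex]

theorem localEquation_eq (F : MvPolynomial (Fin 3) ℂ) (P : P2) :
    localEquation F P = aeval (affinePoint P (X : Fin 2 → MvPolynomial (Fin 2) ℂ)) F := rfl

theorem aeval_localEquation {S : Type*} [CommRing S] [Algebra ℂ S] (F : MvPolynomial (Fin 3) ℂ)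
    (P : P2) (y : Fin 2 → S) : aeval y (localEquation F P) = aeval (affinePoint P y) F := by
  rw [localEquation_eq, ← AlgHom.comp_apply, comp_aeval]
  congr 2
  funext j
  obtain rfl | ⟨k, rfl⟩ := index_cases P j
  · simp
  · simp

theorem aeval_smul_of_isHomogeneous {n d : ℕ} {S : Type*} [CommRing S] [Algebra ℂ S]
    {p : MvPolynomial (Fin n) ℂ} (hp : p.IsHomogeneous d) (c : S) (v : Fin n → S) :
    aeval (fun i => c * v i) p = c ^ d * aeval v p := by
  rw [aeval_def, aeval_def, eval₂_eq', eval₂_eq', Finset.mul_sum]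
  refine Finset.sum_congr rfl fun m hm => ?_
  simp only [mul_pow, Finset.prod_mul_distrib, Finset.prod_pow_eq_pow_sum,
    sum_eq_of_mem_support hp hm]
  ring

/-- Homogenization: `H (x' / xᵢ)` times a power of `xᵢ` is a form in `x`, where `x'` are the affine
coordinates centred at `P`. -/
theorem exists_homogenization (P : P2) (H : MvPolynomial (Fin 2) ℂ) :
    ∃ (n : ℕ) (Hh : MvPolynomial (Fin 3) ℂ), Hh.IsHomogeneous n ∧
      ∀ {S : Type} [CommRing S] [Algebra ℂ S] (x : Fin 3 → S) (y : Fin 2 → S),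
        (∀ k, algebraMap ℂ S (P.rep (chartIndex P)) * x (affineIndex P k) -
          algebraMap ℂ S (P.rep (affineIndex P k)) * x (chartIndex P) =
            x (chartIndex P) * y k) →
        aeval x Hh = x (chartIndex P) ^ n * aeval y H := by
  refine ⟨H.totalDegree, ∑ m ∈ H.support, C (coeff m H) *
    ((∏ k, (C (P.rep (chartIndex P)) * X (affineIndex P k) -
      C (P.rep (affineIndex P k)) * X (chartIndex P)) ^ m k) *
      X (chartIndex P) ^ (H.totalDegree - ∑ k, m k)), ?_, ?_⟩
  · have hle : ∀ m ∈ H.support, ∑ k, m k ≤ H.totalDegree := by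
      intro m hm
      have := le_totalDegree hm
      rwa [Finsupp.sum_fintype _ _ (fun _ => rfl)] at this
    refine IsHomogeneous.sum _ _ _ fun m hm => IsHomogeneous.C_mul ?_ _
    have h1 : (∏ k, (C (P.rep (chartIndex P)) * X (affineIndex P k) -
        C (P.rep (affineIndex P k)) * X (chartIndex P)) ^ m k :
          MvPolynomial (Fin 3) ℂ).IsHomogeneous (∑ k, m k) := by
      refine IsHomogeneous.prod _ _ _ fun k _ => ?_
      have := (((isHomogeneous_C_mul_X (P.rep (chartIndex P)) (affineIndex P k)).sub
        (isHomogeneous_C_mul_X (P.rep (affineIndex P k)) (chartIndex P)))).pow (m k)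
      rwa [one_mul] at this
    have h2 := h1.mul (isHomogeneous_X_pow (R := ℂ) (chartIndex P) (H.totalDegree - ∑ k, m k))
    rwa [Nat.add_sub_cancel' (hle m hm)] at h2
  · intro S _ _ x y hxy
    rw [map_sum, aeval_def y H, eval₂_eq', Finset.mul_sum]
    refine Finset.sum_congr rfl fun m hm => ?_
    have hle : ∑ k, m k ≤ H.totalDegree := by
      have := le_totalDegree hm
      rwa [Finsupp.sum_fintype _ _ (fun _ => rfl)] at this
    simp only [map_mul, map_prod, map_pow, map_sub, aeval_X, algHom_C, hxy, mul_pow,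
      Finset.prod_mul_distrib, Finset.prod_pow_eq_pow_sum]
    obtain ⟨r, hr⟩ := Nat.exists_eq_add_of_le hle
    rw [hr, Nat.add_sub_cancel_left, pow_add]
    ring

theorem sub_C_mem_span_X (H : MvPolynomial (Fin 2) ℂ) :
    H - C (eval 0 H) ∈ Ideal.span (Set.range (X : Fin 2 → MvPolynomial (Fin 2) ℂ)) := by
  induction H using MvPolynomial.induction_on with
  | C c => simp
  | add p q hp hq =>
    have := Ideal.add_mem _ hp hq
    rw [map_add, C_add]
    convert this using 1
    ring
  | mul_X p i hp =>
    simp only [map_mul, eval_X, Pi.zero_apply, mul_zero, C_0, sub_zero]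
    exact Ideal.mul_mem_left _ _ (Ideal.subset_span ⟨i, rfl⟩)

namespace Chart

variable {f : Fin 3 → MvPolynomial (Fin 2) ℂ} {P : P2} (c : Chart f P)

/-- The vector of homogeneous coordinates of the point with parameter `τ`. -/
noncomputable def vec (τ : ℂ) : Fin 3 → ℂ := fun j => eval (τ • c.a + c.b) (f j)

/-- The denominator of the affine coordinates along the curve. -/
noncomputable def den : Polynomial ℂ := lineRestrict c.a c.b (f (chartIndex P))

/-- The form whose restriction is the numerator of an affine coordinate. -/
noncomputable def _root_.RationalPlaneCurve.numForm (f : Fin 3 → MvPolynomial (Fin 2) ℂ) (P : P2)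
    (k : Fin 2) : MvPolynomial (Fin 2) ℂ :=
  C (P.rep (chartIndex P)) * f (affineIndex P k) - C (P.rep (affineIndex P k)) * f (chartIndex P)

/-- The numerator of an affine coordinate, centred at `P`, along the curve. -/
noncomputable def num (k : Fin 2) : Polynomial ℂ := lineRestrict c.a c.b (numForm f P k)

theorem _root_.RationalPlaneCurve.isHomogeneous_numForm {d : ℕ} (hf : ∀ i, (f i).IsHomogeneous d)
    (k : Fin 2) : (numForm f P k).IsHomogeneous d :=
  ((hf _).C_mul _).sub ((hf _).C_mul _)

theorem eval_den (τ : ℂ) : c.den.eval τ = c.vec τ (chartIndex P) := eval_lineRestrict _ _ _ _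

theorem num_eq (k : Fin 2) : c.num k =
    Polynomial.C (P.rep (chartIndex P)) * lineRestrict c.a c.b (f (affineIndex P k)) -
      Polynomial.C (P.rep (affineIndex P k)) * c.den := by
  simp [num, numForm, den]

theorem eval_num (k : Fin 2) (τ : ℂ) : (c.num k).eval τ =
    P.rep (chartIndex P) * c.vec τ (affineIndex P k) -
      P.rep (affineIndex P k) * c.vec τ (chartIndex P) := by
  rw [num_eq, Polynomial.eval_sub, Polynomial.eval_mul, Polynomial.eval_mul, eval_den,
    Polynomial.eval_C, Polynomial.eval_C, eval_lineRestrict]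
  rfl

theorem vec_ne_zero (hreg : NoCommonZero f) (τ : ℂ) : c.vec τ ≠ 0 :=
  hreg _ (smul_add_ne_zero c.det_ne_zero τ)

/-- The point of the projective line with parameter `τ`. -/
noncomputable def point (τ : ℂ) : P1 := linePoint c.a c.b c.det_ne_zero τ

theorem projMap_point {d : ℕ} (hf : ∀ i, (f i).IsHomogeneous d) (hreg : NoCommonZero f) (τ : ℂ) :
    projMap f hreg (c.point τ) = Projectivization.mk ℂ (c.vec τ) (c.vec_ne_zero hreg τ) :=
  projMap_linePoint hf hreg c.det_ne_zero τ

theorem smul_vec {τ : ℂ} (h : c.den.eval τ ≠ 0) :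
    (P.rep (chartIndex P) / c.den.eval τ) • c.vec τ =
      affinePoint P (fun k => (c.num k).eval τ / c.den.eval τ) := by
  funext j
  obtain rfl | ⟨k, rfl⟩ := index_cases P j
  · rw [Pi.smul_apply, ← eval_den, affinePoint_chartIndex, smul_eq_mul, div_mul_cancel₀ _ h]
    rfl
  · rw [Pi.smul_apply, affinePoint_affineIndex, eval_num, ← eval_den, smul_eq_mul]
    simp only [Algebra.algebraMap_self, RingHom.id_apply]
    field_simp
    ring

theorem den_eval_ne_zero (hreg : NoCommonZero f) {τ : ℂ} (h : ∀ k, (c.num k).eval τ = 0) :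
    c.den.eval τ ≠ 0 := by
  intro h0
  refine c.vec_ne_zero hreg τ ?_
  funext j
  obtain rfl | ⟨k, rfl⟩ := index_cases P j
  · rw [← eval_den, h0]
    rfl
  · have := h k
    rw [eval_num, ← eval_den, h0, mul_zero, sub_zero, mul_eq_zero] at this
    exact this.resolve_left (rep_chartIndex_ne_zero P)

theorem exists_point_eq {d : ℕ} (hf : ∀ i, (f i).IsHomogeneous d) {v : Fin 2 → ℂ}
    (hv : v ≠ 0) (h : eval v (f (chartIndex P)) ≠ 0) :
    ∃ τ, c.point τ = Projectivization.mk ℂ v hv := by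
  refine exists_linePoint_eq c.det_ne_zero hv fun h0 => h ?_
  have ha : c.a ≠ 0 := by
    intro ha
    apply c.det_ne_zero
    simp [ha, det2]
  obtain ⟨r, rfl⟩ := eq_smul_of_det2_eq_zero ha h0
  rw [eval_smul_of_isHomogeneous (hf _), c.eval_eq_zero, mul_zero]

/-- The parameters of the points over `P` are the common zeros of the two affine coordinates. -/
theorem projMap_point_eq_iff {d : ℕ} (hf : ∀ i, (f i).IsHomogeneous d) (hreg : NoCommonZero f)
    (τ : ℂ) : projMap f hreg (c.point τ) = P ↔ ∀ k, (c.num k).eval τ = 0 := by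
  rw [projMap_point c hf]
  have hP : Projectivization.mk ℂ (c.vec τ) (c.vec_ne_zero hreg τ) = P ↔
      ∃ r : ℂ, r • P.rep = c.vec τ := by
    rw [← Projectivization.mk_eq_mk_iff' ℂ _ _ (c.vec_ne_zero hreg τ) P.rep_nonzero, P.mk_rep]
  rw [hP]
  constructor
  · rintro ⟨r, hr⟩ k
    rw [eval_num, ← hr]
    simp only [Pi.smul_apply, smul_eq_mul]
    ring
  · intro h
    have h0 := c.den_eval_ne_zero hreg h
    refine ⟨c.den.eval τ / P.rep (chartIndex P), ?_⟩
    have := c.smul_vec h0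
    have hP : affinePoint P (fun k => (c.num k).eval τ / c.den.eval τ) = P.rep := by
      funext j
      obtain rfl | ⟨k, rfl⟩ := index_cases P j
      · simp
      · simp [h k]
    rw [hP] at this
    refine (congrArg _ this.symm).trans ?_
    rw [smul_smul, div_mul_div_cancel₀ (rep_chartIndex_ne_zero P), div_self h0, one_smul]

theorem exists_point_of_projMap_eq {d : ℕ} (hf : ∀ i, (f i).IsHomogeneous d)
    (hreg : NoCommonZero f) {Q : P1} (hQ : (projMap f hreg Q).rep (chartIndex P) ≠ 0) :
    ∃ τ, c.point τ = Q := by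
  induction Q using Projectivization.ind with
  | h v hv =>
    refine c.exists_point_eq hf hv fun h => hQ ?_
    rw [projMap_mk f hf]
    obtain ⟨r, hr⟩ := Projectivization.exists_smul_eq_mk_rep ℂ _ (hreg v hv)
    rw [← hr, Pi.smul_apply, h, smul_zero]

theorem natDegree_den_lt {d : ℕ} (hf : ∀ i, (f i).IsHomogeneous d) (hd : 0 < d) :
    c.den.natDegree < d := by
  refine lt_of_le_of_ne (natDegree_lineRestrict_le _ _ (hf _)) fun h => ?_
  have h1 : c.den.coeff c.den.natDegree = 0 := by
    rw [h, den, coeff_lineRestrict _ _ (hf _), c.eval_eq_zero]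
  rw [Polynomial.coeff_natDegree, Polynomial.leadingCoeff_eq_zero] at h1
  rw [h1, Polynomial.natDegree_zero] at h
  omega

theorem den_ne_zero {d : ℕ} (hf : ∀ i, (f i).IsHomogeneous d) (hlin : LinearIndependent ℂ f) :
    c.den ≠ 0 := fun h =>
  hlin.ne_zero _ (eq_zero_of_lineRestrict_eq_zero c.det_ne_zero (hf _) h)

theorem natDegree_num_le {d : ℕ} (hf : ∀ i, (f i).IsHomogeneous d) (k : Fin 2) :
    (c.num k).natDegree ≤ d := natDegree_lineRestrict_le _ _ (isHomogeneous_numForm hf k)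

theorem coeff_num {d : ℕ} (hf : ∀ i, (f i).IsHomogeneous d) (k : Fin 2) :
    (c.num k).coeff d = P.rep (chartIndex P) * eval c.a (f (affineIndex P k)) := by
  rw [num, coeff_lineRestrict _ _ (isHomogeneous_numForm hf k), numForm]
  simp [c.eval_eq_zero]

theorem exists_coeff_num_ne_zero {d : ℕ} (hf : ∀ i, (f i).IsHomogeneous d)
    (hreg : NoCommonZero f) : ∃ k, (c.num k).coeff d ≠ 0 := by
  by_contra! h
  have ha : c.a ≠ 0 := by
    intro ha
    apply c.det_ne_zero
    simp [ha, det2]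
  refine hreg c.a ha ?_
  funext j
  obtain rfl | ⟨k, rfl⟩ := index_cases P j
  · exact c.eval_eq_zero
  · have := h k
    rw [c.coeff_num hf, mul_eq_zero] at this
    exact this.resolve_left (rep_chartIndex_ne_zero P)

end Chart

theorem nonempty_chart {d : ℕ} (hd : 0 < d) {f : Fin 3 → MvPolynomial (Fin 2) ℂ}
    (hf : ∀ i, (f i).IsHomogeneous d) (P : P2) : Nonempty (Chart f P) := by
  obtain ⟨a, ha, hai⟩ := exists_eval_eq_zero hd (hf (chartIndex P))
  obtain ⟨b, hab⟩ := exists_det2_ne_zero ha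
  exact ⟨⟨a, b, hab, hai⟩⟩

/-! ### Normalization of a parametrized affine curve -/

/-- The coordinate ring `B` of an affine plane curve with coordinates `y 0, y 1` is parametrized by
`y k = u k / G`, where `G` vanishes at infinity and some `u k` does not. -/
structure IsParametrized (B K : Type*) [CommRing B] [Field K] [Algebra ℂ B]
    [Algebra (Polynomial ℂ) K] [Algebra B K] (y : Fin 2 → B) (u : Fin 2 → Polynomial ℂ)
    (G : Polynomial ℂ) (d : ℕ) : Prop where
  surjective : Function.Surjective (aeval y : MvPolynomial (Fin 2) ℂ →ₐ[ℂ] B)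
  map_coord : ∀ k, algebraMap B K (y k) =
    algebraMap (Polynomial ℂ) K (u k) / algebraMap (Polynomial ℂ) K G
  den_ne_zero : G ≠ 0
  natDegree_den_lt : G.natDegree < d
  natDegree_num_le : ∀ k, (u k).natDegree ≤ d
  exists_coeff_ne_zero : ∃ k, (u k).coeff d ≠ 0
  den_eval_ne_zero : ∀ τ, (∀ k, (u k).eval τ = 0) → G.eval τ ≠ 0

namespace IsParametrized

variable {B K : Type*} [CommRing B] [Field K] [Algebra ℂ B] [Algebra (Polynomial ℂ) K]
  [Algebra ℂ K] [IsScalarTower ℂ (Polynomial ℂ) K] [IsFractionRing (Polynomial ℂ) K] [Algebra B K]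
  [IsScalarTower ℂ B K] {y : Fin 2 → B} {u : Fin 2 → Polynomial ℂ} {G : Polynomial ℂ} {d : ℕ}

omit [Algebra ℂ K] [IsScalarTower ℂ (Polynomial ℂ) K] [IsScalarTower ℂ B K] in
theorem algebraMap_den_ne_zero (h : IsParametrized B K y u G d) :
    algebraMap (Polynomial ℂ) K G ≠ 0 :=
  (map_ne_zero_iff _ (IsFractionRing.injective (Polynomial ℂ) K)).mpr h.den_ne_zero

omit [Algebra ℂ K] [IsScalarTower ℂ (Polynomial ℂ) K] [IsScalarTower ℂ B K] in
theorem den_mul_coord (h : IsParametrized B K y u G d) (k : Fin 2) :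
    algebraMap (Polynomial ℂ) K G * algebraMap B K (y k) = algebraMap (Polynomial ℂ) K (u k) := by
  rw [h.map_coord, mul_div_cancel₀ _ h.algebraMap_den_ne_zero]

/-- The parameter `X` is a root of `u k - y k G`, which has a constant leading coefficient when
`u k` has degree `d`. -/
theorem isIntegral_X (h : IsParametrized B K y u G d) :
    IsIntegral B (algebraMap (Polynomial ℂ) K Polynomial.X) := by
  obtain ⟨k, hk⟩ := h.exists_coeff_ne_zero
  let l := (u k).coeff d
  let p : Polynomial B := Polynomial.C (algebraMap ℂ B l⁻¹) *
    ((u k).map (algebraMap ℂ B) - Polynomial.C (y k) * G.map (algebraMap ℂ B))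
  have hdeg : p.natDegree ≤ d := by
    refine (Polynomial.natDegree_C_mul_le _ _).trans ((Polynomial.natDegree_sub_le _ _).trans ?_)
    refine max_le (Polynomial.natDegree_map_le.trans (h.natDegree_num_le k)) ?_
    refine (Polynomial.natDegree_C_mul_le _ _).trans (Polynomial.natDegree_map_le.trans ?_)
    exact h.natDegree_den_lt.le
  have hcoeff : p.coeff d = 1 := by
    simp only [p, Polynomial.coeff_C_mul, Polynomial.coeff_sub, Polynomial.coeff_map]
    rw [Polynomial.coeff_eq_zero_of_natDegree_lt h.natDegree_den_lt, map_zero, mul_zero, sub_zero,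
      ← map_mul, inv_mul_cancel₀ hk, map_one]
  refine ⟨p, Polynomial.monic_of_natDegree_le_of_coeff_eq_one d hdeg hcoeff, ?_⟩
  have hev : ∀ q : Polynomial ℂ, Polynomial.eval₂ (algebraMap B K)
      (algebraMap (Polynomial ℂ) K Polynomial.X) (q.map (algebraMap ℂ B)) =
      algebraMap (Polynomial ℂ) K q := by
    intro q
    rw [Polynomial.eval₂_map, ← IsScalarTower.algebraMap_eq ℂ B K,
      IsScalarTower.algebraMap_eq ℂ (Polynomial ℂ) K, ← Polynomial.hom_eval₂]
    congr 1
    exact Polynomial.eval₂_C_X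
  simp only [p, Polynomial.eval₂_mul, Polynomial.eval₂_sub, Polynomial.eval₂_C, hev]
  rw [mul_comm (algebraMap B K (y k)), h.den_mul_coord, sub_self, mul_zero]

theorem isIntegral_algebraMap (h : IsParametrized B K y u G d) (q : Polynomial ℂ) :
    IsIntegral B (algebraMap (Polynomial ℂ) K q) := by
  have hC : ∀ c : ℂ, IsIntegral B (algebraMap (Polynomial ℂ) K (Polynomial.C c)) := by
    intro c
    have : algebraMap (Polynomial ℂ) K (Polynomial.C c) = algebraMap B K (algebraMap ℂ B c) := by
      rw [← IsScalarTower.algebraMap_apply ℂ B K,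
        IsScalarTower.algebraMap_apply ℂ (Polynomial ℂ) K]
      rfl
    rw [this]
    exact _root_.isIntegral_algebraMap
  induction q using Polynomial.induction_on with
  | C c => exact hC c
  | add p q hp hq =>
    rw [map_add]
    exact hp.add hq
  | monomial n c _ =>
    rw [map_mul, map_pow]
    exact (hC c).mul (h.isIntegral_X.pow _)

omit [Algebra ℂ K] [IsScalarTower ℂ (Polynomial ℂ) K] [IsFractionRing (Polynomial ℂ) K]
  [IsScalarTower ℂ B K] in
/-- The polynomials `u 0`, `u 1`, `G` have no common root. -/
theorem exists_bezout (h : IsParametrized B K y u G d) :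
    ∃ α β γ : Polynomial ℂ, α * u 0 + β * u 1 + γ * G = 1 := by
  classical
  have hcop : IsCoprime (EuclideanDomain.gcd (u 0) (u 1)) G := by
    refine isCoprime_of_no_common_root fun τ hτ => h.den_eval_ne_zero τ fun k => ?_
    have hdvd : EuclideanDomain.gcd (u 0) (u 1) ∣ u k := by
      fin_cases k
      · exact EuclideanDomain.gcd_dvd_left _ _
      · exact EuclideanDomain.gcd_dvd_right _ _
    exact Polynomial.eval_eq_zero_of_dvd_of_eval_eq_zero hdvd hτ
  obtain ⟨x, γ, hx⟩ := hcop
  rw [EuclideanDomain.gcd_eq_gcd_ab] at hx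
  exact ⟨x * EuclideanDomain.gcdA (u 0) (u 1), x * EuclideanDomain.gcdB (u 0) (u 1), γ, by
    rw [← hx]
    ring⟩

/-- A relation `α u₀ + β u₁ + γ G = 1` shows that `1 / G = α y₀ + β y₁ + γ` is integral over `B`. -/
theorem isIntegral_inv_den (h : IsParametrized B K y u G d) :
    IsIntegral B (algebraMap (Polynomial ℂ) K G)⁻¹ := by
  obtain ⟨α, β, γ, hbez⟩ := h.exists_bezout
  have hG := h.algebraMap_den_ne_zero
  have : (algebraMap (Polynomial ℂ) K G)⁻¹ =
      algebraMap (Polynomial ℂ) K α * algebraMap B K (y 0) +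
      algebraMap (Polynomial ℂ) K β * algebraMap B K (y 1) + algebraMap (Polynomial ℂ) K γ := by
    apply mul_left_cancel₀ hG
    rw [mul_inv_cancel₀ hG, ← map_one (algebraMap (Polynomial ℂ) K), ← hbez, map_add, map_add,
      map_mul, map_mul, map_mul, ← h.den_mul_coord, ← h.den_mul_coord]
    ring
  rw [this]
  exact (((h.isIntegral_algebraMap α).mul _root_.isIntegral_algebraMap).add
    ((h.isIntegral_algebraMap β).mul _root_.isIntegral_algebraMap)).add (h.isIntegral_algebraMap γ)

/-- Elements of the integral closure are fractions with a power of `G` as denominator: `ℂ[X, 1 / G]`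
contains `B` and is integrally closed. -/
theorem exists_pow_mul_eq (h : IsParametrized B K y u G d) {x : K} (hx : IsIntegral B x) :
    ∃ (n : ℕ) (q : Polynomial ℂ),
      algebraMap (Polynomial ℂ) K G ^ n * x = algebraMap (Polynomial ℂ) K q := by
  have hM : Submonoid.powers G ≤ nonZeroDivisors (Polynomial ℂ) :=
    powers_le_nonZeroDivisors_of_noZeroDivisors h.den_ne_zero
  let S := Localization.subalgebra.ofField K (Submonoid.powers G) hM
  have hmemS : ∀ x : K, x ∈ S ↔ ∃ (a s : Polynomial ℂ) (_ : s ∈ Submonoid.powers G),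
      x = algebraMap (Polynomial ℂ) K a * (algebraMap (Polynomial ℂ) K s)⁻¹ := fun _ => Iff.rfl
  have : IsIntegrallyClosed S := isIntegrallyClosed_of_isLocalization S _ hM
  have hBS : ∀ b : B, algebraMap B K b ∈ S := by
    intro b
    obtain ⟨H, rfl⟩ := h.surjective b
    induction H using MvPolynomial.induction_on with
    | C c =>
      rw [algHom_C, ← IsScalarTower.algebraMap_apply ℂ B K,
        IsScalarTower.algebraMap_apply ℂ (Polynomial ℂ) K]
      exact S.algebraMap_mem _
    | add p q hp hq =>
      rw [map_add, map_add]
      exact S.add_mem hp hq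
    | mul_X p i hp =>
      rw [map_mul, map_mul, aeval_X]
      refine S.mul_mem hp ?_
      rw [h.map_coord, div_eq_mul_inv]
      exact (hmemS _).mpr ⟨u i, G, Submonoid.mem_powers G, rfl⟩
  have hxS : IsIntegral S x := by
    obtain ⟨p, hp, hpx⟩ := hx
    refine ⟨p.map ((algebraMap B K).codRestrict S hBS), hp.map _, ?_⟩
    rw [Polynomial.eval₂_map]
    exact hpx
  obtain ⟨z, hz⟩ := IsIntegrallyClosed.isIntegral_iff.mp hxS
  obtain ⟨a, s, ⟨n, rfl⟩, hs⟩ := (hmemS _).mp z.2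
  have hzx : (z : K) = x := hz
  refine ⟨n, a, ?_⟩
  rw [← hzx, hs, map_pow, mul_comm, mul_assoc,
    inv_mul_cancel₀ (pow_ne_zero n h.algebraMap_den_ne_zero), mul_one]

/-- The inclusion of `ℂ[X]` into the integral closure. -/
noncomputable def toIntegralClosure (h : IsParametrized B K y u G d) :
    Polynomial ℂ →+* integralClosure B K :=
  (algebraMap (Polynomial ℂ) K).codRestrict (integralClosure B K) h.isIntegral_algebraMap

/-- The integral closure of `B` in the function field is `ℂ[X, 1 / G]`. -/
theorem isLocalization_integralClosure (h : IsParametrized B K y u G d) :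
    letI := h.toIntegralClosure.toAlgebra
    IsLocalization (Submonoid.powers G) (integralClosure B K) := by
  let _ := h.toIntegralClosure.toAlgebra
  have hcoe : ∀ q : Polynomial ℂ, ((algebraMap (Polynomial ℂ) (integralClosure B K) q :
      integralClosure B K) : K) = algebraMap (Polynomial ℂ) K q := fun _ => rfl
  refine ⟨⟨?_, ?_, ?_⟩⟩
  · rintro ⟨_, n, rfl⟩
    simp only [map_pow]
    refine IsUnit.pow n (IsUnit.of_mul_eq_one
      ⟨(algebraMap (Polynomial ℂ) K G)⁻¹, h.isIntegral_inv_den⟩ ?_)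
    ext
    exact mul_inv_cancel₀ h.algebraMap_den_ne_zero
  · rintro ⟨x, hx⟩
    obtain ⟨n, q, hq⟩ := h.exists_pow_mul_eq hx
    refine ⟨(q, ⟨G ^ n, n, rfl⟩), ?_⟩
    ext
    rw [mul_comm]
    change algebraMap (Polynomial ℂ) K (G ^ n) * x = _
    rw [map_pow, hq]
    rfl
  · intro p q hpq
    refine ⟨1, ?_⟩
    have := congrArg (fun z : integralClosure B K => (z : K)) hpq
    rw [IsFractionRing.injective (Polynomial ℂ) K this]

omit [Algebra ℂ K] [IsScalarTower ℂ (Polynomial ℂ) K] [IsFractionRing (Polynomial ℂ) K]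
  [IsScalarTower ℂ B K] in
/-- A prime of a `B`-algebra lies over the origin if and only if it contains the coordinates. -/
theorem mem_primesOver_iff (h : IsParametrized B K y u G d) {T : Type*} [CommRing T] [Algebra B T]
    (Q : Ideal T) : Q ∈ (Ideal.span (Set.range y)).primesOver T ↔
      Q.IsPrime ∧ ∀ k, algebraMap B T (y k) ∈ Q := by
  constructor
  · rintro ⟨hQ, hover⟩
    refine ⟨hQ, fun k => ?_⟩
    have : y k ∈ Q.comap (algebraMap B T) := by
      have h1 := hover.over
      rw [Ideal.under_def] at h1
      rw [← h1]
      exact Ideal.subset_span ⟨k, rfl⟩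
    exact this
  · rintro ⟨hQ, hy⟩
    refine ⟨hQ, ⟨?_⟩⟩
    rw [Ideal.under_def]
    have hle : Ideal.span (Set.range y) ≤ Q.comap (algebraMap B T) := by
      rw [Ideal.span_le]
      rintro _ ⟨k, rfl⟩
      exact hy k
    refine le_antisymm hle fun b hb => ?_
    obtain ⟨H, rfl⟩ := h.surjective b
    have h1 : aeval y (H - C (eval 0 H)) ∈ Ideal.span (Set.range y) := by
      have := Ideal.mem_map_of_mem (aeval y : MvPolynomial (Fin 2) ℂ →ₐ[ℂ] B) (sub_C_mem_span_X H)
      rw [Ideal.map_span, ← Set.range_comp] at this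
      convert this using 3
      funext k
      simp
    rw [map_sub, algHom_C] at h1
    have h2 := Ideal.sub_mem _ hb (hle h1)
    rw [sub_sub_cancel] at h2
    by_cases h0 : eval 0 H = 0
    · rw [h0, map_zero, sub_zero] at h1
      exact h1
    · exfalso
      have hunit : IsUnit (algebraMap B T (algebraMap ℂ B (eval 0 H))) :=
        ((IsUnit.mk0 _ h0).map (algebraMap ℂ B)).map (algebraMap B T)
      exact hQ.ne_top (Ideal.eq_top_of_isUnit_mem _ h2 hunit)

/-- Every point of the normalization over the origin comes from a common zero of the
coordinates. -/
theorem exists_map_eq_of_mem_primesOver (h : IsParametrized B K y u G d)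
    {Q : Ideal (integralClosure B K)}
    (hQ : Q ∈ (Ideal.span (Set.range y)).primesOver (integralClosure B K)) :
    ∃ τ : ℂ, (∀ k, (u k).eval τ = 0) ∧
      Ideal.map h.toIntegralClosure (Ideal.span {Polynomial.X - Polynomial.C τ}) = Q := by
  let _ := h.toIntegralClosure.toAlgebra
  have hloc : IsLocalization (Submonoid.powers G) (integralClosure B K) :=
    h.isLocalization_integralClosure
  have hcoord : ∀ k, algebraMap (Polynomial ℂ) (integralClosure B K) G *
      algebraMap B (integralClosure B K) (y k) =
      algebraMap (Polynomial ℂ) (integralClosure B K) (u k) := by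
    intro k
    ext
    exact h.den_mul_coord k
  obtain ⟨hQp, hQy⟩ := (h.mem_primesOver_iff Q).mp hQ
  have hu : ∀ k, u k ∈ Q.under (Polynomial ℂ) := by
    intro k
    change algebraMap _ _ (u k) ∈ Q
    rw [← hcoord]
    exact Ideal.mul_mem_left _ _ (hQy k)
  have hqp : (Q.under (Polynomial ℂ)).IsPrime := Ideal.IsPrime.under _ _
  obtain ⟨k, hk⟩ := h.exists_coeff_ne_zero
  have hne : Q.under (Polynomial ℂ) ≠ ⊥ := by
    intro hbot
    have := hu k
    rw [hbot, Submodule.mem_bot] at this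
    exact hk (by rw [this, Polynomial.coeff_zero])
  obtain ⟨q, hq, hqprime⟩ := hqp.exists_mem_prime_of_ne_bot hne
  obtain ⟨τ, hτ⟩ := IsAlgClosed.exists_root q
    (Polynomial.degree_ne_of_natDegree_ne (by
      intro h0
      have := Polynomial.eq_C_of_natDegree_eq_zero h0
      apply hqprime.not_isUnit
      rw [this, Polynomial.isUnit_C, isUnit_iff_ne_zero]
      intro h1
      rw [h1, Polynomial.C_0] at this
      exact hqprime.ne_zero this))
  have hX : Polynomial.X - Polynomial.C τ ∈ Q.under (Polynomial ℂ) := by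
    have hass := (Polynomial.irreducible_X_sub_C τ).associated_of_dvd hqprime.irreducible
      (Polynomial.dvd_iff_isRoot.mpr hτ)
    exact Ideal.mem_of_dvd _ hass.symm.dvd hq
  have heq : Q.under (Polynomial ℂ) = Ideal.span {Polynomial.X - Polynomial.C τ} := by
    symm
    refine (PrincipalIdealRing.isMaximal_of_irreducible
      (Polynomial.irreducible_X_sub_C τ)).eq_of_le hqp.ne_top ?_
    rwa [Ideal.span_singleton_le_iff_mem]
  refine ⟨τ, fun k => ?_, ?_⟩
  · have := hu k
    rwa [heq, Ideal.mem_span_singleton, Polynomial.dvd_iff_isRoot] at this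
  · rw [← heq]
    exact IsLocalization.map_under (Submonoid.powers G) _ Q

/-- The points of the normalization over the origin are the common zeros of the coordinates. -/
theorem ncard_primesOver (h : IsParametrized B K y u G d) :
    ((Ideal.span (Set.range y)).primesOver (integralClosure B K)).ncard =
      {τ : ℂ | ∀ k, (u k).eval τ = 0}.ncard := by
  let _ := h.toIntegralClosure.toAlgebra
  have hloc : IsLocalization (Submonoid.powers G) (integralClosure B K) :=
    h.isLocalization_integralClosure
  have hcoord : ∀ k, algebraMap (Polynomial ℂ) (integralClosure B K) G *
      algebraMap B (integralClosure B K) (y k) =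
      algebraMap (Polynomial ℂ) (integralClosure B K) (u k) := by
    intro k
    ext
    exact h.den_mul_coord k
  have hunitG : IsUnit (algebraMap (Polynomial ℂ) (integralClosure B K) G) :=
    IsLocalization.map_units (M := Submonoid.powers G) _ ⟨G, Submonoid.mem_powers G⟩
  have hprime : ∀ τ : ℂ, (Ideal.span {Polynomial.X - Polynomial.C τ} :
      Ideal (Polynomial ℂ)).IsPrime := fun τ =>
    (Ideal.span_singleton_prime (Polynomial.X_sub_C_ne_zero τ)).mpr (Polynomial.prime_X_sub_C τ)
  have hdisj : ∀ τ : ℂ, (∀ k, (u k).eval τ = 0) → Disjoint (Submonoid.powers G : Set (Polynomial ℂ))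
      (Ideal.span {Polynomial.X - Polynomial.C τ} : Ideal (Polynomial ℂ)) := by
    intro τ hτ
    rw [Set.disjoint_left]
    rintro _ ⟨n, rfl⟩ hn
    rw [SetLike.mem_coe, Ideal.mem_span_singleton, Polynomial.dvd_iff_isRoot,
      Polynomial.IsRoot.def, Polynomial.eval_pow] at hn
    exact pow_ne_zero n (h.den_eval_ne_zero τ hτ) hn
  symm
  refine Set.ncard_congr (fun τ _ => Ideal.map (algebraMap (Polynomial ℂ) (integralClosure B K))
    (Ideal.span {Polynomial.X - Polynomial.C τ})) ?_ ?_ ?_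
  · intro τ hτ
    rw [h.mem_primesOver_iff]
    refine ⟨IsLocalization.isPrime_of_isPrime_disjoint (Submonoid.powers G) _ _ (hprime τ)
      (hdisj τ hτ), fun k => ?_⟩
    rw [← Ideal.unit_mul_mem_iff_mem _ hunitG, hcoord]
    refine Ideal.mem_map_of_mem _ ?_
    rw [Ideal.mem_span_singleton, Polynomial.dvd_iff_isRoot]
    exact hτ k
  · intro τ σ hτ hσ heq
    have := congrArg (Ideal.under (Polynomial ℂ)) heq
    rw [IsLocalization.under_map_of_isPrime_disjoint (Submonoid.powers G) _ (hprime τ) (hdisj τ hτ),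
      IsLocalization.under_map_of_isPrime_disjoint (Submonoid.powers G) _ (hprime σ)
        (hdisj σ hσ)] at this
    have h1 : Polynomial.X - Polynomial.C τ ∈
        (Ideal.span {Polynomial.X - Polynomial.C σ} : Ideal (Polynomial ℂ)) := by
      rw [← this]
      exact Ideal.mem_span_singleton_self _
    rw [Ideal.mem_span_singleton, Polynomial.dvd_iff_isRoot] at h1
    simpa [sub_eq_zero, eq_comm] using h1
  · intro Q hQ
    obtain ⟨τ, hτ, hmap⟩ := h.exists_map_eq_of_mem_primesOver hQ
    exact ⟨τ, hτ, hmap⟩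

end IsParametrized

/-! ### The coordinate ring of an affine chart -/

/-- `F` is an irreducible form generating the ideal of relations between the `f i`. -/
structure IsEquation (f : Fin 3 → MvPolynomial (Fin 2) ℂ) (F : MvPolynomial (Fin 3) ℂ) : Prop where
  isHomogeneous : F.IsHomogeneous F.totalDegree
  irreducible : Irreducible F
  aeval_eq_zero_iff : ∀ G, aeval f G = 0 ↔ F ∣ G

theorem IsEquation.aeval_eq_zero {f : Fin 3 → MvPolynomial (Fin 2) ℂ}
    {F : MvPolynomial (Fin 3) ℂ} (hE : IsEquation f F) : aeval f F = 0 :=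
  (hE.aeval_eq_zero_iff F).mpr dvd_rfl

theorem exists_isEquation {d : ℕ} (hd : 0 < d) {f : Fin 3 → MvPolynomial (Fin 2) ℂ}
    (hf : ∀ i, (f i).IsHomogeneous d) (hlin : LinearIndependent ℂ f) : ∃ F, IsEquation f F :=
  let ⟨F, h1, h2, h3⟩ := exists_generator_of_relations hd hf hlin
  ⟨F, h1, h2, h3⟩

theorem aeval_apply_eq_eval {n : ℕ} (x : Fin n → ℂ) (F : MvPolynomial (Fin n) ℂ) :
    aeval x F = eval x F := by
  rw [← coe_aeval_eq_eval]
  rfl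

theorem eval_aeval_eq {f : Fin 3 → MvPolynomial (Fin 2) ℂ} (G : MvPolynomial (Fin 3) ℂ)
    (v : Fin 2 → ℂ) : eval v (aeval f G) = eval (fun i => eval v (f i)) G := by
  induction G using MvPolynomial.induction_on with
  | C c => simp
  | add p q hp hq => simp only [map_add, hp, hq]
  | mul_X p i hp => simp only [map_mul, hp, aeval_X, eval_X]

theorem IsEquation.totalDegree_pos {f : Fin 3 → MvPolynomial (Fin 2) ℂ}
    {F : MvPolynomial (Fin 3) ℂ} (hE : IsEquation f F) : 0 < F.totalDegree := by
  rw [Nat.pos_iff_ne_zero]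
  intro h
  rw [totalDegree_eq_zero_iff_eq_C] at h
  apply hE.irreducible.not_isUnit
  rw [h]
  refine (IsUnit.mk0 _ fun h0 => ?_).map C
  rw [h0, C_0] at h
  exact hE.irreducible.ne_zero h

namespace Chart

variable {f : Fin 3 → MvPolynomial (Fin 2) ℂ} {P : P2} (c : Chart f P)

/-- The affine coordinates along the curve, as rational functions of the parameter. -/
noncomputable def coord (k : Fin 2) : RatFunc ℂ :=
  algebraMap (Polynomial ℂ) (RatFunc ℂ) (c.num k) / algebraMap (Polynomial ℂ) (RatFunc ℂ) c.den

/-- The parametrization of the affine curve, as a homomorphism to the function field. -/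
noncomputable def paramHom : MvPolynomial (Fin 2) ℂ →ₐ[ℂ] RatFunc ℂ := aeval c.coord

theorem algebraMap_lineRestrict_aeval (G : MvPolynomial (Fin 3) ℂ) :
    algebraMap (Polynomial ℂ) (RatFunc ℂ) (lineRestrict c.a c.b (aeval f G)) =
      aeval (fun j => algebraMap (Polynomial ℂ) (RatFunc ℂ) (lineRestrict c.a c.b (f j))) G := by
  have : ((IsScalarTower.toAlgHom ℂ (Polynomial ℂ) (RatFunc ℂ)).comp
      (lineRestrict c.a c.b)).comp (aeval f) =
      aeval (fun j => algebraMap (Polynomial ℂ) (RatFunc ℂ) (lineRestrict c.a c.b (f j))) := by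
    ext j
    simp
  exact DFunLike.congr_fun this G

theorem algebraMap_num (k : Fin 2) (hden : c.den ≠ 0) :
    algebraMap ℂ (RatFunc ℂ) (P.rep (chartIndex P)) *
        algebraMap (Polynomial ℂ) (RatFunc ℂ) (lineRestrict c.a c.b (f (affineIndex P k))) -
      algebraMap ℂ (RatFunc ℂ) (P.rep (affineIndex P k)) *
        algebraMap (Polynomial ℂ) (RatFunc ℂ) (lineRestrict c.a c.b (f (chartIndex P))) =
      algebraMap (Polynomial ℂ) (RatFunc ℂ) (lineRestrict c.a c.b (f (chartIndex P))) *
        c.coord k := by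
  have hden' : algebraMap (Polynomial ℂ) (RatFunc ℂ) c.den ≠ 0 :=
    (map_ne_zero_iff _ (IsFractionRing.injective (Polynomial ℂ) (RatFunc ℂ))).mpr hden
  have h1 : algebraMap (Polynomial ℂ) (RatFunc ℂ) (lineRestrict c.a c.b (f (chartIndex P))) *
      c.coord k = algebraMap (Polynomial ℂ) (RatFunc ℂ) (c.num k) := by
    rw [coord]
    exact mul_div_cancel₀ _ hden'
  rw [h1, num_eq, map_sub, map_mul, map_mul, IsScalarTower.algebraMap_apply ℂ (Polynomial ℂ),
    IsScalarTower.algebraMap_apply ℂ (Polynomial ℂ)]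
  rfl

/-- The ideal of the affine curve is generated by the local equation: a relation between the affine
coordinates homogenizes to a multiple of `F`. -/
theorem paramHom_eq_zero_iff {d : ℕ} (hf : ∀ i, (f i).IsHomogeneous d)
    (hlin : LinearIndependent ℂ f) {F : MvPolynomial (Fin 3) ℂ} (hE : IsEquation f F)
    (H : MvPolynomial (Fin 2) ℂ) : c.paramHom H = 0 ↔ localEquation F P ∣ H := by
  have hden := c.den_ne_zero hf hlin
  have hinj := IsFractionRing.injective (Polynomial ℂ) (RatFunc ℂ)
  have hden' : algebraMap (Polynomial ℂ) (RatFunc ℂ) c.den ≠ 0 :=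
    (map_ne_zero_iff _ hinj).mpr hden
  have hp : algebraMap ℂ (RatFunc ℂ) (P.rep (chartIndex P)) ≠ 0 := by
    rw [map_ne_zero]
    exact rep_chartIndex_ne_zero P
  constructor
  · intro hH
    obtain ⟨n, Hh, hhom, hval⟩ := exists_homogenization P H
    have h1 := hval (fun j => algebraMap (Polynomial ℂ) (RatFunc ℂ) (lineRestrict c.a c.b (f j)))
      c.coord fun k => c.algebraMap_num k hden
    have h2 : aeval f Hh = 0 := by
      refine eq_zero_of_lineRestrict_eq_zero c.det_ne_zero (hhom.aeval f hf) (hinj ?_)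
      rw [algebraMap_lineRestrict_aeval, h1, map_zero]
      change _ * c.paramHom H = 0
      rw [hH, mul_zero]
    obtain ⟨K, hK⟩ := (hE.aeval_eq_zero_iff Hh).mp h2
    have h3 := hval (affinePoint P (X : Fin 2 → MvPolynomial (Fin 2) ℂ)) X (by
      intro k
      rw [affinePoint_chartIndex, affinePoint_affineIndex]
      ring)
    rw [hK, map_mul, ← localEquation_eq, affinePoint_chartIndex, aeval_X_left_apply] at h3
    have hunit : IsUnit (algebraMap ℂ (MvPolynomial (Fin 2) ℂ) (P.rep (chartIndex P)) ^ n) :=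
      ((IsUnit.mk0 _ (rep_chartIndex_ne_zero P)).map (algebraMap ℂ _)).pow n
    rw [← hunit.dvd_mul_left, ← h3]
    exact dvd_mul_right _ _
  · rintro ⟨K, rfl⟩
    rw [map_mul, paramHom, aeval_localEquation]
    have h1 : (fun j => (algebraMap (Polynomial ℂ) (RatFunc ℂ) c.den) *
        affinePoint P c.coord j) =
        fun j => algebraMap ℂ (RatFunc ℂ) (P.rep (chartIndex P)) *
          algebraMap (Polynomial ℂ) (RatFunc ℂ) (lineRestrict c.a c.b (f j)) := by
      funext j
      obtain rfl | ⟨k, rfl⟩ := index_cases P j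
      · rw [affinePoint_chartIndex, mul_comm]
        rfl
      · have := c.algebraMap_num k hden
        rw [sub_eq_iff_eq_add] at this
        rw [affinePoint_affineIndex, this, mul_add, mul_comm _ (algebraMap ℂ _ _), add_comm]
        rfl
    have h2 := aeval_smul_of_isHomogeneous hE.isHomogeneous
      (algebraMap (Polynomial ℂ) (RatFunc ℂ) c.den) (affinePoint P c.coord)
    rw [h1, aeval_smul_of_isHomogeneous hE.isHomogeneous, ← algebraMap_lineRestrict_aeval,
      hE.aeval_eq_zero, map_zero, map_zero, mul_zero] at h2
    rw [(mul_eq_zero.mp h2.symm).resolve_left (pow_ne_zero _ hden'), zero_mul]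

/-- The inclusion of the affine coordinate ring into the function field of the line. -/
noncomputable def quotHom {d : ℕ} (hf : ∀ i, (f i).IsHomogeneous d)
    (hlin : LinearIndependent ℂ f) {F : MvPolynomial (Fin 3) ℂ} (hE : IsEquation f F) :
    AffineRing F P →ₐ[ℂ] RatFunc ℂ :=
  Ideal.Quotient.liftₐ (Ideal.span {localEquation F P}) c.paramHom fun H hH =>
    (c.paramHom_eq_zero_iff hf hlin hE H).mpr (Ideal.mem_span_singleton.mp hH)

theorem quotHom_mk {d : ℕ} (hf : ∀ i, (f i).IsHomogeneous d)
    (hlin : LinearIndependent ℂ f) {F : MvPolynomial (Fin 3) ℂ} (hE : IsEquation f F)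
    (H : MvPolynomial (Fin 2) ℂ) :
    c.quotHom hf hlin hE (Ideal.Quotient.mk _ H) = c.paramHom H := rfl

theorem quotHom_injective {d : ℕ} (hf : ∀ i, (f i).IsHomogeneous d)
    (hlin : LinearIndependent ℂ f) {F : MvPolynomial (Fin 3) ℂ} (hE : IsEquation f F) :
    Function.Injective (c.quotHom hf hlin hE) := by
  rw [injective_iff_map_eq_zero]
  intro x hx
  obtain ⟨H, rfl⟩ := Ideal.Quotient.mk_surjective x
  rw [quotHom_mk, c.paramHom_eq_zero_iff hf hlin hE] at hx
  exact Ideal.Quotient.eq_zero_iff_mem.mpr (Ideal.mem_span_singleton.mpr hx)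

theorem isParametrized {d : ℕ} (hd : 0 < d) (hf : ∀ i, (f i).IsHomogeneous d)
    (hreg : NoCommonZero f)
    (hlin : LinearIndependent ℂ f) {F : MvPolynomial (Fin 3) ℂ} (hE : IsEquation f F) :
    letI := (c.quotHom hf hlin hE).toRingHom.toAlgebra
    IsParametrized (AffineRing F P) (RatFunc ℂ)
      (fun k => Ideal.Quotient.mk (Ideal.span {localEquation F P}) (X k)) c.num c.den d := by
  let _ := (c.quotHom hf hlin hE).toRingHom.toAlgebra
  refine ⟨?_, ?_, c.den_ne_zero hf hlin, c.natDegree_den_lt hf hd, c.natDegree_num_le hf,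
    c.exists_coeff_num_ne_zero hf hreg, fun τ => c.den_eval_ne_zero hreg⟩
  · intro x
    obtain ⟨H, rfl⟩ := Ideal.Quotient.mk_surjective x
    refine ⟨H, ?_⟩
    have : (aeval fun k => Ideal.Quotient.mk (Ideal.span {localEquation F P}) (X k)) =
        Ideal.Quotient.mkₐ ℂ (Ideal.span {localEquation F P}) := by
      ext k
      simp
    rw [this]
    rfl
  · intro k
    change c.quotHom hf hlin hE _ = _
    rw [quotHom_mk, paramHom, aeval_X]
    rfl

/-- A point of the curve `F = 0` is in the image of the parametrization: by lying over, there is a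
point of the normalization above it. -/
theorem exists_point_of_mem_curvePoints {d : ℕ} (hd : 0 < d) (hf : ∀ i, (f i).IsHomogeneous d)
    (hreg : NoCommonZero f)
    (hlin : LinearIndependent ℂ f) {F : MvPolynomial (Fin 3) ℂ} (hE : IsEquation f F)
    (hP : P ∈ curvePoints F) : ∃ τ, ∀ k, (c.num k).eval τ = 0 := by
  let _ := (c.quotHom hf hlin hE).toRingHom.toAlgebra
  have : IsScalarTower ℂ (AffineRing F P) (RatFunc ℂ) :=
    IsScalarTower.of_algebraMap_eq' (c.quotHom hf hlin hE).comp_algebraMap.symm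
  have hpar : IsParametrized (AffineRing F P) (RatFunc ℂ)
      (fun k => Ideal.Quotient.mk (Ideal.span {localEquation F P}) (X k)) c.num c.den d :=
    c.isParametrized hd hf hreg hlin hE
  let e : AffineRing F P →ₐ[ℂ] ℂ := Ideal.Quotient.liftₐ (Ideal.span {localEquation F P})
    (aeval (0 : Fin 2 → ℂ)) (by
      intro H hH
      obtain ⟨K, rfl⟩ := Ideal.mem_span_singleton.mp hH
      rw [map_mul, aeval_localEquation]
      have : affinePoint P (0 : Fin 2 → ℂ) = P.rep := by
        funext j
        obtain rfl | ⟨k, rfl⟩ := index_cases P j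
        · simp
        · simp
      rw [this]
      have hP' : aeval P.rep F = 0 := by rw [aeval_apply_eq_eval]; exact hP
      rw [hP', zero_mul])
  have hker : RingHom.ker e ∈ (pointIdeal F P).primesOver (AffineRing F P) := by
    refine (hpar.mem_primesOver_iff _).mpr ⟨RingHom.ker_isPrime _, fun k => ?_⟩
    rw [RingHom.mem_ker]
    change aeval (0 : Fin 2 → ℂ) (X k) = 0
    simp
  have hpt : pointIdeal F P = RingHom.ker e := by
    have := hker.2.over
    rwa [Ideal.under_def, Algebra.algebraMap_self, Ideal.comap_id] at this
  have hprime : (pointIdeal F P).IsPrime := hpt ▸ RingHom.ker_isPrime e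
  have hfaith : FaithfulSMul (AffineRing F P) (integralClosure (AffineRing F P) (RatFunc ℂ)) := by
    rw [faithfulSMul_iff_algebraMap_injective]
    intro x y hxy
    exact c.quotHom_injective hf hlin hE (congrArg Subtype.val hxy)
  obtain ⟨Q, hQ⟩ := Ideal.nonempty_primesOver (S := integralClosure (AffineRing F P) (RatFunc ℂ))
    (pointIdeal F P)
  obtain ⟨τ, hτ, -⟩ := hpar.exists_map_eq_of_mem_primesOver hQ
  exact ⟨τ, hτ⟩

end Chart

theorem IsEquation.curvePoints_eq {d : ℕ} (hd : 0 < d) {f : Fin 3 → MvPolynomial (Fin 2) ℂ}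
    (hf : ∀ i, (f i).IsHomogeneous d) (hreg : NoCommonZero f) (hlin : LinearIndependent ℂ f)
    {F : MvPolynomial (Fin 3) ℂ} (hE : IsEquation f F) :
    curvePoints F = Set.range (projMap f hreg) := by
  ext P
  constructor
  · intro hP
    obtain ⟨c⟩ := nonempty_chart hd hf P
    obtain ⟨τ, hτ⟩ := c.exists_point_of_mem_curvePoints hd hf hreg hlin hE hP
    exact ⟨_, (c.projMap_point_eq_iff hf hreg τ).mpr hτ⟩
  · rintro ⟨Q, rfl⟩
    unfold projMap
    rw [mem_curvePoints_mk hE.isHomogeneous, ← eval_aeval_eq, hE.aeval_eq_zero, map_zero]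

theorem eval_zero_of_isHomogeneous {n : ℕ} {F : MvPolynomial (Fin 3) ℂ} (hF : F.IsHomogeneous n)
    (hn : 0 < n) : eval 0 F = 0 := by
  have := eval_smul_of_isHomogeneous hF 0 0
  rwa [zero_pow hn.ne', zero_mul, smul_zero] at this

/-- A reduced equation of the image is irreducible and generates the relations: by the
Nullstellensatz it divides a power of the generator. -/
theorem IsReducedEquation.isEquation {d : ℕ} (hd : 0 < d) {f : Fin 3 → MvPolynomial (Fin 2) ℂ}
    (hf : ∀ i, (f i).IsHomogeneous d) (hreg : NoCommonZero f) (hlin : LinearIndependent ℂ f)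
    {F : MvPolynomial (Fin 3) ℂ} (hF : IsReducedEquation F (Set.range (projMap f hreg))) :
    IsEquation f F := by
  obtain ⟨F₀, hE⟩ := exists_isEquation hd hf hlin
  obtain ⟨hhom, hsq, hpts⟩ := hF
  have hzero : aeval f F = 0 := by
    refine MvPolynomial.funext fun v => ?_
    rw [map_zero]
    by_cases hv : v = 0
    · subst hv
      have hpos : 0 < F.totalDegree := by
        rw [Nat.pos_iff_ne_zero]
        intro h
        rw [totalDegree_eq_zero_iff_eq_C] at h
        have hmem : projMap f hreg (Projectivization.mk ℂ ![1, 0]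
            (fun h => by simpa using congrFun h 0)) ∈ curvePoints F := by
          rw [hpts]
          exact ⟨_, rfl⟩
        unfold curvePoints at hmem
        rw [Set.mem_ofPred_eq, h, eval_C] at hmem
        rw [hmem, C_0] at h
        exact hsq.ne_zero h
      rw [eval_aeval_eq]
      have h0 : (fun i => eval 0 (f i)) = 0 := by
        funext i
        have := eval_smul_of_isHomogeneous (hf i) 0 0
        rwa [zero_pow hd.ne', zero_mul, smul_zero] at this
      rw [h0, eval_zero_of_isHomogeneous hhom hpos]
    · have hmem : projMap f hreg (Projectivization.mk ℂ v hv) ∈ curvePoints F := by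
        rw [hpts]
        exact ⟨_, rfl⟩
      rw [projMap_mk f hf, mem_curvePoints_mk hhom] at hmem
      rw [eval_aeval_eq, hmem]
  have hdvd := (hE.aeval_eq_zero_iff F).mp hzero
  have hrad : F₀ ∈ (Ideal.span {F}).radical := by
    rw [← vanishingIdeal_zeroLocus_eq_radical (K := ℂ), mem_vanishingIdeal_iff]
    intro x hx
    rw [mem_zeroLocus_iff] at hx
    have hxF : eval x F = 0 := by
      have := hx F (Ideal.mem_span_singleton_self F)
      rwa [aeval_apply_eq_eval] at this
    rw [aeval_apply_eq_eval]
    by_cases hx0 : x = 0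
    · subst hx0
      exact eval_zero_of_isHomogeneous hE.isHomogeneous hE.totalDegree_pos
    · refine (mem_curvePoints_mk hE.isHomogeneous x hx0).mp ?_
      rw [hE.curvePoints_eq hd hf hreg hlin, ← hpts]
      exact (mem_curvePoints_mk hhom x hx0).mpr hxF
  obtain ⟨n, hn⟩ := hrad
  rw [Ideal.mem_span_singleton] at hn
  have hn0 : n ≠ 0 := by
    rintro rfl
    rw [pow_zero] at hn
    exact hE.irreducible.not_isUnit (isUnit_of_dvd_one (hdvd.trans hn))
  have hass : Associated F F₀ := associated_of_dvd_dvd ((hsq.dvd_pow_iff_dvd hn0).mp hn) hdvd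
  exact ⟨hhom, hass.symm.irreducible hE.irreducible, fun G => by
    rw [hE.aeval_eq_zero_iff, hass.dvd_iff_dvd_left]⟩

/-! ### Zeros of binary forms -/

/-- The linear form vanishing at the point `v` of the projective line. -/
noncomputable def linForm (v : Fin 2 → ℂ) : MvPolynomial (Fin 2) ℂ :=
  C (v 1) * X 0 - C (v 0) * X 1

theorem eval_linForm (v w : Fin 2 → ℂ) : eval w (linForm v) = det2 w v := by
  simp [linForm, det2]
  ring

/-- A binary form vanishing at `v` is divisible by the linear form of `v`: modulo that linear form
the vector of the variables is a multiple of `v`. -/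
theorem linForm_dvd {n : ℕ} {h : MvPolynomial (Fin 2) ℂ} (hh : h.IsHomogeneous n)
    {v : Fin 2 → ℂ} (hv : v ≠ 0) (h0 : eval v h = 0) : linForm v ∣ h := by
  obtain ⟨b, hb⟩ := exists_det2_ne_zero hv
  let S := MvPolynomial (Fin 2) ℂ ⧸ Ideal.span {linForm v}
  let c : MvPolynomial (Fin 2) ℂ := C (det2 v b)⁻¹ * (C (b 1) * X 0 - C (b 0) * X 1)
  have hdiv : ∀ j, X j - c * C (v j) = linForm v * C (-(b j) * (det2 v b)⁻¹) := by
    have hone : (C (det2 v b) * C (det2 v b)⁻¹ : MvPolynomial (Fin 2) ℂ) = 1 := by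
      rw [← C_mul, mul_inv_cancel₀ hb, C_1]
    unfold det2 at hone
    simp only [C_sub, C_mul] at hone
    simp only [c, linForm, det2, C_mul, C_neg]
    rw [Fin.forall_fin_two]
    constructor
    · linear_combination (-X 0) * hone
    · linear_combination (-X 1) * hone
  have hX : ∀ j, Ideal.Quotient.mkₐ ℂ (Ideal.span {linForm v}) (X j) =
      Ideal.Quotient.mkₐ ℂ (Ideal.span {linForm v}) c * algebraMap ℂ S (v j) := by
    intro j
    have hC : algebraMap ℂ S (v j) =
        Ideal.Quotient.mkₐ ℂ (Ideal.span {linForm v}) (C (v j)) := rfl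
    rw [hC, ← map_mul]
    refine Ideal.Quotient.eq.mpr (Ideal.mem_span_singleton.mpr ?_)
    exact ⟨_, hdiv j⟩
  have h1 : Ideal.Quotient.mkₐ ℂ (Ideal.span {linForm v}) h =
      aeval (fun j => Ideal.Quotient.mkₐ ℂ (Ideal.span {linForm v}) (X j)) h := by
    rw [← MvPolynomial.comp_aeval_apply, aeval_X_left_apply]
  have h2 : aeval (fun j => algebraMap ℂ S (v j)) h = 0 := by
    have := aeval_algebraMap_apply S v h
    rw [aeval_apply_eq_eval, h0, map_zero] at this
    exact this
  rw [funext hX, aeval_smul_of_isHomogeneous hh, h2, mul_zero] at h1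
  exact Ideal.mem_span_singleton.mp (Ideal.Quotient.eq_zero_iff_mem.mp h1)

theorem not_isUnit_linForm (v : Fin 2 → ℂ) : ¬ IsUnit (linForm v) := by
  intro h
  have := h.map (eval v)
  rw [eval_linForm] at this
  apply this.ne_zero
  unfold det2
  ring

theorem eval_rep_eq_zero_iff {n : ℕ} {h : MvPolynomial (Fin 2) ℂ} (hh : h.IsHomogeneous n)
    {v : Fin 2 → ℂ} (hv : v ≠ 0) :
    eval (Projectivization.mk ℂ v hv).rep h = 0 ↔ eval v h = 0 := by
  obtain ⟨r, hr⟩ := Projectivization.exists_smul_eq_mk_rep ℂ v hv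
  rw [← hr, Units.smul_def, eval_smul_of_isHomogeneous hh]
  simp

theorem finite_setOf_eval_eq_zero {n : ℕ} {h : MvPolynomial (Fin 2) ℂ} (hh : h.IsHomogeneous n)
    (h0 : h ≠ 0) : {Q : P1 | eval Q.rep h = 0}.Finite := by
  have hab : det2 ![1, 0] ![0, 1] ≠ 0 := by simp [det2]
  have ha : (![1, 0] : Fin 2 → ℂ) ≠ 0 := fun h => by simpa using congrFun h 0
  have hne : lineRestrict ![1, 0] ![0, 1] h ≠ 0 := fun h1 =>
    h0 (eq_zero_of_lineRestrict_eq_zero hab hh h1)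
  refine (((Polynomial.finite_setOfPred_isRoot hne).image (linePoint _ _ hab)).insert
    (Projectivization.mk ℂ _ ha)).subset ?_
  intro Q hQ
  induction Q using Projectivization.ind with
  | h v hv =>
    rw [Set.mem_ofPred_eq, eval_rep_eq_zero_iff hh] at hQ
    by_cases hva : det2 ![1, 0] v = 0
    · left
      obtain ⟨c, hc⟩ := eq_smul_of_det2_eq_zero ha hva
      exact mk_eq_mk_of_smul hv ha c hc.symm
    · right
      obtain ⟨τ, hτ⟩ := exists_linePoint_eq hab hv hva
      refine ⟨τ, ?_, hτ⟩
      rw [← eval_rep_eq_zero_iff hh hv, ← hτ, linePoint, eval_rep_eq_zero_iff hh] at hQ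
      rw [Set.mem_ofPred_eq, Polynomial.IsRoot.def, eval_lineRestrict, hQ]

theorem numForm_ne_zero {f : Fin 3 → MvPolynomial (Fin 2) ℂ} (hlin : LinearIndependent ℂ f)
    (P : P2) (k : Fin 2) : numForm f P k ≠ 0 := by
  intro h
  have h1 := sum_C_mul_eq_zero_iff.mp hlin (fun j => if j = affineIndex P k then
    P.rep (chartIndex P) else if j = chartIndex P then -P.rep (affineIndex P k) else 0) ?_
  · have := congrFun h1 (affineIndex P k)
    rw [if_pos rfl] at this
    exact rep_chartIndex_ne_zero P this
  · have hne : affineIndex P k ≠ chartIndex P := Fin.succAbove_ne _ _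
    rw [← h, ← Finset.sum_subset (Finset.subset_univ {affineIndex P k, chartIndex P}),
      Finset.sum_pair hne]
    · simp [hne.symm, numForm, sub_eq_add_neg]
    · intro j _ hj
      simp only [Finset.mem_insert, Finset.mem_singleton, not_or] at hj
      simp [hj.1, hj.2]

/-- The fibres of a nondegenerate parametrization are finite. -/
theorem finite_fibre {d : ℕ} {f : Fin 3 → MvPolynomial (Fin 2) ℂ}
    (hf : ∀ i, (f i).IsHomogeneous d) (hreg : NoCommonZero f) (hlin : LinearIndependent ℂ f)
    (P : P2) : {Q : P1 | projMap f hreg Q = P}.Finite := by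
  refine (finite_setOf_eval_eq_zero (isHomogeneous_numForm hf 0)
    (numForm_ne_zero hlin P 0)).subset ?_
  rintro Q rfl
  obtain ⟨r, hr⟩ := Projectivization.exists_smul_eq_mk_rep ℂ _ (hreg Q.rep Q.rep_nonzero)
  have hr' : ∀ j, (projMap f hreg Q).rep j = r * eval Q.rep (f j) := fun j =>
    (congrFun hr j).symm
  rw [Set.mem_ofPred_eq, numForm]
  simp only [map_sub, map_mul, eval_C, hr']
  ring

/-! ### Common divisors -/

/-- A nonconstant common divisor would be a form, with a zero common to the `f i`. -/
theorem isUnit_of_forall_dvd {d : ℕ} {f : Fin 3 → MvPolynomial (Fin 2) ℂ}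
    (hf : ∀ i, (f i).IsHomogeneous d) (hreg : NoCommonZero f) (h0 : f 0 ≠ 0)
    {B : MvPolynomial (Fin 2) ℂ} (hB : ∀ i, B ∣ f i) : IsUnit B := by
  obtain ⟨K, hK⟩ := hB 0
  have hBh := (isHomogeneous_of_mul (hK ▸ hf 0) (hK ▸ h0)).1
  have hB0 : B ≠ 0 := by
    rintro rfl
    rw [zero_mul] at hK
    exact h0 hK
  rcases Nat.eq_zero_or_pos B.totalDegree with hdeg | hdeg
  · rw [totalDegree_eq_zero_iff_eq_C] at hdeg
    rw [hdeg]
    refine (IsUnit.mk0 _ fun hc => ?_).map C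
    rw [hc, C_0] at hdeg
    exact hB0 hdeg
  · obtain ⟨v, hv, hv0⟩ := exists_eval_eq_zero hdeg hBh
    refine absurd (funext fun i => ?_) (hreg v hv)
    obtain ⟨L, hL⟩ := hB i
    rw [hL, map_mul, hv0, zero_mul]
    rfl

/-- A vector proportional to a vector without common divisor is a multiple of it. -/
theorem exists_eq_mul_of_proportional {R : Type*} [CommRing R] [IsDomain R]
    [UniqueFactorizationMonoid R] {N g : Fin 3 → R} (h0 : g 0 ≠ 0)
    (hg : ∀ B, (∀ i, B ∣ g i) → IsUnit B) (h : ∀ i j, N i * g j = N j * g i) :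
    ∃ H, ∀ i, N i = H * g i := by
  classical
  let _ : GCDMonoid R := UniqueFactorizationMonoid.toGCDMonoid R
  have hunit : IsUnit (gcd (g 0) (gcd (g 1) (g 2))) := by
    refine hg _ fun i => ?_
    fin_cases i
    · exact gcd_dvd_left _ _
    · exact (gcd_dvd_right _ _).trans (gcd_dvd_left _ _)
    · exact (gcd_dvd_right _ _).trans (gcd_dvd_right _ _)
  have hdvd : g 0 ∣ N 0 * gcd (g 0) (gcd (g 1) (g 2)) := by
    have h1 : g 0 ∣ gcd (N 0 * g 1) (N 0 * g 2) :=
      dvd_gcd ⟨N 1, by rw [h, mul_comm]⟩ ⟨N 2, by rw [h, mul_comm]⟩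
    have h2 : g 0 ∣ gcd (N 0 * g 0) (N 0 * gcd (g 1) (g 2)) :=
      dvd_gcd (dvd_mul_left _ _) (h1.trans (gcd_mul_left' _ _ _).dvd)
    exact h2.trans (gcd_mul_left' _ _ _).dvd
  obtain ⟨H, hH⟩ := (hunit.dvd_mul_right).mp hdvd
  refine ⟨H, fun i => mul_right_cancel₀ h0 ?_⟩
  rw [h i 0, hH]
  ring

/-! ### The dual parametrization -/

/-- Two vectors orthogonal to both partial derivatives of an immersion are proportional. -/
theorem proportional_of_orthogonal {f N g : Fin 3 → MvPolynomial (Fin 2) ℂ}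
    (hJ : jacobian (f 0) (f 1) ≠ 0) (hN : ∀ k, ∑ i, N i * pderiv k (f i) = 0)
    (hg : ∀ k, ∑ i, g i * pderiv k (f i) = 0) (i j : Fin 3) : N i * g j = N j * g i := by
  let M : Fin 3 → MvPolynomial (Fin 2) ℂ :=
    ![jacobian (f 1) (f 2), jacobian (f 2) (f 0), jacobian (f 0) (f 1)]
  have key : ∀ N : Fin 3 → MvPolynomial (Fin 2) ℂ, (∀ k, ∑ i, N i * pderiv k (f i) = 0) →
      ∀ i, N i * jacobian (f 0) (f 1) = N 2 * M i := by
    intro N hN i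
    have hs := hN 0
    have ht := hN 1
    rw [Fin.sum_univ_three] at hs ht
    fin_cases i
    · change N 0 * jacobian (f 0) (f 1) = N 2 * jacobian (f 1) (f 2)
      unfold jacobian
      linear_combination pderiv 1 (f 1) * hs - pderiv 0 (f 1) * ht
    · change N 1 * jacobian (f 0) (f 1) = N 2 * jacobian (f 2) (f 0)
      unfold jacobian
      linear_combination pderiv 0 (f 0) * ht - pderiv 1 (f 0) * hs
    · rfl
  apply mul_right_cancel₀ (mul_ne_zero hJ hJ)
  linear_combination g j * jacobian (f 0) (f 1) * key N hN i + N 2 * M i * key g hg j -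
    g i * jacobian (f 0) (f 1) * key N hN j - N 2 * M j * key g hg i

/-- The polar map along the curve is a nonzero multiple of the dual parametrization. -/
theorem IsEquation.exists_gradient_eq {d e : ℕ} (hd : 0 < d)
    {f g : Fin 3 → MvPolynomial (Fin 2) ℂ} (hf : ∀ i, (f i).IsHomogeneous d)
    (hlin : LinearIndependent ℂ f) {F : MvPolynomial (Fin 3) ℂ} (hE : IsEquation f F)
    (hg : ∀ i, (g i).IsHomogeneous e) (hgreg : NoCommonZero g) (hg0 : g 0 ≠ 0)
    (horth : ∀ k, ∑ i, g i * pderiv k (f i) = 0) :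
    ∃ (n : ℕ) (H : MvPolynomial (Fin 2) ℂ), H ≠ 0 ∧ H.IsHomogeneous n ∧
      ∀ i, aeval f (pderiv i F) = H * g i := by
  have hN : ∀ k, ∑ i, aeval f (pderiv i F) * pderiv k (f i) = 0 := by
    intro k
    rw [← pderiv_aeval, hE.aeval_eq_zero, map_zero]
  obtain ⟨H, hH⟩ := exists_eq_mul_of_proportional hg0
    (fun B hB => isUnit_of_forall_dvd hg hgreg hg0 hB)
    (proportional_of_orthogonal (N := fun i => aeval f (pderiv i F))
      (jacobian_ne_zero hd hf hlin (by decide)) hN horth)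
  have hH0 : H ≠ 0 := by
    rintro rfl
    have hz : ∀ i, pderiv i F = 0 := by
      intro i
      by_contra hne
      have h1 := totalDegree_pderiv_lt hne
      obtain ⟨K, hK⟩ := (hE.aeval_eq_zero_iff _).mp ((hH i).trans (zero_mul _))
      rw [hK] at hne
      rw [hK, totalDegree_mul_of_isDomain (left_ne_zero_of_mul hne)
        (right_ne_zero_of_mul hne)] at h1
      omega
    obtain ⟨c, hc⟩ := eq_C_of_pderiv_eq_zero hz
    have := hE.totalDegree_pos
    rw [hc, totalDegree_C] at this
    omega
  have hhom : (H * g 0).IsHomogeneous (d * (F.totalDegree - 1)) := by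
    rw [← hH 0]
    exact hE.isHomogeneous.pderiv.aeval f hf
  exact ⟨_, H, hH0, (isHomogeneous_of_mul hhom (mul_ne_zero hH0 hg0)).1, hH⟩

/-- The gradient at a representative of a point of the curve. -/
theorem IsEquation.gradient_projMap {d : ℕ} {f g : Fin 3 → MvPolynomial (Fin 2) ℂ}
    (hf : ∀ i, (f i).IsHomogeneous d) (hreg : NoCommonZero f) {F : MvPolynomial (Fin 3) ℂ}
    (hE : IsEquation f F) {H : MvPolynomial (Fin 2) ℂ}
    (hH : ∀ i, aeval f (pderiv i F) = H * g i) (v : Fin 2 → ℂ) (hv : v ≠ 0) :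
    ∃ r : ℂ, r ≠ 0 ∧ gradient F (projMap f hreg (Projectivization.mk ℂ v hv)).rep =
      (r * eval v H) • fun i => eval v (g i) := by
  rw [projMap_mk f hf]
  obtain ⟨r, hr⟩ := Projectivization.exists_smul_eq_mk_rep ℂ _ (hreg v hv)
  refine ⟨(r : ℂ) ^ (F.totalDegree - 1), pow_ne_zero _ r.ne_zero, ?_⟩
  funext i
  unfold gradient
  have h1 := congrArg (eval v) (hH i)
  rw [eval_aeval_eq, map_mul] at h1
  rw [← hr, Units.smul_def, eval_smul_of_isHomogeneous hE.isHomogeneous.pderiv, h1]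
  simp [mul_assoc]

/-- The singular points are images of zeros of the factor `H` by which the polar map differs from a
parametrization without common zero. -/
theorem IsEquation.finite_singularPoints {d n : ℕ} (hd : 0 < d)
    {f g : Fin 3 → MvPolynomial (Fin 2) ℂ}
    (hf : ∀ i, (f i).IsHomogeneous d) (hreg : NoCommonZero f) (hlin : LinearIndependent ℂ f)
    (hgreg : NoCommonZero g)
    {F : MvPolynomial (Fin 3) ℂ} (hE : IsEquation f F) {H : MvPolynomial (Fin 2) ℂ} (hH0 : H ≠ 0)
    (hHn : H.IsHomogeneous n) (hH : ∀ i, aeval f (pderiv i F) = H * g i) :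
    (singularPoints F).Finite := by
  refine ((finite_setOf_eval_eq_zero hHn hH0).image (projMap f hreg)).subset ?_
  rintro P ⟨hP, hgrad⟩
  rw [hE.curvePoints_eq hd hf hreg hlin] at hP
  obtain ⟨Q, rfl⟩ := hP
  refine ⟨Q, ?_, rfl⟩
  obtain ⟨r, hr, h⟩ := hE.gradient_projMap hf hreg hH Q.rep Q.rep_nonzero
  rw [Projectivization.mk_rep, hgrad] at h
  have := (smul_eq_zero.mp h.symm).resolve_right (hgreg _ Q.rep_nonzero)
  exact (mul_eq_zero.mp this).resolve_left hr

/-- The dual curve is the image of `g`: off the zeros of `H` the polar map is given by `g`, and the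
image of `g` is closed, being the zero set of an equation. -/
theorem IsEquation.dualCurve_eq {d e : ℕ} (hd : 0 < d) (he : 0 < e)
    {f g : Fin 3 → MvPolynomial (Fin 2) ℂ}
    (hf : ∀ i, (f i).IsHomogeneous d) (hreg : NoCommonZero f) (hlin : LinearIndependent ℂ f)
    (hg : ∀ i, (g i).IsHomogeneous e) (hgreg : NoCommonZero g) (hglin : LinearIndependent ℂ g)
    {F : MvPolynomial (Fin 3) ℂ} (hE : IsEquation f F) {H : MvPolynomial (Fin 2) ℂ} (hH0 : H ≠ 0)
    (hH : ∀ i, aeval f (pderiv i F) = H * g i) :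
    dualCurve F = Set.range (projMap g hgreg) := by
  obtain ⟨G, hG⟩ := exists_isEquation he hg hglin
  ext L
  constructor
  · intro hL
    rw [← hG.curvePoints_eq he hg hgreg hglin]
    refine hL _ G hG.isHomogeneous ?_
    rintro _ ⟨P, hP, hgrad, rfl⟩
    rw [hE.curvePoints_eq hd hf hreg hlin] at hP
    obtain ⟨Q, rfl⟩ := hP
    rw [hG.curvePoints_eq he hg hgreg hglin]
    refine ⟨Q, ?_⟩
    obtain ⟨r, hr, h⟩ := hE.gradient_projMap hf hreg hH Q.rep Q.rep_nonzero
    rw [Projectivization.mk_rep] at h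
    unfold projMap
    symm
    exact mk_eq_mk_of_smul _ _ _ h.symm
  · rintro ⟨Q, rfl⟩ m K hK hvan
    have hzero : aeval g K * (H * X 0) = 0 := by
      refine MvPolynomial.funext fun v => ?_
      rw [map_zero, map_mul, map_mul]
      by_cases hv : v = 0
      · simp [hv]
      by_cases hHv : eval v H = 0
      · simp [hHv]
      obtain ⟨r, hr, h⟩ := hE.gradient_projMap hf hreg hH v hv
      have hne : gradient F (projMap f hreg (Projectivization.mk ℂ v hv)).rep ≠ 0 := by
        rw [h]
        exact smul_ne_zero (mul_ne_zero hr hHv) (hgreg v hv)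
      have h1 := hvan _ ⟨projMap f hreg (Projectivization.mk ℂ v hv), by
        rw [hE.curvePoints_eq hd hf hreg hlin]
        exact ⟨_, rfl⟩, hne, rfl⟩
      rw [mem_curvePoints_mk hK, h, eval_smul_of_isHomogeneous hK] at h1
      rw [eval_aeval_eq, (mul_eq_zero.mp h1).resolve_left (pow_ne_zero _ (mul_ne_zero hr hHv)),
        zero_mul]
    have hK0 : aeval g K = 0 :=
      (mul_eq_zero.mp hzero).resolve_right (mul_ne_zero hH0 (X_ne_zero 0))
    unfold projMap
    rw [mem_curvePoints_mk hK, ← eval_aeval_eq, hK0, map_zero]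

/-- Biduality: if the polar map of the dual curve is a multiple of `f`, then a general point of the
dual curve determines the point of the curve, and so its parameter. -/
theorem IsEquation.genericallyOneToOne {d e n : ℕ}
    {f g : Fin 3 → MvPolynomial (Fin 2) ℂ}
    (hf : ∀ i, (f i).IsHomogeneous d) (hreg : NoCommonZero f) (hlin : LinearIndependent ℂ f)
    (hinj : GenericallyOneToOne (projMap f hreg))
    (hg : ∀ i, (g i).IsHomogeneous e) (hgreg : NoCommonZero g)
    {G : MvPolynomial (Fin 3) ℂ} (hG : IsEquation g G) {H : MvPolynomial (Fin 2) ℂ} (hH0 : H ≠ 0)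
    (hHn : H.IsHomogeneous n) (hH : ∀ i, aeval g (pderiv i G) = H * f i) :
    GenericallyOneToOne (projMap g hgreg) := by
  refine (((finite_setOf_eval_eq_zero hHn hH0).union
    (hinj.biUnion fun P _ => finite_fibre hf hreg hlin P)).image (projMap g hgreg)).subset ?_
  rintro _ ⟨⟨Q, rfl⟩, hQ⟩
  refine ⟨Q, ?_, rfl⟩
  by_cases hHQ : eval Q.rep H = 0
  · exact Or.inl hHQ
  right
  have hex : ∃ Q', projMap g hgreg Q' = projMap g hgreg Q ∧ Q' ≠ Q := by
    by_contra! hc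
    exact hQ ⟨Q, rfl, hc⟩
  obtain ⟨Q', hQ', hne⟩ := hex
  obtain ⟨r, hr, h⟩ := hG.gradient_projMap hg hgreg hH Q.rep Q.rep_nonzero
  obtain ⟨r', hr', h'⟩ := hG.gradient_projMap hg hgreg hH Q'.rep Q'.rep_nonzero
  rw [Projectivization.mk_rep] at h h'
  rw [hQ', h] at h'
  have heq : projMap f hreg Q' = projMap f hreg Q := by
    unfold projMap
    symm
    refine mk_eq_mk_of_smul _ _ ((r * eval Q.rep H)⁻¹ * (r' * eval Q'.rep H)) ?_
    rw [mul_smul, ← h', smul_smul, inv_mul_cancel₀ (mul_ne_zero hr hHQ), one_smul]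
  simp only [Set.mem_iUnion]
  refine ⟨projMap f hreg Q, ⟨⟨Q, rfl⟩, ?_⟩, rfl⟩
  rintro ⟨Q₀, -, huniq⟩
  exact hne ((huniq Q' heq).trans (huniq Q rfl).symm)

/-- `g` is the vector of minors of the Jacobian matrix of `f`, divided by their greatest common
divisor `A`. -/
structure IsDualMap (f : Fin 3 → MvPolynomial (Fin 2) ℂ) (A : MvPolynomial (Fin 2) ℂ)
    (g : Fin 3 → MvPolynomial (Fin 2) ℂ) : Prop where
  dvd_iff : ∀ B : MvPolynomial (Fin 2) ℂ,
    B ∣ A ↔ B ∣ minor f 0 1 ∧ B ∣ minor f 0 2 ∧ B ∣ minor f 1 2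
  mul_zero_eq : A * g 0 = minor f 1 2
  mul_one_eq : A * g 1 = -minor f 0 2
  mul_two_eq : A * g 2 = minor f 0 1

/-- A linear relation between the `2 × 2` minors makes the components of `f` linearly dependent:
projecting from the corresponding point of the plane gives a map with vanishing Jacobian. -/
theorem false_of_minor_relation {d : ℕ} (hd : 0 < d) {f : Fin 3 → MvPolynomial (Fin 2) ℂ}
    (hf : ∀ i, (f i).IsHomogeneous d) (hlin : LinearIndependent ℂ f) {i j k : Fin 3}
    (hij : i ≠ j) (hik : i ≠ k) (hjk : j ≠ k) {a b c : ℂ} (ha : a ≠ 0)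
    (h : C a * jacobian (f j) (f k) + C b * jacobian (f k) (f i) +
      C c * jacobian (f i) (f j) = 0) : False := by
  have hJ : jacobian (C a * f j - C b * f i) (C a * f k - C c * f i) = 0 := by
    have : jacobian (C a * f j - C b * f i) (C a * f k - C c * f i) =
        C a * (C a * jacobian (f j) (f k) + C b * jacobian (f k) (f i) +
          C c * jacobian (f i) (f j)) := by
      simp only [jacobian, map_sub, Derivation.leibniz, pderiv_C, smul_eq_mul, mul_zero, add_zero]
      ring
    rw [this, h, mul_zero]
  obtain ⟨α, β, hαβ, h1⟩ := exists_of_jacobian_eq_zero hd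
    (((hf j).C_mul a).sub ((hf i).C_mul b)) (((hf k).C_mul a).sub ((hf i).C_mul c)) hJ
  have h2 := sum_C_mul_eq_zero_iff.mp hlin (fun l => if l = i then -(α * b + β * c) else
    if l = j then α * a else β * a) ?_
  · have hj := congrFun h2 j
    have hk := congrFun h2 k
    simp only [hij.symm, hik.symm, hjk.symm, if_true, if_false, Pi.zero_apply, mul_eq_zero, ha,
      or_false] at hj hk
    exact hαβ.elim (fun h => h hj) (fun h => h hk)
  · have huniv : (Finset.univ : Finset (Fin 3)) = {i, j, k} :=
      (show ∀ i j k : Fin 3, i ≠ j → i ≠ k → j ≠ k → (Finset.univ : Finset (Fin 3)) = {i, j, k} by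
        decide) i j k hij hik hjk
    rw [huniv, Finset.sum_insert (by simp [hij, hik]), Finset.sum_pair hjk]
    simp only [hij.symm, hik.symm, hjk.symm, if_true, if_false, C_neg, C_add, C_mul]
    linear_combination h1

namespace IsDualMap

variable {f g : Fin 3 → MvPolynomial (Fin 2) ℂ} {A : MvPolynomial (Fin 2) ℂ} {d : ℕ}

theorem mul_eq (h : IsDualMap f A g) (i : Fin 3) : A * g i =
    (![jacobian (f 1) (f 2), jacobian (f 2) (f 0), jacobian (f 0) (f 1)] :
      Fin 3 → MvPolynomial (Fin 2) ℂ) i := by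
  fin_cases i
  · exact h.mul_zero_eq
  · refine h.mul_one_eq.trans ?_
    change -minor f 0 2 = jacobian (f 2) (f 0)
    rw [minor, jacobian]
    ring
  · exact h.mul_two_eq

theorem mul_ne_zero (h : IsDualMap f A g) (hd : 0 < d) (hf : ∀ i, (f i).IsHomogeneous d)
    (hlin : LinearIndependent ℂ f) (i : Fin 3) : A * g i ≠ 0 := by
  rw [h.mul_eq]
  fin_cases i
  · exact jacobian_ne_zero hd hf hlin (i := 1) (j := 2) (by decide)
  · exact jacobian_ne_zero hd hf hlin (i := 2) (j := 0) (by decide)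
  · exact jacobian_ne_zero hd hf hlin (i := 0) (j := 1) (by decide)

theorem isHomogeneous_mul (h : IsDualMap f A g) (hf : ∀ i, (f i).IsHomogeneous d) (i : Fin 3) :
    (A * g i).IsHomogeneous (2 * (d - 1)) := by
  rw [h.mul_eq]
  fin_cases i
  · exact isHomogeneous_jacobian (hf 1) (hf 2)
  · exact isHomogeneous_jacobian (hf 2) (hf 0)
  · exact isHomogeneous_jacobian (hf 0) (hf 1)

theorem ne_zero (h : IsDualMap f A g) (hd : 0 < d) (hf : ∀ i, (f i).IsHomogeneous d)
    (hlin : LinearIndependent ℂ f) (i : Fin 3) : g i ≠ 0 :=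
  right_ne_zero_of_mul (h.mul_ne_zero hd hf hlin i)

theorem gcd_ne_zero (h : IsDualMap f A g) (hd : 0 < d) (hf : ∀ i, (f i).IsHomogeneous d)
    (hlin : LinearIndependent ℂ f) : A ≠ 0 :=
  left_ne_zero_of_mul (h.mul_ne_zero hd hf hlin 0)

theorem isHomogeneous_gcd (h : IsDualMap f A g) (hd : 0 < d) (hf : ∀ i, (f i).IsHomogeneous d)
    (hlin : LinearIndependent ℂ f) : A.IsHomogeneous A.totalDegree :=
  (isHomogeneous_of_mul (h.isHomogeneous_mul hf 0) (h.mul_ne_zero hd hf hlin 0)).1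

theorem totalDegree_add (h : IsDualMap f A g) (hd : 0 < d) (hf : ∀ i, (f i).IsHomogeneous d)
    (hlin : LinearIndependent ℂ f) (i : Fin 3) :
    A.totalDegree + (g i).totalDegree = 2 * (d - 1) := by
  rw [← totalDegree_mul_of_isDomain (h.gcd_ne_zero hd hf hlin) (h.ne_zero hd hf hlin i)]
  exact (h.isHomogeneous_mul hf i).totalDegree (h.mul_ne_zero hd hf hlin i)

theorem isHomogeneous (h : IsDualMap f A g) (hd : 0 < d) (hf : ∀ i, (f i).IsHomogeneous d)
    (hlin : LinearIndependent ℂ f) (i : Fin 3) : (g i).IsHomogeneous (g 0).totalDegree := by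
  have h1 := h.totalDegree_add hd hf hlin i
  have h2 := h.totalDegree_add hd hf hlin 0
  have : (g 0).totalDegree = (g i).totalDegree := by omega
  rw [this]
  exact (isHomogeneous_of_mul (h.isHomogeneous_mul hf i) (h.mul_ne_zero hd hf hlin i)).2

/-- The dual curve is not contained in a line: otherwise the Jacobian minors would satisfy a linear
relation. -/
theorem linearIndependent (h : IsDualMap f A g) (hd : 0 < d) (hf : ∀ i, (f i).IsHomogeneous d)
    (hlin : LinearIndependent ℂ f) : LinearIndependent ℂ g := by
  rw [sum_C_mul_eq_zero_iff]
  intro c hc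
  have h0 := h.mul_eq 0
  have h1 := h.mul_eq 1
  have h2 := h.mul_eq 2
  simp only [Matrix.cons_val] at h0 h1 h2
  rw [Fin.sum_univ_three] at hc
  by_contra hne
  obtain ⟨k, hk⟩ := Function.ne_iff.mp hne
  rw [Pi.zero_apply] at hk
  rcases (show ∀ k : Fin 3, k = 0 ∨ k = 1 ∨ k = 2 by decide) k with rfl | rfl | rfl
  · refine false_of_minor_relation hd hf hlin (i := 0) (j := 1) (k := 2) (by decide) (by decide)
      (by decide) hk (b := c 1) (c := c 2) ?_
    rw [← h0, ← h1, ← h2]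
    linear_combination A * hc
  · refine false_of_minor_relation hd hf hlin (i := 1) (j := 2) (k := 0) (by decide) (by decide)
      (by decide) hk (b := c 2) (c := c 0) ?_
    rw [← h0, ← h1, ← h2]
    linear_combination A * hc
  · refine false_of_minor_relation hd hf hlin (i := 2) (j := 0) (k := 1) (by decide) (by decide)
      (by decide) hk (b := c 0) (c := c 1) ?_
    rw [← h0, ← h1, ← h2]
    linear_combination A * hc

/-- The components of the dual map are not constant, since constants are linearly dependent. -/
theorem totalDegree_pos (h : IsDualMap f A g) (hd : 0 < d) (hf : ∀ i, (f i).IsHomogeneous d)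
    (hlin : LinearIndependent ℂ f) : 0 < (g 0).totalDegree := by
  rw [Nat.pos_iff_ne_zero]
  intro h0
  have hconst : ∀ i, g i = C (coeff 0 (g i)) := by
    intro i
    rw [← totalDegree_eq_zero_iff_eq_C]
    have := (h.isHomogeneous hd hf hlin i).totalDegree_le
    omega
  have := sum_C_mul_eq_zero_iff.mp (h.linearIndependent hd hf hlin)
    ![coeff 0 (g 1), -coeff 0 (g 0), 0] (by
      rw [Fin.sum_univ_three, hconst 0, hconst 1]
      simp
      ring)
  have h1 := congrFun this 1
  simp only [Matrix.cons_val, Pi.zero_apply, neg_eq_zero] at h1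
  apply h.ne_zero hd hf hlin 0
  rw [hconst 0, h1, C_0]

/-- At a common zero the linear form vanishing there could be moved into the greatest common
divisor. -/
theorem noCommonZero (h : IsDualMap f A g) (hd : 0 < d) (hf : ∀ i, (f i).IsHomogeneous d)
    (hlin : LinearIndependent ℂ f) : NoCommonZero g := by
  intro v hv h0
  have hdvd : ∀ i, linForm v ∣ g i := fun i =>
    linForm_dvd (h.isHomogeneous hd hf hlin i) hv (congrFun h0 i)
  have hAdvd : A * linForm v ∣ A := by
    rw [h.dvd_iff, ← h.mul_two_eq, ← h.mul_zero_eq, ← dvd_neg (b := minor f 0 2), ← h.mul_one_eq]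
    exact ⟨mul_dvd_mul_left A (hdvd 2), mul_dvd_mul_left A (hdvd 1), mul_dvd_mul_left A (hdvd 0)⟩
  obtain ⟨K, hK⟩ := hAdvd
  refine not_isUnit_linForm v (IsUnit.of_mul_eq_one K ?_)
  refine mul_left_cancel₀ (h.gcd_ne_zero hd hf hlin) ?_
  rw [mul_one, ← mul_assoc, ← hK]

/-- Each row of the Jacobian matrix is orthogonal to the vector of its maximal minors. -/
theorem sum_mul_pderiv (h : IsDualMap f A g) (hd : 0 < d) (hf : ∀ i, (f i).IsHomogeneous d)
    (hlin : LinearIndependent ℂ f) (k : Fin 2) : ∑ i, g i * pderiv k (f i) = 0 := by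
  refine mul_left_cancel₀ (h.gcd_ne_zero hd hf hlin) ?_
  have h0 := h.mul_eq 0
  have h1 := h.mul_eq 1
  have h2 := h.mul_eq 2
  simp only [Matrix.cons_val, jacobian] at h0 h1 h2
  rw [Fin.sum_univ_three]
  rcases (show ∀ k : Fin 2, k = 0 ∨ k = 1 by decide) k with rfl | rfl
  · linear_combination pderiv 0 (f 0) * h0 + pderiv 0 (f 1) * h1 + pderiv 0 (f 2) * h2
  · linear_combination pderiv 1 (f 0) * h0 + pderiv 1 (f 1) * h1 + pderiv 1 (f 2) * h2

/-- By Euler's identity `f` is a combination of its partial derivatives, so it is orthogonal to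
`g` as well. -/
theorem sum_mul_eq_zero (h : IsDualMap f A g) (hd : 0 < d) (hf : ∀ i, (f i).IsHomogeneous d)
    (hlin : LinearIndependent ℂ f) : ∑ i, g i * f i = 0 := by
  have h0 := h.sum_mul_pderiv hd hf hlin 0
  have h1 := h.sum_mul_pderiv hd hf hlin 1
  have euler : ∀ i, X 0 * pderiv 0 (f i) + X 1 * pderiv 1 (f i) = C (d : ℂ) * f i := by
    intro i
    have := (hf i).sum_X_mul_pderiv
    rw [Fin.sum_univ_two] at this
    rw [this]
    simp
  have hdC : (C (d : ℂ) : MvPolynomial (Fin 2) ℂ) ≠ 0 := by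
    rw [Ne, C_eq_zero, Nat.cast_eq_zero]
    exact hd.ne'
  refine mul_left_cancel₀ hdC ?_
  rw [Fin.sum_univ_three] at h0 h1 ⊢
  linear_combination X 0 * h0 + X 1 * h1 - g 0 * euler 0 - g 1 * euler 1 - g 2 * euler 2

/-- Differentiating `∑ g i f i = 0` shows that `f` is orthogonal to the partial derivatives of `g`:
it stands to `g` as `g` does to `f`. -/
theorem sum_pderiv_mul (h : IsDualMap f A g) (hd : 0 < d) (hf : ∀ i, (f i).IsHomogeneous d)
    (hlin : LinearIndependent ℂ f) (k : Fin 2) : ∑ i, f i * pderiv k (g i) = 0 := by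
  have h0 := h.sum_mul_pderiv hd hf hlin k
  have h1 := congrArg (pderiv k) (h.sum_mul_eq_zero hd hf hlin)
  rw [Fin.sum_univ_three] at h0 h1 ⊢
  simp only [map_add, map_zero, Derivation.leibniz, smul_eq_mul] at h1
  linear_combination h1 - h0

end IsDualMap

/-! ### Lines of a fixed direction -/

/-- The point at infinity, in the affine chart around `P`, of the lines of slope `l`. -/
noncomputable def direction (P : P2) (l : ℂ) : Fin 3 → ℂ :=
  (chartIndex P).insertNth (α := fun _ => ℂ) 0 ![1, l]

@[simp]
theorem direction_chartIndex (P : P2) (l : ℂ) : direction P l (chartIndex P) = 0 := by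
  simp [direction]

@[simp]
theorem direction_affineIndex (P : P2) (l : ℂ) (k : Fin 2) :
    direction P l (affineIndex P k) = ![1, l] k := by
  simp [direction, affineIndex]

theorem eq_smul_direction {P : P2} {l : ℂ} {v : Fin 3 → ℂ} (h : v (chartIndex P) = 0)
    (h1 : v (affineIndex P 1) = l * v (affineIndex P 0)) :
    v = v (affineIndex P 0) • direction P l := by
  funext j
  obtain rfl | ⟨k, rfl⟩ := index_cases P j
  · simp [h]
  · rcases (show ∀ k : Fin 2, k = 0 ∨ k = 1 by decide) k with rfl | rfl
    · simp
    · simp [h1, mul_comm]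

theorem direction_ne_zero (P : P2) (l : ℂ) : direction P l ≠ 0 := by
  intro h
  have := congrFun h (affineIndex P 0)
  simp at this

theorem lineRestrict_localEquation (F : MvPolynomial (Fin 3) ℂ) (P : P2) (l c : ℂ) :
    lineRestrict ![1, l] ![0, c] (localEquation F P) =
      lineRestrict (direction P l) (affinePoint P ![0, c]) F := by
  unfold lineRestrict
  rw [aeval_localEquation]
  congr 2
  funext j
  obtain rfl | ⟨k, rfl⟩ := index_cases P j
  · simp
  · simp [add_assoc]

theorem natDegree_lineRestrict_localEquation {n : ℕ} {F : MvPolynomial (Fin 3) ℂ}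
    (hF : F.IsHomogeneous n) {P : P2} {l : ℂ} (hl : eval (direction P l) F ≠ 0) (c : ℂ) :
    (lineRestrict ![1, l] ![0, c] (localEquation F P)).natDegree = n := by
  rw [lineRestrict_localEquation]
  exact Polynomial.natDegree_eq_of_le_of_coeff_ne_zero (natDegree_lineRestrict_le _ _ hF)
    (by rwa [coeff_lineRestrict _ _ hF])

theorem leadingCoeff_lineRestrict_localEquation {n : ℕ} {F : MvPolynomial (Fin 3) ℂ}
    (hF : F.IsHomogeneous n) {P : P2} {l : ℂ} (hl : eval (direction P l) F ≠ 0) (c : ℂ) :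
    (lineRestrict ![1, l] ![0, c] (localEquation F P)).leadingCoeff = eval (direction P l) F := by
  rw [Polynomial.leadingCoeff, natDegree_lineRestrict_localEquation hF hl,
    lineRestrict_localEquation, coeff_lineRestrict _ _ hF]

/-- All but finitely many directions are transversal to the curve at infinity. -/
theorem IsEquation.finite_setOf_direction {d : ℕ} (hd : 0 < d) {f : Fin 3 → MvPolynomial (Fin 2) ℂ}
    (hf : ∀ i, (f i).IsHomogeneous d) (hreg : NoCommonZero f) (hlin : LinearIndependent ℂ f)
    {F : MvPolynomial (Fin 3) ℂ} (hE : IsEquation f F) (P : P2) :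
    {l : ℂ | eval (direction P l) F = 0}.Finite := by
  refine ((finite_setOf_eval_eq_zero (hf (chartIndex P)) (hlin.ne_zero _)).image
    fun Q => ratio (affineIndex P 1) (affineIndex P 0) (projMap f hreg Q)).subset ?_
  intro l hl
  rw [Set.mem_ofPred_eq, ← mem_curvePoints_mk hE.isHomogeneous _ (direction_ne_zero P l),
    hE.curvePoints_eq hd hf hreg hlin] at hl
  obtain ⟨Q, hQ⟩ := hl
  refine ⟨Q, ?_, ?_⟩
  · obtain ⟨r, hr⟩ := (Projectivization.mk_eq_mk_iff' ℂ _ _ _ _).mp hQ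
    have := congrFun hr (chartIndex P)
    simp only [Pi.smul_apply, direction_chartIndex, smul_zero] at this
    exact this.symm
  · simp only
    rw [hQ, ratio_mk]
    simp

namespace Chart

variable {f : Fin 3 → MvPolynomial (Fin 2) ℂ} {P : P2} (c : Chart f P)

/-- The numerator, along the curve, of the linear function `x₁ - l x₀` that is constant on the lines
of slope `l`. -/
noncomputable def pencil (l : ℂ) : Polynomial ℂ := c.num 1 - Polynomial.C l * c.num 0

theorem eval_pencil (l τ : ℂ) :
    (c.pencil l).eval τ = (c.num 1).eval τ - l * (c.num 0).eval τ := by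
  simp [pencil]

section

variable {d : ℕ} {F : MvPolynomial (Fin 3) ℂ} {l : ℂ}

theorem natDegree_pencil (hf : ∀ i, (f i).IsHomogeneous d) (hreg : NoCommonZero f)
    (hE : IsEquation f F) (hl : eval (direction P l) F ≠ 0) : (c.pencil l).natDegree = d := by
  have ha : c.a ≠ 0 := by
    intro ha
    apply c.det_ne_zero
    simp [ha, det2]
  refine Polynomial.natDegree_eq_of_le_of_coeff_ne_zero ?_ ?_
  · exact (Polynomial.natDegree_sub_le_of_le (c.natDegree_num_le hf 1)
      ((Polynomial.natDegree_C_mul_le _ _).trans (c.natDegree_num_le hf 0))).trans (max_self d).le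
  · rw [pencil, Polynomial.coeff_sub, Polynomial.coeff_C_mul, c.coeff_num hf, c.coeff_num hf]
    intro h
    have h1 : eval c.a (f (affineIndex P 1)) = l * eval c.a (f (affineIndex P 0)) := by
      refine mul_left_cancel₀ (rep_chartIndex_ne_zero P) ?_
      linear_combination h
    have h2 := eq_smul_direction (v := fun i => eval c.a (f i)) c.eval_eq_zero h1
    have h3 : eval c.a (f (affineIndex P 0)) ≠ 0 := by
      intro h4
      rw [h4, zero_smul] at h2
      exact hreg _ ha h2
    have h5 : eval (fun i => eval c.a (f i)) F = 0 := by
      rw [← eval_aeval_eq, hE.aeval_eq_zero, map_zero]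
    rw [h2, eval_smul_of_isHomogeneous hE.isHomogeneous] at h5
    exact hl ((mul_eq_zero.mp h5).resolve_left (pow_ne_zero _ h3))

theorem den_eval_ne_zero_of_pencil (hreg : NoCommonZero f)
    (hE : IsEquation f F) (hl : eval (direction P l) F ≠ 0) {τ : ℂ}
    (h : (c.pencil l).eval τ = 0) : c.den.eval τ ≠ 0 := by
  intro h0
  rw [eval_den] at h0
  have h1 : c.vec τ (affineIndex P 1) = l * c.vec τ (affineIndex P 0) := by
    refine mul_left_cancel₀ (rep_chartIndex_ne_zero P) ?_
    rw [eval_pencil, eval_num, eval_num, h0] at h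
    linear_combination h
  have h2 := eq_smul_direction h0 h1
  have h3 : c.vec τ (affineIndex P 0) ≠ 0 := by
    intro h4
    rw [h4, zero_smul] at h2
    exact c.vec_ne_zero hreg τ h2
  have h5 : eval (c.vec τ) F = 0 := by
    have : c.vec τ = fun i => eval (τ • c.a + c.b) (f i) := rfl
    rw [this, ← eval_aeval_eq, hE.aeval_eq_zero, map_zero]
  rw [h2, eval_smul_of_isHomogeneous hE.isHomogeneous] at h5
  exact hl ((mul_eq_zero.mp h5).resolve_left (pow_ne_zero _ h3))

theorem isCoprime_pencil (hreg : NoCommonZero f)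
    (hE : IsEquation f F) (hl : eval (direction P l) F ≠ 0) : IsCoprime (c.pencil l) c.den :=
  isCoprime_of_no_common_root fun _ => c.den_eval_ne_zero_of_pencil hreg hE hl

theorem den_eval_ne_zero_of_mem_roots (hreg : NoCommonZero f)
    (hE : IsEquation f F) (hl : eval (direction P l) F ≠ 0) {e τ : ℂ}
    (h : (c.pencil l - Polynomial.C e * c.den).eval τ = 0) : c.den.eval τ ≠ 0 := by
  intro h0
  refine c.den_eval_ne_zero_of_pencil hreg hE hl (τ := τ) ?_ h0
  simpa [h0] using h

/-- The parameters of the points of the curve on a line of slope `l` are the roots of a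
member of the pencil. -/
theorem eval_lineRestrict_eq_zero (hE : IsEquation f F) {e τ : ℂ} (hden : c.den.eval τ ≠ 0)
    (h : (c.pencil l - Polynomial.C e * c.den).eval τ = 0) :
    (lineRestrict ![1, l] ![0, e] (localEquation F P)).eval
      ((c.num 0).eval τ / c.den.eval τ) = 0 := by
  have hpt : ((c.num 0).eval τ / c.den.eval τ) • ![1, l] + ![0, e] =
      fun k => (c.num k).eval τ / c.den.eval τ := by
    rw [Polynomial.eval_sub, eval_pencil, Polynomial.eval_mul, Polynomial.eval_C] at h
    have h1 : (c.num 1).eval τ / c.den.eval τ =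
        (c.num 0).eval τ / c.den.eval τ * l + e := by
      field_simp
      linear_combination h
    funext k
    rcases (show ∀ k : Fin 2, k = 0 ∨ k = 1 by decide) k with rfl | rfl
    · simp
    · simp [h1]
  rw [eval_lineRestrict, hpt, ← aeval_apply_eq_eval, aeval_localEquation, aeval_apply_eq_eval,
    ← c.smul_vec hden, eval_smul_of_isHomogeneous hE.isHomogeneous]
  have : c.vec τ = fun i => eval (τ • c.a + c.b) (f i) := rfl
  rw [this, ← eval_aeval_eq, hE.aeval_eq_zero, map_zero, mul_zero]

theorem projMap_point_eq_of_div_eq (hf : ∀ i, (f i).IsHomogeneous d) (hreg : NoCommonZero f)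
    {τ σ : ℂ} (hτ : c.den.eval τ ≠ 0) (hσ : c.den.eval σ ≠ 0)
    (h : ∀ k, (c.num k).eval τ / c.den.eval τ = (c.num k).eval σ / c.den.eval σ) :
    projMap f hreg (c.point τ) = projMap f hreg (c.point σ) := by
  rw [c.projMap_point hf, c.projMap_point hf, Projectivization.mk_eq_mk_iff']
  have h1 := c.smul_vec hτ
  rw [funext h, ← c.smul_vec hσ] at h1
  have hp := rep_chartIndex_ne_zero P
  refine ⟨c.den.eval τ / P.rep (chartIndex P) * (P.rep (chartIndex P) / c.den.eval σ), ?_⟩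
  rw [mul_smul, ← h1, smul_smul, div_mul_div_cancel₀ hp, div_self hτ, one_smul]

/-- A general line of slope `l` meets the curve in `d` points with distinct coordinates. -/
theorem finite_setOf_not_distinct (hd : 0 < d) (hf : ∀ i, (f i).IsHomogeneous d)
    (hreg : NoCommonZero f) (hinj : GenericallyOneToOne (projMap f hreg))
    (hE : IsEquation f F) (hl : eval (direction P l) F ≠ 0) :
    {e : ℂ | ¬ ((c.pencil l - Polynomial.C e * c.den).roots.map
      fun τ => (c.num 0).eval τ / c.den.eval τ).Nodup}.Finite := by
  have hdeg : c.den.natDegree < (c.pencil l).natDegree := by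
    rw [c.natDegree_pencil hf hreg hE hl]
    exact c.natDegree_den_lt hf hd
  refine ((finite_setOf_not_nodup_roots hdeg (c.isCoprime_pencil hreg hE hl)).union
    (hinj.image fun R => (P.rep (chartIndex P) * ratio (affineIndex P 1) (chartIndex P) R -
      P.rep (affineIndex P 1)) - l * (P.rep (chartIndex P) *
        ratio (affineIndex P 0) (chartIndex P) R - P.rep (affineIndex P 0)))).subset ?_
  intro e he
  rw [Set.mem_ofPred_eq] at he
  by_contra hne
  rw [Set.mem_union, not_or, Set.mem_ofPred_eq, not_not] at hne
  refine he (hne.1.map_on ?_)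
  intro τ hτ σ hσ hτσ
  have hτ0 := Polynomial.isRoot_of_mem_roots hτ
  have hσ0 := Polynomial.isRoot_of_mem_roots hσ
  have hτd := c.den_eval_ne_zero_of_mem_roots hreg hE hl hτ0
  have hσd := c.den_eval_ne_zero_of_mem_roots hreg hE hl hσ0
  by_contra hdiff
  apply hne.2
  have hline : ∀ {ρ : ℂ}, (c.pencil l - Polynomial.C e * c.den).eval ρ = 0 →
      c.den.eval ρ ≠ 0 → (c.num 1).eval ρ / c.den.eval ρ =
        l * ((c.num 0).eval ρ / c.den.eval ρ) + e := by
    intro ρ hρ hρd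
    rw [Polynomial.eval_sub, eval_pencil, Polynomial.eval_mul, Polynomial.eval_C] at hρ
    field_simp
    linear_combination hρ
  refine ⟨projMap f hreg (c.point τ), ⟨⟨_, rfl⟩, ?_⟩, ?_⟩
  · rintro ⟨Q, -, hQ⟩
    have h1 := hQ (c.point τ) rfl
    have h2 := hQ (c.point σ) (c.projMap_point_eq_of_div_eq hf hreg hσd hτd ?_)
    · exact hdiff (linePoint_injective c.det_ne_zero (h1.trans h2.symm))
    · rw [Fin.forall_fin_two, hline hτ0 hτd, hline hσ0 hσd]
      exact ⟨hτσ.symm, by rw [hτσ]⟩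
  · simp only
    rw [c.projMap_point hf, ratio_mk, ratio_mk]
    have h1 := hline hτ0 hτd
    rw [eval_num, eval_num, eval_den] at h1
    rw [eval_den] at hτd
    field_simp at h1 ⊢
    linear_combination h1

end

end Chart

/-- A general line of given slope meets the curve in `d` distinct points, so the degree of the curve
is at least `d`. -/
theorem IsEquation.le_totalDegree {d : ℕ} (hd : 0 < d) {f : Fin 3 → MvPolynomial (Fin 2) ℂ}
    (hf : ∀ i, (f i).IsHomogeneous d) (hreg : NoCommonZero f) (hlin : LinearIndependent ℂ f)
    (hinj : GenericallyOneToOne (projMap f hreg))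
    {F : MvPolynomial (Fin 3) ℂ} (hE : IsEquation f F) : d ≤ F.totalDegree := by
  classical
  have v : P1 := Projectivization.mk ℂ ![1, 0] (fun h => by simpa using congrFun h 0)
  obtain ⟨c⟩ := nonempty_chart hd hf (projMap f hreg v)
  obtain ⟨l, hl⟩ := (hE.finite_setOf_direction hd hf hreg hlin
    (projMap f hreg v)).infinite_compl.nonempty
  obtain ⟨e, he⟩ := (c.finite_setOf_not_distinct hd hf hreg hinj hE hl).infinite_compl.nonempty
  rw [Set.mem_compl_iff, Set.mem_ofPred_eq, not_not] at he
  have hdeg : c.den.natDegree < (c.pencil l).natDegree := by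
    rw [c.natDegree_pencil hf hreg hE hl]
    exact c.natDegree_den_lt hf hd
  have hcard := card_roots_sub_C_mul hdeg e
  rw [c.natDegree_pencil hf hreg hE hl] at hcard
  have hnat := natDegree_lineRestrict_localEquation hE.isHomogeneous hl e
  have hne : lineRestrict ![1, l] ![0, e] (localEquation F (projMap f hreg v)) ≠ 0 := by
    intro h
    rw [h, Polynomial.natDegree_zero] at hnat
    exact hE.totalDegree_pos.ne hnat
  rw [← hnat, ← hcard, ← Multiset.card_map (fun τ => (c.num 0).eval τ / c.den.eval τ)]
  refine le_trans (Multiset.card_le_card ?_) (Polynomial.card_roots' _)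
  rw [Multiset.le_iff_subset he]
  intro x hx
  obtain ⟨τ, hτ, rfl⟩ := Multiset.mem_map.mp hx
  have hτ0 := Polynomial.isRoot_of_mem_roots hτ
  exact (Polynomial.mem_roots hne).mpr (c.eval_lineRestrict_eq_zero hE
    (c.den_eval_ne_zero_of_mem_roots hreg hE hl hτ0) hτ0)

/-! ### Degree and birationality -/

/-- The degree of a rational function as a self-map of the projective line is the degree of the
corresponding extension of function fields; here the numerator has the larger degree. -/
theorem finrank_adjoin_div {p q : Polynomial ℂ} (h : IsCoprime p q)
    (hdeg : q.natDegree < p.natDegree) (hq : q ≠ 0) :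
    Module.finrank (IntermediateField.adjoin ℂ {algebraMap (Polynomial ℂ) (RatFunc ℂ) p /
      algebraMap (Polynomial ℂ) (RatFunc ℂ) q}) (RatFunc ℂ) = p.natDegree := by
  classical
  have hp : p ≠ 0 := by
    rintro rfl
    simp at hdeg
  have hunit : IsUnit (gcd p q) := (gcd_isUnit_iff p q).mpr h
  have hdiv : ∀ r, r ≠ 0 → gcd p q ∣ r → (r / gcd p q).natDegree = r.natDegree := by
    intro r hr hdvd
    have h1 := EuclideanDomain.mul_div_cancel' hunit.ne_zero hdvd
    have h2 := congrArg Polynomial.natDegree h1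
    rwa [Polynomial.natDegree_mul hunit.ne_zero (by
      intro h0
      rw [h0, mul_zero] at h1
      exact hr h1.symm), Polynomial.natDegree_eq_zero_of_isUnit hunit, zero_add] at h2
  have hlead : (q / gcd p q).leadingCoeff⁻¹ ≠ 0 := by
    refine inv_ne_zero (Polynomial.leadingCoeff_ne_zero.mpr fun h0 => ?_)
    have h1 := EuclideanDomain.mul_div_cancel' hunit.ne_zero (gcd_dvd_right p q)
    rw [h0, mul_zero] at h1
    exact hq h1.symm
  rw [RatFunc.finrank_eq_max_natDegree, RatFunc.num_div, RatFunc.denom_div _ hq,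
    Polynomial.natDegree_C_mul hlead, Polynomial.natDegree_C_mul hlead,
    hdiv p hp (gcd_dvd_left p q), hdiv q hq (gcd_dvd_right p q), max_eq_left hdeg.le]

namespace Chart

variable {f : Fin 3 → MvPolynomial (Fin 2) ℂ} {P : P2} (c : Chart f P)
variable {d : ℕ} {F : MvPolynomial (Fin 3) ℂ} {l : ℂ}

/-- The linear function `x₁ - l x₀` as an element of the function field. -/
noncomputable def slopeCoord (l : ℂ) : RatFunc ℂ :=
  c.coord 1 - algebraMap ℂ (RatFunc ℂ) l * c.coord 0

theorem slopeCoord_eq (l : ℂ) : c.slopeCoord l =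
    algebraMap (Polynomial ℂ) (RatFunc ℂ) (c.pencil l) /
      algebraMap (Polynomial ℂ) (RatFunc ℂ) c.den := by
  rw [slopeCoord, coord, coord, pencil, map_sub, map_mul,
    IsScalarTower.algebraMap_apply ℂ (Polynomial ℂ) (RatFunc ℂ), sub_div, mul_div_assoc]
  rfl

/-- The function field of the line has degree `d` over `ℂ(x₁ - l x₀)`, for a direction `l`
transversal to the curve at infinity. -/
theorem finrank_adjoin_slopeCoord (hd : 0 < d) (hf : ∀ i, (f i).IsHomogeneous d)
    (hreg : NoCommonZero f) (hlin : LinearIndependent ℂ f) (hE : IsEquation f F)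
    (hl : eval (direction P l) F ≠ 0) :
    Module.finrank (IntermediateField.adjoin ℂ {c.slopeCoord l}) (RatFunc ℂ) = d := by
  have hdeg := c.natDegree_pencil hf hreg hE hl
  rw [c.slopeCoord_eq, finrank_adjoin_div (c.isCoprime_pencil hreg hE hl)
    (by rw [hdeg]; exact c.natDegree_den_lt hf hd) (c.den_ne_zero hf hlin), hdeg]

/-- The local equation has degree `deg F` in `x₀` with constant leading coefficient, over
the polynomials in `x₁ - l x₀`, and it generates the relations: no relation has smaller degree
in `x₀`. -/
theorem linearIndependent_pow (hf : ∀ i, (f i).IsHomogeneous d)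
    (hlin : LinearIndependent ℂ f) (hE : IsEquation f F) (hl : eval (direction P l) F ≠ 0) :
    LinearIndependent (IntermediateField.adjoin ℂ {c.slopeCoord l})
      (fun i : Fin F.totalDegree => c.coord 0 ^ (i : ℕ)) := by
  open scoped IntermediateField.algebraAdjoinAdjoin in
  rw [← LinearIndependent.iff_fractionRing (R := Algebra.adjoin ℂ {c.slopeCoord l}),
    Fintype.linearIndependent_iff]
  intro g hg
  have hex : ∀ i, ∃ p : Polynomial ℂ, Polynomial.aeval (c.slopeCoord l) p = (g i : RatFunc ℂ) := by
    intro i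
    have hle := (Algebra.adjoin_singleton_eq_range_aeval ℂ (c.slopeCoord l)).le
    exact hle (g i).2
  choose p hp using hex
  have hpar : ∀ q : Polynomial ℂ, c.paramHom (Polynomial.aeval (X 1 - C l * X 0) q) =
      Polynomial.aeval (c.slopeCoord l) q := by
    intro q
    rw [← Polynomial.aeval_algHom_apply]
    simp [paramHom, slopeCoord]
  have hzero : c.paramHom (∑ i : Fin F.totalDegree,
      Polynomial.aeval (X 1 - C l * X 0) (p i) * X 0 ^ (i : ℕ)) = 0 := by
    rw [map_sum, ← hg]
    refine Finset.sum_congr rfl fun i _ => ?_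
    rw [map_mul, hpar, hp, map_pow, paramHom, aeval_X]
    rfl
  rw [c.paramHom_eq_zero_iff hf hlin hE] at hzero
  have hev : ∀ (e : ℂ) (i : Fin F.totalDegree), (p i).eval e = 0 := by
    intro e
    have h1 := map_dvd (lineRestrict ![1, l] ![0, e]) hzero
    have h2 : lineRestrict ![1, l] ![0, e] (∑ i : Fin F.totalDegree,
        Polynomial.aeval (X 1 - C l * X 0) (p i) * X 0 ^ (i : ℕ)) =
        ∑ i : Fin F.totalDegree, Polynomial.C ((p i).eval e) * Polynomial.X ^ (i : ℕ) := by
      rw [map_sum]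
      refine Finset.sum_congr rfl fun i _ => ?_
      rw [map_mul, map_pow, ← Polynomial.aeval_algHom_apply]
      have h3 : lineRestrict ![1, l] ![0, e] (X 1 - C l * X 0) = Polynomial.C e := by
        simp
      have h4 : lineRestrict ![1, l] ![0, e] (X 0) = Polynomial.X := by
        simp
      rw [h3, h4, ← Polynomial.algebraMap_eq, Polynomial.aeval_algebraMap_apply,
        Polynomial.coe_aeval_eq_eval]
    rw [h2] at h1
    have hcoeff : ∀ i : Fin F.totalDegree, (∑ i : Fin F.totalDegree,
        Polynomial.C ((p i).eval e) * Polynomial.X ^ (i : ℕ)).coeff i = (p i).eval e := by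
      intro i
      simp only [Polynomial.finsetSum_coeff, Polynomial.coeff_C_mul_X_pow]
      rw [Finset.sum_eq_single i]
      · simp
      · intro j _ hj
        rw [if_neg fun h => hj (Fin.ext h.symm)]
      · simp
    have h5 : (∑ i : Fin F.totalDegree,
        Polynomial.C ((p i).eval e) * Polynomial.X ^ (i : ℕ)) = 0 := by
      refine Polynomial.eq_zero_of_dvd_of_degree_lt h1 ?_
      rw [Polynomial.degree_eq_natDegree (p := lineRestrict _ _ _) ?_,
        natDegree_lineRestrict_localEquation hE.isHomogeneous hl]
      · refine (Polynomial.degree_sum_le _ _).trans_lt ?_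
        rw [Finset.sup_lt_iff (WithBot.bot_lt_coe _)]
        intro i _
        exact (Polynomial.degree_C_mul_X_pow_le _ _).trans_lt (by exact_mod_cast i.2)
      · rw [← Polynomial.leadingCoeff_ne_zero,
          leadingCoeff_lineRestrict_localEquation hE.isHomogeneous hl]
        exact hl
    intro i
    rw [← hcoeff i, h5, Polynomial.coeff_zero]
  intro i
  have hpi : p i = 0 := Polynomial.funext fun e => by rw [hev e i, Polynomial.eval_zero]
  have := hp i
  rw [hpi, map_zero] at this
  exact Subtype.ext this.symm

end Chart

/-- The degree of the image of a generically one-to-one map is the degree of the map: it is at least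
`d` by counting points on a line, and at most `d` because the powers of `x₀` below `deg F` are
independent in an extension of degree `d`. -/
theorem IsEquation.totalDegree_eq {d : ℕ} (hd : 0 < d) {f : Fin 3 → MvPolynomial (Fin 2) ℂ}
    (hf : ∀ i, (f i).IsHomogeneous d) (hreg : NoCommonZero f) (hlin : LinearIndependent ℂ f)
    (hinj : GenericallyOneToOne (projMap f hreg))
    {F : MvPolynomial (Fin 3) ℂ} (hE : IsEquation f F) : F.totalDegree = d := by
  refine le_antisymm ?_ (hE.le_totalDegree hd hf hreg hlin hinj)
  have v : P1 := Projectivization.mk ℂ ![1, 0] (fun h => by simpa using congrFun h 0)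
  obtain ⟨c⟩ := nonempty_chart hd hf (projMap f hreg v)
  obtain ⟨l, hl⟩ := (hE.finite_setOf_direction hd hf hreg hlin
    (projMap f hreg v)).infinite_compl.nonempty
  have hfin := c.finrank_adjoin_slopeCoord hd hf hreg hlin hE hl
  have : FiniteDimensional (IntermediateField.adjoin ℂ {c.slopeCoord l}) (RatFunc ℂ) :=
    FiniteDimensional.of_finrank_pos (by omega)
  have h := (c.linearIndependent_pow hf hlin hE hl).fintype_card_le_finrank
  rwa [Fintype.card_fin, hfin] at h

/-! ### Branches -/

theorem ncard_primesOver_congr {R S T : Type*} [CommRing R] [CommRing S] [CommRing T] [Algebra R S]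
    [Algebra R T] (e : S ≃ₐ[R] T) (p : Ideal R) :
    (p.primesOver S).ncard = (p.primesOver T).ncard := by
  have h : p.primesOver S = Ideal.comap e '' p.primesOver T := by
    ext Q
    constructor
    · rintro ⟨h1, h2⟩
      refine ⟨Q.comap e.symm, ⟨inferInstance, Ideal.LiesOver.of_eq_comap p e.symm rfl⟩, ?_⟩
      ext x
      simp
    · rintro ⟨Q, ⟨h1, h2⟩, rfl⟩
      exact ⟨inferInstance, Ideal.LiesOver.of_eq_comap p e rfl⟩
  rw [h, Set.ncard_image_of_injective _ (Ideal.comap_injective_of_surjective e e.surjective)]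

namespace Chart

variable {f : Fin 3 → MvPolynomial (Fin 2) ℂ} {P : P2} (c : Chart f P)
variable {d : ℕ} {F : MvPolynomial (Fin 3) ℂ} {l : ℂ}

/-- The affine coordinates generate the function field of the line: already the powers of `x₀` span
it over `ℂ(x₁ - l x₀)`, being `d` independent elements of an extension of degree `d`. -/
theorem adjoin_coord (hd : 0 < d) (hf : ∀ i, (f i).IsHomogeneous d)
    (hreg : NoCommonZero f) (hlin : LinearIndependent ℂ f)
    (hinj : GenericallyOneToOne (projMap f hreg)) (hE : IsEquation f F) :
    IntermediateField.adjoin ℂ (Set.range c.coord) = ⊤ := by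
  obtain ⟨l, hl⟩ := (hE.finite_setOf_direction hd hf hreg hlin P).infinite_compl.nonempty
  have hfin := c.finrank_adjoin_slopeCoord hd hf hreg hlin hE hl
  have : FiniteDimensional (IntermediateField.adjoin ℂ {c.slopeCoord l}) (RatFunc ℂ) :=
    FiniteDimensional.of_finrank_pos (by omega)
  have hspan := (c.linearIndependent_pow hf hlin hE hl).span_eq_top_of_card_eq_finrank'
    (by rw [Fintype.card_fin, hfin, hE.totalDegree_eq hd hf hreg hlin hinj])
  have hmem : ∀ k, c.coord k ∈ IntermediateField.adjoin ℂ (Set.range c.coord) := fun k =>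
    IntermediateField.subset_adjoin ℂ _ ⟨k, rfl⟩
  have hle : IntermediateField.adjoin ℂ {c.slopeCoord l} ≤
      IntermediateField.adjoin ℂ (Set.range c.coord) := by
    rw [IntermediateField.adjoin_simple_le_iff]
    exact sub_mem (hmem 1) (mul_mem (algebraMap_mem _ l) (hmem 0))
  rw [eq_top_iff]
  intro z _
  have hz : z ∈ Submodule.span (IntermediateField.adjoin ℂ {c.slopeCoord l})
      (Set.range fun i : Fin F.totalDegree => c.coord 0 ^ (i : ℕ)) := hspan ▸ Submodule.mem_top
  induction hz using Submodule.span_induction with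
  | mem x hx =>
    obtain ⟨i, rfl⟩ := hx
    exact pow_mem (hmem 0) _
  | zero => exact zero_mem _
  | add x y _ _ hx hy => exact add_mem (hx trivial) (hy trivial)
  | smul a x _ hx => exact mul_mem (hle a.2) (hx trivial)

/-- The parametrization is birational: the function field of the curve is that of the line. -/
theorem isFractionRing (hd : 0 < d) (hf : ∀ i, (f i).IsHomogeneous d)
    (hreg : NoCommonZero f) (hlin : LinearIndependent ℂ f)
    (hinj : GenericallyOneToOne (projMap f hreg)) (hE : IsEquation f F) :
    letI := (c.quotHom hf hlin hE).toRingHom.toAlgebra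
    IsFractionRing (AffineRing F P) (RatFunc ℂ) := by
  let _ := (c.quotHom hf hlin hE).toRingHom.toAlgebra
  have : FaithfulSMul (AffineRing F P) (RatFunc ℂ) := by
    rw [faithfulSMul_iff_algebraMap_injective]
    exact c.quotHom_injective hf hlin hE
  refine IsFractionRing.of_field _ _ fun z => ?_
  have hz : z ∈ IntermediateField.adjoin ℂ (Set.range c.coord) := by
    rw [c.adjoin_coord hd hf hreg hlin hinj hE]
    trivial
  obtain ⟨r, hr, s, hs, rfl⟩ := IntermediateField.mem_adjoin_iff_div.mp hz
  rw [Algebra.adjoin_range_eq_range_aeval] at hr hs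
  obtain ⟨r, rfl⟩ := hr
  obtain ⟨s, rfl⟩ := hs
  exact ⟨Ideal.Quotient.mk _ r, Ideal.Quotient.mk _ s, rfl⟩

/-- The branches at `P` correspond to the parameters of `P`. -/
theorem branchesAt_eq (hd : 0 < d) (hf : ∀ i, (f i).IsHomogeneous d)
    (hreg : NoCommonZero f) (hlin : LinearIndependent ℂ f)
    (hinj : GenericallyOneToOne (projMap f hreg)) (hE : IsEquation f F) :
    branchesAt F P = {τ : ℂ | ∀ k, (c.num k).eval τ = 0}.ncard := by
  let _ := (c.quotHom hf hlin hE).toRingHom.toAlgebra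
  have : IsScalarTower ℂ (AffineRing F P) (RatFunc ℂ) :=
    IsScalarTower.of_algebraMap_eq' (c.quotHom hf hlin hE).comp_algebraMap.symm
  have hfrac : IsFractionRing (AffineRing F P) (RatFunc ℂ) :=
    c.isFractionRing hd hf hreg hlin hinj hE
  have hpar : IsParametrized (AffineRing F P) (RatFunc ℂ)
      (fun k => Ideal.Quotient.mk (Ideal.span {localEquation F P}) (X k)) c.num c.den d :=
    c.isParametrized hd hf hreg hlin hE
  rw [← hpar.ncard_primesOver]
  exact ncard_primesOver_congr (S := NormalizedRing F P)
    (T := integralClosure (AffineRing F P) (RatFunc ℂ))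
    (FractionRing.algEquiv (AffineRing F P) (RatFunc ℂ)).mapIntegralClosure _

end Chart

/-! ### Multiplicities -/

/-- The product of the values of `h` at the roots of `p - e q` is a polynomial in `e`: it is
a resultant. -/
theorem exists_eval_eq_prod_roots {p q : Polynomial ℂ} (hdeg : q.natDegree < p.natDegree)
    (h : Polynomial ℂ) : ∃ R : Polynomial ℂ, ∀ e, R.eval e =
      ((p - Polynomial.C e * q).roots.map h.eval).prod := by
  have hp : p ≠ 0 := by
    rintro rfl
    simp at hdeg
  refine ⟨Polynomial.C ((p.leadingCoeff ^ h.natDegree)⁻¹) * Polynomial.resultant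
    (p.map Polynomial.C - Polynomial.C Polynomial.X * q.map Polynomial.C) (h.map Polynomial.C)
    p.natDegree h.natDegree, fun e => ?_⟩
  have hC : (Polynomial.evalRingHom e).comp Polynomial.C = RingHom.id ℂ := by
    ext x
    simp
  have h1 := Polynomial.resultant_eq_prod_eval (p - Polynomial.C e * q) h h.natDegree le_rfl
    (IsAlgClosed.splits _)
  rw [natDegree_sub_C_mul hdeg, Polynomial.leadingCoeff, natDegree_sub_C_mul hdeg,
    Polynomial.coeff_sub, Polynomial.coeff_C_mul, Polynomial.coeff_eq_zero_of_natDegree_lt hdeg,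
    mul_zero, sub_zero, Polynomial.coeff_natDegree] at h1
  rw [Polynomial.eval_mul, Polynomial.eval_C, ← Polynomial.coe_evalRingHom,
    ← Polynomial.resultant_map_map, Polynomial.map_sub, Polynomial.map_mul, Polynomial.map_map,
    Polynomial.map_map, Polynomial.map_map, hC, Polynomial.map_id, Polynomial.map_id,
    Polynomial.map_id, Polynomial.map_C, Polynomial.coe_evalRingHom, Polynomial.eval_X, h1,
    ← mul_assoc, inv_mul_cancel₀ (pow_ne_zero _ (Polynomial.leadingCoeff_ne_zero.mpr hp)), one_mul]

theorem rootMultiplicity_eq_of_eq_pow_mul {p q : Polynomial ℂ} {τ : ℂ} {n : ℕ}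
    (h : p = (Polynomial.X - Polynomial.C τ) ^ n * q) (hq : q.eval τ ≠ 0) :
    p.rootMultiplicity τ = n := by
  have hq0 : q ≠ 0 := by
    rintro rfl
    simp at hq
  rw [h, mul_comm, Polynomial.rootMultiplicity_mul_X_sub_C_pow hq0,
    Polynomial.rootMultiplicity_eq_zero hq, zero_add]

theorem lineRestrict_zero {n : ℕ} (a : Fin n → ℂ) (p : MvPolynomial (Fin n) ℂ) :
    lineRestrict a 0 p = (gradingHom p).map (eval a) := by
  induction p using MvPolynomial.induction_on with
  | C c => simp [gradingHom]
  | add p q hp hq => simp only [map_add, hp, hq, Polynomial.map_add]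
  | mul_X p i hp =>
    rw [map_mul, map_mul, hp, Polynomial.map_mul]
    simp [gradingHom]

/-- Along a line through the origin the coefficients of a polynomial are the values of its
homogeneous components at a direction vector. -/
theorem coeff_lineRestrict_zero {n : ℕ} (a : Fin n → ℂ) (p : MvPolynomial (Fin n) ℂ) (k : ℕ) :
    (lineRestrict a 0 p).coeff k = eval a (homogeneousComponent k p) := by
  rw [lineRestrict_zero, Polynomial.coeff_map, coeff_gradingHom]

theorem finite_setOf_eval_slope {n : ℕ} {h : MvPolynomial (Fin 2) ℂ} (hh : h.IsHomogeneous n)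
    (h0 : h ≠ 0) : {l : ℂ | eval ![1, l] h = 0}.Finite := by
  have hne : lineRestrict ![0, 1] ![1, 0] h ≠ 0 := fun h1 =>
    h0 (eq_zero_of_lineRestrict_eq_zero (by simp [det2]) hh h1)
  refine (Polynomial.finite_setOfPred_isRoot hne).subset fun l hl => ?_
  rw [Set.mem_ofPred_eq, Polynomial.IsRoot, eval_lineRestrict]
  rw [Set.mem_ofPred_eq] at hl
  convert hl using 2
  simp

/-- The multiplicity is the order of vanishing along a general line. -/
theorem rootMultiplicity_lineRestrict {F : MvPolynomial (Fin 3) ℂ} {P : P2}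
    (h0 : localEquation F P ≠ 0) :
    ∃ S : Set ℂ, S.Finite ∧ ∀ l ∉ S,
      (lineRestrict ![1, l] 0 (localEquation F P)).rootMultiplicity 0 = multiplicityAt F P := by
  have hne : {k | homogeneousComponent k (localEquation F P) ≠ 0}.Nonempty := by
    by_contra h
    rw [Set.not_nonempty_iff_eq_empty, Set.eq_empty_iff_forall_notMem] at h
    apply h0
    rw [← sum_homogeneousComponent (localEquation F P)]
    exact Finset.sum_eq_zero fun k _ => by simpa using h k
  have hm : homogeneousComponent (multiplicityAt F P) (localEquation F P) ≠ 0 := Nat.sInf_mem hne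
  refine ⟨_, finite_setOf_eval_slope (homogeneousComponent_isHomogeneous _ _) hm, fun l hl => ?_⟩
  rw [Set.mem_ofPred_eq, ← coeff_lineRestrict_zero] at hl
  rw [Polynomial.rootMultiplicity_eq_natTrailingDegree']
  refine le_antisymm (Polynomial.natTrailingDegree_le_of_ne_zero hl)
    (Polynomial.le_natTrailingDegree (fun h => hl (by rw [h, Polynomial.coeff_zero])) ?_)
  intro k hk
  have : homogeneousComponent k (localEquation F P) = 0 := by
    by_contra h
    exact Nat.notMem_of_lt_sInf hk h
  rw [coeff_lineRestrict_zero, this, map_zero]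

namespace Chart

variable {f : Fin 3 → MvPolynomial (Fin 2) ℂ} {P : P2} (c : Chart f P)
variable {d : ℕ} {F : MvPolynomial (Fin 3) ℂ} {l : ℂ}

/-- The norm formula: on the line `x₁ - l x₀ = e` the equation of the curve is, up to a constant
factor, the product of `x - x₀(τ)` over the parameters `τ` on that line. It is written without
denominators, so that both sides are polynomials in `e`. -/
theorem eval_lineRestrict_mul_prod (hd : 0 < d) (hf : ∀ i, (f i).IsHomogeneous d)
    (hreg : NoCommonZero f) (hlin : LinearIndependent ℂ f)
    (hinj : GenericallyOneToOne (projMap f hreg)) (hE : IsEquation f F)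
    (hl : eval (direction P l) F ≠ 0) (e x : ℂ) :
    (lineRestrict ![1, l] ![0, e] (localEquation F P)).eval x *
        ((c.pencil l - Polynomial.C e * c.den).roots.map c.den.eval).prod =
      eval (direction P l) F * ((c.pencil l - Polynomial.C e * c.den).roots.map
        (Polynomial.C x * c.den - c.num 0).eval).prod := by
  have hdeg : c.den.natDegree < (c.pencil l).natDegree := by
    rw [c.natDegree_pencil hf hreg hE hl]
    exact c.natDegree_den_lt hf hd
  obtain ⟨R₁, hR₁⟩ := exists_eval_eq_prod_roots hdeg c.den
  obtain ⟨R₂, hR₂⟩ := exists_eval_eq_prod_roots hdeg (Polynomial.C x * c.den - c.num 0)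
  have hline : ∀ e, (lineRestrict ![1, l] ![0, e] (localEquation F P)).eval x =
      (lineRestrict ![0, 1] ![x, l * x] (localEquation F P)).eval e := by
    intro e
    rw [eval_lineRestrict, eval_lineRestrict]
    congr 2
    funext k
    rcases (show ∀ k : Fin 2, k = 0 ∨ k = 1 by decide) k with rfl | rfl
    · simp
    · simp only [Pi.add_apply, Pi.smul_apply, Matrix.cons_val, smul_eq_mul]
      ring
  -- both sides are polynomials in `e`, so it is enough to compare them for general `e`
  have key : lineRestrict ![0, 1] ![x, l * x] (localEquation F P) * R₁ =
      Polynomial.C (eval (direction P l) F) * R₂ := by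
    refine Polynomial.eq_of_infinite_eval_eq _ _
      ((c.finite_setOf_not_distinct hd hf hreg hinj hE hl).infinite_compl.mono ?_)
    intro e he
    rw [Set.mem_compl_iff, Set.mem_ofPred_eq, not_not] at he
    rw [Set.mem_ofPred_eq, Polynomial.eval_mul, Polynomial.eval_mul, Polynomial.eval_C, hR₁, hR₂,
      ← hline]
    have hnat := natDegree_lineRestrict_localEquation hE.isHomogeneous hl e
    have hlead := leadingCoeff_lineRestrict_localEquation hE.isHomogeneous hl e
    have hne : lineRestrict ![1, l] ![0, e] (localEquation F P) ≠ 0 := by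
      rwa [← Polynomial.leadingCoeff_ne_zero, hlead]
    have hroots : (c.pencil l - Polynomial.C e * c.den).roots.map
        (fun τ => (c.num 0).eval τ / c.den.eval τ) =
        (lineRestrict ![1, l] ![0, e] (localEquation F P)).roots := by
      refine Multiset.eq_of_le_of_card_le ((Multiset.le_iff_subset he).mpr ?_) ?_
      · intro y hy
        obtain ⟨τ, hτ, rfl⟩ := Multiset.mem_map.mp hy
        have hτ0 := Polynomial.isRoot_of_mem_roots hτ
        exact (Polynomial.mem_roots hne).mpr (c.eval_lineRestrict_eq_zero hE
          (c.den_eval_ne_zero_of_mem_roots hreg hE hl hτ0) hτ0)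
      · rw [Multiset.card_map, card_roots_sub_C_mul hdeg, c.natDegree_pencil hf hreg hE hl,
          IsAlgClosed.card_roots_eq_natDegree, hnat, hE.totalDegree_eq hd hf hreg hlin hinj]
    have hsplit := (IsAlgClosed.splits
      (lineRestrict ![1, l] ![0, e] (localEquation F P))).eq_prod_roots
    rw [hlead, ← hroots] at hsplit
    rw [hsplit, Polynomial.eval_mul, Polynomial.eval_C, Polynomial.eval_multiset_prod, mul_assoc,
      Multiset.map_map, Multiset.map_map, ← Multiset.prod_map_mul]
    congr 2
    refine Multiset.map_congr rfl fun τ hτ => ?_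
    have hden := c.den_eval_ne_zero_of_mem_roots hreg hE hl (Polynomial.isRoot_of_mem_roots hτ)
    simp only [Function.comp_apply, Polynomial.eval_sub, Polynomial.eval_X, Polynomial.eval_C,
      Polynomial.eval_mul]
    field_simp
  have := congrArg (Polynomial.eval e) key
  rwa [Polynomial.eval_mul, Polynomial.eval_mul, Polynomial.eval_C, hR₁, hR₂, ← hline] at this

/-- The intersections of the curve with a line through `P`, counted with multiplicity, correspond to
the parameters of the points of the curve on that line. -/
theorem roots_lineRestrict (hd : 0 < d) (hf : ∀ i, (f i).IsHomogeneous d)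
    (hreg : NoCommonZero f) (hlin : LinearIndependent ℂ f)
    (hinj : GenericallyOneToOne (projMap f hreg)) (hE : IsEquation f F)
    (hl : eval (direction P l) F ≠ 0) :
    (lineRestrict ![1, l] 0 (localEquation F P)).roots =
      (c.pencil l).roots.map fun τ => (c.num 0).eval τ / c.den.eval τ := by
  have hden : ∀ τ ∈ (c.pencil l).roots, c.den.eval τ ≠ 0 := fun τ hτ =>
    c.den_eval_ne_zero_of_pencil hreg hE hl (Polynomial.isRoot_of_mem_roots hτ)
  have key : lineRestrict ![1, l] 0 (localEquation F P) =
      Polynomial.C (eval (direction P l) F) * (((c.pencil l).roots.map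
        fun τ => (c.num 0).eval τ / c.den.eval τ).map
          fun y => Polynomial.X - Polynomial.C y).prod := by
    refine Polynomial.funext fun x => ?_
    have h := c.eval_lineRestrict_mul_prod hd hf hreg hlin hinj hE hl 0 x
    have h0 : (![0, 0] : Fin 2 → ℂ) = 0 := by simp
    rw [Polynomial.C_0, zero_mul, sub_zero, h0] at h
    have hprod : ((c.pencil l).roots.map c.den.eval).prod ≠ 0 := by
      refine Multiset.prod_ne_zero fun hmem => ?_
      obtain ⟨τ, hτ, h1⟩ := Multiset.mem_map.mp hmem
      exact hden τ hτ h1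
    refine mul_right_cancel₀ hprod (h.trans ?_)
    rw [Polynomial.eval_mul, Polynomial.eval_C, Polynomial.eval_multiset_prod, mul_assoc,
      Multiset.map_map, Multiset.map_map, ← Multiset.prod_map_mul]
    congr 2
    refine Multiset.map_congr rfl fun τ hτ => ?_
    have := hden τ hτ
    simp only [Function.comp_apply, Polynomial.eval_sub, Polynomial.eval_X, Polynomial.eval_C,
      Polynomial.eval_mul]
    field_simp
  rw [key, Polynomial.roots_C_mul _ hl, Polynomial.roots_multiset_prod_X_sub_C]

/-- The order of vanishing of the parametrization, in coordinates centred at `P`, at the parameter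
`τ`: the multiplicity of the branch through that point. -/
noncomputable def order (τ : ℂ) : ℕ :=
  min ((c.num 0).rootMultiplicity τ) ((c.num 1).rootMultiplicity τ)

theorem num_ne_zero (hf : ∀ i, (f i).IsHomogeneous d) (hlin : LinearIndependent ℂ f) (k : Fin 2) :
    c.num k ≠ 0 := fun h =>
  numForm_ne_zero hlin P k
    (eq_zero_of_lineRestrict_eq_zero c.det_ne_zero (isHomogeneous_numForm hf k) h)

theorem exists_num_eq (hf : ∀ i, (f i).IsHomogeneous d) (hlin : LinearIndependent ℂ f) (τ : ℂ) :
    ∃ N : Fin 2 → Polynomial ℂ,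
      (∀ k, c.num k = (Polynomial.X - Polynomial.C τ) ^ c.order τ * N k) ∧
      ∃ k, (N k).eval τ ≠ 0 := by
  have h := fun k => Polynomial.exists_eq_pow_rootMultiplicity_mul_and_not_dvd (c.num k)
    (c.num_ne_zero hf hlin k) τ
  choose N hN hN0 using h
  have hle : ∀ k, c.order τ ≤ (c.num k).rootMultiplicity τ := by
    rw [Fin.forall_fin_two]
    exact ⟨min_le_left _ _, min_le_right _ _⟩
  refine ⟨fun k => (Polynomial.X - Polynomial.C τ) ^
    ((c.num k).rootMultiplicity τ - c.order τ) * N k, fun k => ?_, ?_⟩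
  · rw [← mul_assoc, ← pow_add, Nat.add_sub_cancel' (hle k)]
    exact hN k
  · have hex : ∃ k, c.order τ = (c.num k).rootMultiplicity τ := by
      rcases min_choice ((c.num 0).rootMultiplicity τ) ((c.num 1).rootMultiplicity τ) with h | h
      · exact ⟨0, h⟩
      · exact ⟨1, h⟩
    obtain ⟨k, hk⟩ := hex
    refine ⟨k, ?_⟩
    beta_reduce
    rw [hk, Nat.sub_self, pow_zero, one_mul]
    intro h0
    exact hN0 k (Polynomial.dvd_iff_isRoot.mpr h0)

/-- For all but finitely many slopes `l`, the line of slope `l` through the centre is not tangent to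
the branch at `τ`, and meets it with the multiplicity of the branch. -/
theorem finite_setOf_rootMultiplicity_pencil_ne (hf : ∀ i, (f i).IsHomogeneous d)
    (hlin : LinearIndependent ℂ f) (τ : ℂ) :
    {l : ℂ | (c.pencil l).rootMultiplicity τ ≠ c.order τ}.Finite := by
  obtain ⟨N, hN, hN0⟩ := c.exists_num_eq hf hlin τ
  have hq : Polynomial.C ((N 1).eval τ) - Polynomial.C ((N 0).eval τ) * Polynomial.X ≠ 0 := by
    intro h
    have h0 := congrArg (Polynomial.coeff · 0) h
    have h1 := congrArg (Polynomial.coeff · 1) h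
    simp [Polynomial.coeff_C] at h0 h1
    obtain ⟨k, hk⟩ := hN0
    rcases (show ∀ k : Fin 2, k = 0 ∨ k = 1 by decide) k with rfl | rfl
    · exact hk h1
    · exact hk h0
  refine (Polynomial.finite_setOfPred_isRoot hq).subset fun l hl => ?_
  by_contra hne
  apply hl
  have hne' : (N 1 - Polynomial.C l * N 0).eval τ ≠ 0 := by
    intro h
    apply hne
    rw [Set.mem_ofPred_eq, Polynomial.IsRoot]
    simp only [Polynomial.eval_sub, Polynomial.eval_mul, Polynomial.eval_C, Polynomial.eval_X]
      at h ⊢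
    linear_combination h
  have heq : c.pencil l = (Polynomial.X - Polynomial.C τ) ^ c.order τ *
      (N 1 - Polynomial.C l * N 0) := by
    rw [pencil, hN 0, hN 1]
    ring
  exact rootMultiplicity_eq_of_eq_pow_mul heq hne'

theorem finite_setOf_eval_num_eq_zero (hf : ∀ i, (f i).IsHomogeneous d)
    (hlin : LinearIndependent ℂ f) : {τ : ℂ | ∀ k, (c.num k).eval τ = 0}.Finite :=
  (Polynomial.finite_setOfPred_isRoot (c.num_ne_zero hf hlin 0)).subset fun _ h => h 0

/-- The multiplicity of the curve at `P` is the sum of the multiplicities of its branches. -/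
theorem multiplicityAt_eq (hd : 0 < d) (hf : ∀ i, (f i).IsHomogeneous d)
    (hreg : NoCommonZero f) (hlin : LinearIndependent ℂ f)
    (hinj : GenericallyOneToOne (projMap f hreg)) (hE : IsEquation f F) :
    multiplicityAt F P = ∑ τ ∈ (c.finite_setOf_eval_num_eq_zero hf hlin).toFinset, c.order τ := by
  classical
  have hG : localEquation F P ≠ 0 := by
    intro h
    obtain ⟨l, hl⟩ := (hE.finite_setOf_direction hd hf hreg hlin P).infinite_compl.nonempty
    have := leadingCoeff_lineRestrict_localEquation hE.isHomogeneous hl 0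
    rw [h, map_zero, Polynomial.leadingCoeff_zero] at this
    exact hl this.symm
  obtain ⟨S, hS, hm⟩ := rootMultiplicity_lineRestrict hG
  obtain ⟨l, hl⟩ := (((hE.finite_setOf_direction hd hf hreg hlin P).union hS).union
    ((c.finite_setOf_eval_num_eq_zero hf hlin).biUnion fun τ _ =>
      c.finite_setOf_rootMultiplicity_pencil_ne hf hlin τ)).infinite_compl.nonempty
  rw [Set.mem_compl_iff, Set.mem_union, Set.mem_union, not_or, not_or] at hl
  obtain ⟨⟨hl1, hl2⟩, hl3⟩ := hl
  have hord : ∀ τ, (∀ k, (c.num k).eval τ = 0) →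
      (c.pencil l).rootMultiplicity τ = c.order τ := by
    intro τ hτ
    by_contra h
    exact hl3 (Set.mem_biUnion (x := τ) hτ h)
  rw [← hm l hl2, ← Polynomial.count_roots, c.roots_lineRestrict hd hf hreg hlin hinj hE hl1,
    Multiset.count_map]
  have hfilter : (c.pencil l).roots.filter (fun τ => 0 = (c.num 0).eval τ / c.den.eval τ) =
      (c.pencil l).roots.filter (· ∈ (c.finite_setOf_eval_num_eq_zero hf hlin).toFinset) := by
    refine Multiset.filter_congr fun τ hτ => ?_
    have h0 := Polynomial.isRoot_of_mem_roots hτ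
    have hden := c.den_eval_ne_zero_of_pencil hreg hE hl1 h0
    rw [Polynomial.IsRoot, eval_pencil] at h0
    rw [Set.Finite.mem_toFinset, Set.mem_ofPred_eq, Fin.forall_fin_two, eq_comm, div_eq_zero_iff,
      or_iff_left hden]
    constructor
    · intro h
      rw [h, mul_zero, sub_zero] at h0
      exact ⟨h, h0⟩
    · exact fun h => h.1
  rw [hfilter]
  have := Multiset.sum_count_eq_card (s := (c.finite_setOf_eval_num_eq_zero hf hlin).toFinset)
    (m := (c.pencil l).roots.filter
      (· ∈ (c.finite_setOf_eval_num_eq_zero hf hlin).toFinset))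
    (fun τ hτ => (Multiset.mem_filter.mp hτ).2)
  rw [← this]
  refine Finset.sum_congr rfl fun τ hτ => ?_
  rw [Multiset.count_filter_of_pos hτ, Polynomial.count_roots]
  exact hord τ ((Set.Finite.mem_toFinset _).mp hτ)

end Chart

/-! ### The greatest common divisor of the minors -/

theorem lineRestrict_linForm (a b : Fin 2 → ℂ) (r τ : ℂ) :
    lineRestrict a b (linForm (r • (τ • a + b))) =
      Polynomial.C (r * det2 a b) * (Polynomial.X - Polynomial.C τ) := by
  refine Polynomial.funext fun σ => ?_
  rw [eval_lineRestrict, eval_linForm]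
  simp only [det2, Polynomial.eval_mul, Polynomial.eval_C, Polynomial.eval_sub, Polynomial.eval_X,
    Pi.add_apply, Pi.smul_apply, smul_eq_mul]
  ring

/-- The order of vanishing of a binary form at a point of the projective line. -/
noncomputable def vanishingOrder (A : MvPolynomial (Fin 2) ℂ) (Q : P1) : ℕ :=
  multiplicity (linForm Q.rep) A

theorem rootMultiplicity_lineRestrict_eq {n : ℕ} {A : MvPolynomial (Fin 2) ℂ}
    (hA : A.IsHomogeneous n) (hA0 : A ≠ 0) {a b : Fin 2 → ℂ} (hab : det2 a b ≠ 0) (τ : ℂ) :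
    (lineRestrict a b A).rootMultiplicity τ = vanishingOrder A (linePoint a b hab τ) := by
  have hv := smul_add_ne_zero hab τ
  have hfin : FiniteMultiplicity (linForm (linePoint a b hab τ).rep) A :=
    FiniteMultiplicity.of_not_isUnit (not_isUnit_linForm _) hA0
  obtain ⟨B, hB, hB0⟩ := hfin.exists_eq_pow_mul_and_not_dvd
  have hBhom := (isHomogeneous_of_mul (hB ▸ hA) (hB ▸ hA0)).2
  obtain ⟨r, hr⟩ := Projectivization.exists_smul_eq_mk_rep ℂ _ hv
  have hBτ : eval (τ • a + b) B ≠ 0 := by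
    intro h
    apply hB0
    refine linForm_dvd hBhom (linePoint a b hab τ).rep_nonzero ?_
    exact (eval_rep_eq_zero_iff hBhom hv).mpr h
  have hlin : lineRestrict a b (linForm (linePoint a b hab τ).rep) =
      Polynomial.C (r * det2 a b) * (Polynomial.X - Polynomial.C τ) := by
    rw [← lineRestrict_linForm]
    exact congrArg (fun v => lineRestrict a b (linForm v)) hr.symm
  have hrd : (r : ℂ) * det2 a b ≠ 0 := mul_ne_zero r.ne_zero hab
  refine rootMultiplicity_eq_of_eq_pow_mul (q := Polynomial.C ((r * det2 a b) ^
    vanishingOrder A (linePoint a b hab τ)) * lineRestrict a b B) ?_ ?_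
  · conv_lhs => rw [hB]
    rw [map_mul, map_pow, hlin, vanishingOrder, mul_pow, Polynomial.C_pow]
    ring
  · rw [Polynomial.eval_mul, Polynomial.eval_C, eval_lineRestrict]
    exact mul_ne_zero (pow_ne_zero _ hrd) hBτ

theorem exists_eval_ne_zero {n : ℕ} {A : MvPolynomial (Fin 2) ℂ} (hA : A.IsHomogeneous n)
    (hA0 : A ≠ 0) : ∃ v : Fin 2 → ℂ, v ≠ 0 ∧ eval v A ≠ 0 := by
  have hab : det2 ![1, 0] ![0, 1] ≠ 0 := by simp [det2]
  by_contra! h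
  refine hA0 (eq_zero_of_lineRestrict_eq_zero hab hA (Polynomial.funext fun τ => ?_))
  rw [eval_lineRestrict, h _ (smul_add_ne_zero hab τ), Polynomial.eval_zero]

/-- The degree of a binary form is the number of its zeros, counted with multiplicity. -/
theorem totalDegree_eq_sum_vanishingOrder {n : ℕ} {A : MvPolynomial (Fin 2) ℂ}
    (hA : A.IsHomogeneous n) (hA0 : A ≠ 0) :
    A.totalDegree = ∑ Q ∈ (finite_setOf_eval_eq_zero hA hA0).toFinset, vanishingOrder A Q := by
  classical
  obtain ⟨a, ha, haA⟩ := exists_eval_ne_zero hA hA0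
  obtain ⟨b, hab⟩ := exists_det2_ne_zero ha
  have hdeg : (lineRestrict a b A).natDegree = n :=
    Polynomial.natDegree_eq_of_le_of_coeff_ne_zero (natDegree_lineRestrict_le _ _ hA)
      (by rwa [coeff_lineRestrict _ _ hA])
  have hne : lineRestrict a b A ≠ 0 := fun h => hA0 (eq_zero_of_lineRestrict_eq_zero hab hA h)
  have hset : (finite_setOf_eval_eq_zero hA hA0).toFinset =
      (lineRestrict a b A).roots.toFinset.image (linePoint a b hab) := by
    ext Q
    rw [Set.Finite.mem_toFinset, Set.mem_ofPred_eq, Finset.mem_image]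
    constructor
    · induction Q using Projectivization.ind with
      | h v hv =>
        intro hQ
        rw [eval_rep_eq_zero_iff hA] at hQ
        have hdet : det2 a v ≠ 0 := by
          intro h
          obtain ⟨s, rfl⟩ := eq_smul_of_det2_eq_zero ha h
          rw [eval_smul_of_isHomogeneous hA] at hQ
          have h0 := (mul_eq_zero.mp hQ).resolve_right haA
          have : s = 0 := eq_zero_of_pow_eq_zero h0
          exact hv (by rw [this, zero_smul])
        obtain ⟨τ, hτ⟩ := exists_linePoint_eq hab hv hdet
        refine ⟨τ, ?_, hτ⟩
        rw [Multiset.mem_toFinset, Polynomial.mem_roots hne, Polynomial.IsRoot, eval_lineRestrict,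
          ← eval_rep_eq_zero_iff hA (smul_add_ne_zero hab τ)]
        rw [← eval_rep_eq_zero_iff hA hv, ← hτ] at hQ
        exact hQ
    · rintro ⟨τ, hτ, rfl⟩
      rw [Multiset.mem_toFinset, Polynomial.mem_roots hne, Polynomial.IsRoot,
        eval_lineRestrict] at hτ
      exact (eval_rep_eq_zero_iff hA (smul_add_ne_zero hab τ)).mpr hτ
  rw [hset, Finset.sum_image (fun _ _ _ _ h => linePoint_injective hab h), hA.totalDegree hA0,
    ← hdeg, ← IsAlgClosed.card_roots_eq_natDegree, ← Multiset.toFinset_sum_count_eq]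
  refine Finset.sum_congr rfl fun τ _ => ?_
  rw [Polynomial.count_roots, rootMultiplicity_lineRestrict_eq hA hA0 hab]

theorem pow_dvd_wronskian {T u : Polynomial ℂ} {r : ℕ} (h : T ^ r ∣ u) (D : Polynomial ℂ) :
    T ^ (r - 1) ∣ Polynomial.wronskian D u :=
  dvd_sub ((Polynomial.pow_sub_one_dvd_derivative_of_pow_dvd h).mul_left _)
    (((pow_dvd_pow _ (Nat.sub_le r 1)).trans h).mul_left _)

theorem exists_wronskian_eq_pow_mul {D u N : Polynomial ℂ} {τ : ℂ} {r : ℕ} (hr : 0 < r)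
    (hu : u = (Polynomial.X - Polynomial.C τ) ^ r * N) (hN : N.eval τ ≠ 0) (hD : D.eval τ ≠ 0) :
    ∃ q, Polynomial.wronskian D u = (Polynomial.X - Polynomial.C τ) ^ (r - 1) * q ∧
      q.eval τ ≠ 0 := by
  obtain ⟨s, rfl⟩ : ∃ s, r = s + 1 := ⟨r - 1, by omega⟩
  refine ⟨Polynomial.C ((s : ℂ) + 1) * D * N +
    (Polynomial.X - Polynomial.C τ) * (D * Polynomial.derivative N - Polynomial.derivative D * N),
    ?_, ?_⟩
  · rw [hu, Polynomial.wronskian, Polynomial.derivative_mul, Polynomial.derivative_X_sub_C_pow]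
    simp only [Nat.add_sub_cancel, pow_succ, Nat.cast_add, Nat.cast_one, map_add,
      Polynomial.C_1, map_natCast]
    ring
  · have : ((s : ℂ) + 1) ≠ 0 := by exact_mod_cast Nat.succ_ne_zero s
    simp [this, hN, hD]

theorem IsDualMap.dvd_jacobian {f g : Fin 3 → MvPolynomial (Fin 2) ℂ} {A : MvPolynomial (Fin 2) ℂ}
    (h : IsDualMap f A g) (j k : Fin 3) : A ∣ jacobian (f j) (f k) := by
  obtain ⟨h01, h02, h12⟩ := (h.dvd_iff A).mp dvd_rfl
  have hlt : ∀ j k : Fin 3, j < k → A ∣ jacobian (f j) (f k) := by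
    intro j k hjk
    rcases (show ∀ j k : Fin 3, j < k → (j = 0 ∧ k = 1) ∨ (j = 0 ∧ k = 2) ∨ (j = 1 ∧ k = 2) by
      decide) j k hjk with ⟨rfl, rfl⟩ | ⟨rfl, rfl⟩ | ⟨rfl, rfl⟩
    · exact h01
    · exact h02
    · exact h12
  rcases lt_trichotomy j k with hjk | rfl | hjk
  · exact hlt j k hjk
  · rw [jacobian, sub_self]
    exact dvd_zero A
  · have := hlt k j hjk
    rwa [← dvd_neg, jacobian, neg_sub] at this

namespace Chart

variable {f : Fin 3 → MvPolynomial (Fin 2) ℂ} {P : P2} (c : Chart f P)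
variable {d : ℕ} {F : MvPolynomial (Fin 3) ℂ}

theorem pow_dvd_wronskian_lineRestrict {T : Polynomial ℂ} {r : ℕ} (h : ∀ k, T ^ r ∣ c.num k)
    (j k : Fin 3) : T ^ (r - 1) ∣
      Polynomial.wronskian (lineRestrict c.a c.b (f j)) (lineRestrict c.a c.b (f k)) := by
  have hunit : IsUnit (Polynomial.C (P.rep (chartIndex P))) :=
    (IsUnit.mk0 _ (rep_chartIndex_ne_zero P)).map Polynomial.C
  have hstep : ∀ (D : Polynomial ℂ), T ^ (r - 1) ∣ Polynomial.wronskian D c.den →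
      ∀ m, T ^ (r - 1) ∣
        Polynomial.wronskian D (lineRestrict c.a c.b (f (affineIndex P m))) := by
    intro D hD m
    have h1 := dvd_add (pow_dvd_wronskian (h m) D) (hD.mul_left
      (Polynomial.C (P.rep (affineIndex P m))))
    rw [← hunit.dvd_mul_left]
    convert h1 using 1
    rw [num_eq, Polynomial.wronskian, Polynomial.wronskian, Polynomial.wronskian,
      Polynomial.derivative_sub, Polynomial.derivative_C_mul, Polynomial.derivative_C_mul]
    ring
  have hden : ∀ j, T ^ (r - 1) ∣ Polynomial.wronskian (lineRestrict c.a c.b (f j)) c.den := by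
    intro j
    rw [← Polynomial.wronskian_neg_eq, dvd_neg]
    obtain rfl | ⟨m, rfl⟩ := index_cases P j
    · rw [← den, Polynomial.wronskian_self_eq_zero]
      exact dvd_zero _
    · exact hstep _ (by rw [Polynomial.wronskian_self_eq_zero]; exact dvd_zero _) m
  obtain rfl | ⟨m, rfl⟩ := index_cases P k
  · exact hden j
  · exact hstep _ (hden j) m

/-- At a point of the normalization, the minors of the Jacobian matrix vanish to an order one less
than the multiplicity of the branch. -/
theorem vanishingOrder_add_one {g : Fin 3 → MvPolynomial (Fin 2) ℂ} {A : MvPolynomial (Fin 2) ℂ}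
    (h : IsDualMap f A g) (hd : 0 < d) (hf : ∀ i, (f i).IsHomogeneous d)
    (hreg : NoCommonZero f) (hlin : LinearIndependent ℂ f) {τ : ℂ}
    (hτ : ∀ k, (c.num k).eval τ = 0) :
    vanishingOrder A (c.point τ) + 1 = c.order τ := by
  have hA0 := h.gcd_ne_zero hd hf hlin
  have hAhom := h.isHomogeneous_gcd hd hf hlin
  have hlA : lineRestrict c.a c.b A ≠ 0 := fun h0 =>
    hA0 (eq_zero_of_lineRestrict_eq_zero c.det_ne_zero hAhom h0)
  have hpos : 0 < c.order τ := by
    have := fun k => (Polynomial.rootMultiplicity_pos (c.num_ne_zero hf hlin k)).mpr (hτ k)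
    exact lt_min (this 0) (this 1)
  obtain ⟨N, hN, k, hk⟩ := c.exists_num_eq hf hlin τ
  have hdet : IsUnit (Polynomial.C (-det2 c.a c.b)) :=
    (IsUnit.mk0 _ (neg_ne_zero.mpr c.det_ne_zero)).map Polynomial.C
  unfold point
  rw [← rootMultiplicity_lineRestrict_eq hAhom hA0 c.det_ne_zero]
  suffices hle : (lineRestrict c.a c.b A).rootMultiplicity τ = c.order τ - 1 by omega
  refine le_antisymm ?_ ?_
  · have hden := c.den_eval_ne_zero hreg hτ
    obtain ⟨q, hq, hqτ⟩ := exists_wronskian_eq_pow_mul hpos (hN k) hk hden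
    have hdvd : lineRestrict c.a c.b A ∣
        Polynomial.C (d : ℂ) * Polynomial.wronskian c.den (c.num k) := by
      rw [den, num, wronskian_lineRestrict (hf _) (isHomogeneous_numForm hf k)]
      refine (map_dvd _ ?_).mul_left _
      have : jacobian (f (chartIndex P)) (numForm f P k) =
          C (P.rep (chartIndex P)) * jacobian (f (chartIndex P)) (f (affineIndex P k)) := by
        simp only [jacobian, numForm, map_sub, Derivation.leibniz, pderiv_C, smul_eq_mul,
          mul_zero, add_zero]
        ring
      rw [this]
      exact (h.dvd_jacobian _ _).mul_left _
    have hW : Polynomial.C (d : ℂ) * Polynomial.wronskian c.den (c.num k) =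
        (Polynomial.X - Polynomial.C τ) ^ (c.order τ - 1) * (Polynomial.C (d : ℂ) * q) := by
      rw [hq]
      ring
    have hqτ' : (Polynomial.C (d : ℂ) * q).eval τ ≠ 0 := by
      rw [Polynomial.eval_mul, Polynomial.eval_C]
      exact mul_ne_zero (Nat.cast_ne_zero.mpr hd.ne') hqτ
    have hWne : Polynomial.C (d : ℂ) * Polynomial.wronskian c.den (c.num k) ≠ 0 := by
      rw [hW]
      refine mul_ne_zero (pow_ne_zero _ (Polynomial.X_sub_C_ne_zero τ)) fun h0 => hqτ' ?_
      rw [h0, Polynomial.eval_zero]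
    rw [← rootMultiplicity_eq_of_eq_pow_mul hW hqτ']
    exact Polynomial.rootMultiplicity_le_rootMultiplicity_of_dvd hWne hdvd τ
  · have hgreg := h.noCommonZero hd hf hlin (τ • c.a + c.b) (smul_add_ne_zero c.det_ne_zero τ)
    obtain ⟨m, hm⟩ := Function.ne_iff.mp hgreg
    have hm' : (lineRestrict c.a c.b (g m)).eval τ ≠ 0 := by
      rw [eval_lineRestrict]
      exact hm
    have hpow : ∀ j k, (Polynomial.X - Polynomial.C τ) ^ (c.order τ - 1) ∣
        lineRestrict c.a c.b (jacobian (f j) (f k)) := by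
      intro j k
      rw [← hdet.dvd_mul_left, ← wronskian_lineRestrict (hf j) (hf k)]
      exact (c.pow_dvd_wronskian_lineRestrict (fun k => ⟨_, hN k⟩) j k).mul_left _
    have hdvd : (Polynomial.X - Polynomial.C τ) ^ (c.order τ - 1) ∣
        lineRestrict c.a c.b A * lineRestrict c.a c.b (g m) := by
      rw [← map_mul, h.mul_eq]
      rcases (show ∀ k : Fin 3, k = 0 ∨ k = 1 ∨ k = 2 by decide) m with rfl | rfl | rfl
      · exact hpow _ _
      · exact hpow _ _
      · exact hpow _ _
    rw [Polynomial.le_rootMultiplicity_iff hlA]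
    refine IsCoprime.dvd_of_dvd_mul_right (IsCoprime.pow_left ?_) hdvd
    refine isCoprime_of_no_common_root fun σ hσ => ?_
    rw [Polynomial.eval_sub, Polynomial.eval_X, Polynomial.eval_C, sub_eq_zero] at hσ
    rwa [hσ]

end Chart

/-! ### The sum over the singular points -/

theorem vanishingOrder_eq_zero {A : MvPolynomial (Fin 2) ℂ} {Q : P1} (h : eval Q.rep A ≠ 0) :
    vanishingOrder A Q = 0 := by
  refine multiplicity_eq_zero.mpr fun hdvd => h ?_
  obtain ⟨B, hB⟩ := hdvd
  rw [hB, map_mul, eval_linForm]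
  have : det2 Q.rep Q.rep = 0 := by
    unfold det2
    ring
  rw [this, zero_mul]

/-- Each branch contributes its multiplicity to the multiplicity of the curve, and its multiplicity
is one more than the order of vanishing of `A`. -/
theorem multiplicityAt_eq_sum_add_branchesAt {d : ℕ} (hd : 0 < d)
    {f g : Fin 3 → MvPolynomial (Fin 2) ℂ}
    (hf : ∀ i, (f i).IsHomogeneous d) (hreg : NoCommonZero f) (hlin : LinearIndependent ℂ f)
    (hinj : GenericallyOneToOne (projMap f hreg)) {F : MvPolynomial (Fin 3) ℂ}
    (hE : IsEquation f F) {A : MvPolynomial (Fin 2) ℂ} (h : IsDualMap f A g) (P : P2) :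
    multiplicityAt F P = ∑ Q ∈ (finite_fibre hf hreg hlin P).toFinset, vanishingOrder A Q +
      branchesAt F P := by
  classical
  obtain ⟨c⟩ := nonempty_chart hd hf P
  have hset : (finite_fibre hf hreg hlin P).toFinset =
      (c.finite_setOf_eval_num_eq_zero hf hlin).toFinset.image c.point := by
    ext Q
    rw [Set.Finite.mem_toFinset, Set.mem_ofPred_eq, Finset.mem_image]
    constructor
    · intro hQ
      obtain ⟨τ, rfl⟩ := c.exists_point_of_projMap_eq hf hreg (Q := Q)
        (by rw [hQ]; exact rep_chartIndex_ne_zero P)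
      exact ⟨τ, (Set.Finite.mem_toFinset _).mpr ((c.projMap_point_eq_iff hf hreg τ).mp hQ), rfl⟩
    · rintro ⟨τ, hτ, rfl⟩
      exact (c.projMap_point_eq_iff hf hreg τ).mpr ((Set.Finite.mem_toFinset _).mp hτ)
  rw [hset, Finset.sum_image fun τ _ σ _ (h : c.point τ = c.point σ) =>
      linePoint_injective c.det_ne_zero h,
    c.multiplicityAt_eq hd hf hreg hlin hinj hE, c.branchesAt_eq hd hf hreg hlin hinj hE,
    Set.ncard_eq_toFinset_card _ (c.finite_setOf_eval_num_eq_zero hf hlin), Finset.card_eq_sum_ones,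
    ← Finset.sum_add_distrib]
  refine Finset.sum_congr rfl fun τ hτ => ?_
  exact (c.vanishingOrder_add_one h hd hf hreg hlin ((Set.Finite.mem_toFinset _).mp hτ)).symm

/-- A point at which the gradient does not vanish has multiplicity at most one. -/
theorem multiplicityAt_le_one {n : ℕ} {F : MvPolynomial (Fin 3) ℂ} (hF : F.IsHomogeneous n)
    {P : P2} (hP : P ∈ curvePoints F) (hgrad : gradient F P.rep ≠ 0) :
    multiplicityAt F P ≤ 1 := by
  refine Nat.sInf_le fun h1 => hgrad ?_
  have hslope : ∀ a : Fin 2 → ℂ, ∑ k, a k * gradient F P.rep (affineIndex P k) = 0 := by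
    intro a
    have h2 := coeff_lineRestrict_zero a (localEquation F P) 1
    have h3 : lineRestrict a 0 (localEquation F P) = lineRestrict
        ((chartIndex P).insertNth (α := fun _ => ℂ) 0 a) P.rep F := by
      unfold lineRestrict
      rw [aeval_localEquation]
      congr 2
      funext j
      obtain rfl | ⟨k, rfl⟩ := index_cases P j
      · simp
      · rw [affinePoint_affineIndex]
        simp [affineIndex]
    have h4 : (Polynomial.derivative (lineRestrict a 0 (localEquation F P))).eval 0 = 0 := by
      rw [← Polynomial.coeff_zero_eq_eval_zero, Polynomial.coeff_derivative, zero_add, h2, h1,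
        map_zero, zero_mul]
    rw [h3, derivative_lineRestrict, Polynomial.eval_finsetSum,
      Fin.sum_univ_succAbove _ (chartIndex P)] at h4
    simp only [Polynomial.eval_mul, Polynomial.eval_C, eval_lineRestrict, zero_smul, zero_add,
      Fin.insertNth_apply_same, Fin.insertNth_apply_succAbove, zero_mul] at h4
    exact h4
  have haff : ∀ k, gradient F P.rep (affineIndex P k) = 0 := by
    intro k
    simpa [Pi.single_apply] using hslope (Pi.single k 1)
  have heuler : ∑ i, P.rep i * gradient F P.rep i = 0 := by
    have := congrArg (eval P.rep) hF.sum_X_mul_pderiv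
    rw [map_sum, map_nsmul, show eval P.rep F = 0 from hP, smul_zero] at this
    simpa [gradient] using this
  rw [Fin.sum_univ_succAbove _ (chartIndex P)] at heuler
  have hzero : ∀ k, gradient F P.rep ((chartIndex P).succAbove k) = 0 := haff
  simp only [hzero, mul_zero, Finset.sum_const_zero, add_zero, mul_eq_zero] at heuler
  funext j
  obtain rfl | ⟨k, rfl⟩ := index_cases P j
  · exact heuler.resolve_left (rep_chartIndex_ne_zero P)
  · exact haff k

/-- Every point of the curve is in the image of the parametrization, so has a branch. -/
theorem branchesAt_pos {d : ℕ} (hd : 0 < d) {f : Fin 3 → MvPolynomial (Fin 2) ℂ}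
    (hf : ∀ i, (f i).IsHomogeneous d) (hreg : NoCommonZero f) (hlin : LinearIndependent ℂ f)
    (hinj : GenericallyOneToOne (projMap f hreg)) {F : MvPolynomial (Fin 3) ℂ}
    (hE : IsEquation f F) {P : P2} (hP : P ∈ curvePoints F) : 0 < branchesAt F P := by
  obtain ⟨c⟩ := nonempty_chart hd hf P
  rw [c.branchesAt_eq hd hf hreg hlin hinj hE,
    Set.ncard_pos (c.finite_setOf_eval_num_eq_zero hf hlin)]
  exact c.exists_point_of_mem_curvePoints hd hf hreg hlin hE hP

/-- The zeros of `A` are grouped by their images. A nonsingular point has multiplicity one and one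
branch, so it is not the image of a zero of `A`. -/
theorem totalDegree_eq_finsum {d : ℕ} (hd : 0 < d) {f g : Fin 3 → MvPolynomial (Fin 2) ℂ}
    (hf : ∀ i, (f i).IsHomogeneous d) (hreg : NoCommonZero f) (hlin : LinearIndependent ℂ f)
    (hinj : GenericallyOneToOne (projMap f hreg)) {F : MvPolynomial (Fin 3) ℂ}
    (hE : IsEquation f F) {A : MvPolynomial (Fin 2) ℂ} (h : IsDualMap f A g) :
    (A.totalDegree : ℤ) =
      ∑ᶠ P ∈ singularPoints F, ((multiplicityAt F P : ℤ) - (branchesAt F P : ℤ)) := by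
  classical
  have hA := h.isHomogeneous_gcd hd hf hlin
  have hA0 := h.gcd_ne_zero hd hf hlin
  have hfib : ∀ P, (multiplicityAt F P : ℤ) - (branchesAt F P : ℤ) =
      ∑ Q ∈ (finite_fibre hf hreg hlin P).toFinset, (vanishingOrder A Q : ℤ) := by
    intro P
    rw [multiplicityAt_eq_sum_add_branchesAt hd hf hreg hlin hinj hE h P]
    push_cast
    ring
  have hsum : (A.totalDegree : ℤ) =
      ∑ P ∈ (finite_setOf_eval_eq_zero hA hA0).toFinset.image (projMap f hreg),
        ((multiplicityAt F P : ℤ) - (branchesAt F P : ℤ)) := by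
    rw [congrArg (Nat.cast (R := ℤ)) (totalDegree_eq_sum_vanishingOrder hA hA0), Nat.cast_sum,
      ← Finset.sum_fiberwise_of_maps_to fun Q hQ => Finset.mem_image_of_mem (projMap f hreg) hQ]
    refine Finset.sum_congr rfl fun P _ => ?_
    rw [hfib]
    refine Finset.sum_subset ?_ ?_
    · intro Q hQ
      exact (Set.Finite.mem_toFinset _).mpr (Finset.mem_filter.mp hQ).2
    · intro Q hQ hQ'
      rw [Set.Finite.mem_toFinset] at hQ
      rw [vanishingOrder_eq_zero, Nat.cast_zero]
      intro h0
      exact hQ' (Finset.mem_filter.mpr ⟨(Set.Finite.mem_toFinset _).mpr h0, hQ⟩)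
  rw [hsum]
  symm
  refine finsum_mem_eq_sum_of_inter_support_eq _ ?_
  ext P
  rw [Set.mem_inter_iff, Set.mem_inter_iff, and_congr_left_iff]
  intro hne
  rw [Function.mem_support] at hne
  constructor
  · intro _
    rw [hfib] at hne
    obtain ⟨Q, hQ, hv⟩ := Finset.exists_ne_zero_of_sum_ne_zero hne
    rw [Set.Finite.mem_toFinset] at hQ
    refine Finset.mem_coe.mpr (Finset.mem_image.mpr
      ⟨Q, (Set.Finite.mem_toFinset _).mpr ?_, hQ⟩)
    by_contra h0
    exact hv (by rw [vanishingOrder_eq_zero h0, Nat.cast_zero])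
  · intro hP
    obtain ⟨Q, -, rfl⟩ := Finset.mem_image.mp (Finset.mem_coe.mp hP)
    have hmem : projMap f hreg Q ∈ curvePoints F := by
      rw [hE.curvePoints_eq hd hf hreg hlin]
      exact ⟨Q, rfl⟩
    refine ⟨hmem, ?_⟩
    by_contra hgrad
    have h1 := multiplicityAt_le_one hE.isHomogeneous hmem hgrad
    have h2 := branchesAt_pos hd hf hreg hlin hinj hE hmem
    have h3 := multiplicityAt_eq_sum_add_branchesAt hd hf hreg hlin hinj hE h (projMap f hreg Q)
    omega

theorem IsEquation.isReducedEquation {d : ℕ} (hd : 0 < d) {f : Fin 3 → MvPolynomial (Fin 2) ℂ}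
    (hf : ∀ i, (f i).IsHomogeneous d) (hreg : NoCommonZero f) (hlin : LinearIndependent ℂ f)
    {F : MvPolynomial (Fin 3) ℂ} (hE : IsEquation f F) :
    IsReducedEquation F (Set.range (projMap f hreg)) :=
  ⟨hE.isHomogeneous, hE.irreducible.squarefree, hE.curvePoints_eq hd hf hreg hlin⟩

end RationalPlaneCurve

theorem theorem3p4
    (d : ℕ) (hd : 2 ≤ d)
    (f : Fin 3 → MvPolynomial (Fin 2) ℂ)
    (hf : ∀ i, (f i).IsHomogeneous d)
    (hreg : NoCommonZero f)
    (hinj : GenericallyOneToOne (projMap f hreg))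
    (F : MvPolynomial (Fin 3) ℂ)
    (hF : IsReducedEquation F (Set.range (projMap f hreg)))
    (A : MvPolynomial (Fin 2) ℂ)
    (hA : ∀ B : MvPolynomial (Fin 2) ℂ,
      B ∣ A ↔ B ∣ minor f 0 1 ∧ B ∣ minor f 0 2 ∧ B ∣ minor f 1 2)
    (fdual : Fin 3 → MvPolynomial (Fin 2) ℂ)
    (h0 : A * fdual 0 = minor f 1 2)
    (h1 : A * fdual 1 = -minor f 0 2)
    (h2 : A * fdual 2 = minor f 0 1) :
    (∃ Fdual : MvPolynomial (Fin 3) ℂ,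
      IsReducedEquation Fdual (dualCurve F) ∧
      ∀ i, (fdual i).IsHomogeneous Fdual.totalDegree ∧
        (fdual i).totalDegree = Fdual.totalDegree) ∧
    (∃ hdual : NoCommonZero fdual,
      Set.range (projMap fdual hdual) = dualCurve F ∧
      GenericallyOneToOne (projMap fdual hdual)) ∧
    (singularPoints F).Finite ∧
    (A.totalDegree : ℤ) =
      ∑ᶠ P ∈ singularPoints F, ((multiplicityAt F P : ℤ) - (branchesAt F P : ℤ)) := by
  have hd0 : 0 < d := by omega
  have hlin := linearIndependent_of_genericallyOneToOne hd hf hreg hinj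
  have hE := hF.isEquation hd0 hf hreg hlin
  have hdm : IsDualMap f A fdual := ⟨hA, h0, h1, h2⟩
  have hg := hdm.isHomogeneous hd0 hf hlin
  have hgreg := hdm.noCommonZero hd0 hf hlin
  have hglin := hdm.linearIndependent hd0 hf hlin
  have he := hdm.totalDegree_pos hd0 hf hlin
  obtain ⟨n, H, hH0, hHn, hH⟩ := hE.exists_gradient_eq hd0 hf hlin hg hgreg (hglin.ne_zero 0)
    (hdm.sum_mul_pderiv hd0 hf hlin)
  -- so the polar map of the curve is the dual parametrization, up to the factor `H`
  have hdual := hE.dualCurve_eq hd0 he hf hreg hlin hg hgreg hglin hH0 hH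
  obtain ⟨G, hG⟩ := exists_isEquation he hg hglin
  -- biduality: the polar map of the dual curve is the original parametrization
  obtain ⟨n', H', hH0', hHn', hH'⟩ := hG.exists_gradient_eq he hg hglin hf hreg (hlin.ne_zero 0)
    (hdm.sum_pderiv_mul hd0 hf hlin)
  have hginj := hG.genericallyOneToOne hf hreg hlin hinj hg hgreg hH0' hHn' hH'
  have hdeg := hG.totalDegree_eq he hg hgreg hglin hginj
  refine ⟨⟨G, ?_, fun i => ?_⟩, ⟨hgreg, hdual.symm, hginj⟩,
    hE.finite_singularPoints hd0 hf hreg hlin hgreg hH0 hHn hH,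
    totalDegree_eq_finsum hd0 hf hreg hlin hinj hE hdm⟩
  · rw [hdual]
    exact hG.isReducedEquation he hg hgreg hglin
  · rw [hdeg]
    exact ⟨hg i, (hg i).totalDegree (hglin.ne_zero i)⟩
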